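/- Let $k$ be a field of arbitrary characteristic, $V$ a finite-dimensional $k$-vector space, $G$ a finite group acting linearly on $V$ (written ${}^g v$), and $A=S(V)\#G$ the skew group algebra, graded by $\deg v=1$, $\deg g=0$ (so $A_0=kG$). *Resolution.* Let $X_{i,j}=A\otimes (kG)^{\otimes i}\otimes\bigwedge^j V\otimes A$ and $X_n=\bigoplus_{i+j=n}X_{i,j}$, with differential $d$ the sum of the $A$-bimodule maps $$d^h(1\otimes g_1\otimes\cdots\otimes g_i\otimes x\otimes 1)=g_1\otimes\cdots\otimes g_i\otimes x\otimes 1+\sum_{l=1}^{i-1}(-1)^l\otimes g_1\otimes\cdots\otimes g_lg_{l+1}\otimes\cdots\otimes g_i\otimes x\otimes 1+(-1)^i\otimes g_1\otimes\cdots\otimes g_{i-1}\otimes{}^{g_i}x\otimes g_i,$$ $$d^v(1\otimes g_1\otimes\cdots\otimes g_i\otimes v_1\wedge\cdots\wedge v_j\otimes 1)=(-1)^i\sum_{l=1}^{j}(-1)^{l+1}\bigl({}^{g_1\cdots g_i}v_l\otimes g_1\otimes\cdots\otimes g_i\otimes v_1\wedge\cdots\hat v_l\cdots\wedge v_j\otimes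 1-1\otimes g_1\otimes\cdots\otimes g_i\otimes v_1\wedge\cdots\hat v_l\cdots\wedge v_j\otimes v_l\bigr).$$ An $n$-cochain on $X_\bullet$ is an $A$-bimodule map $X_n\to A$, and $d^*f=f\circ d$. The space $X_n$ is graded by the degree of $A$ in the outer factors, with $\bigwedge^jV$ in degree $j$ and $kG$ in degree $0$. *Chain maps.* Let $A^{\otimes(\bullet+2)}$ be the bar resolution with differential $\delta(a_0\otimes\cdots\otimes a_{n+1})=\sum_{i=0}^n(-1)^i a_0\otimes\cdots\otimes a_ia_{i+1}\otimes\cdots\otimes a_{n+1}$. Let $\phi_3:X_3\to A^{\otimes 5}$ be the bimodule map with $$\begin{aligned} 1\otimes g\otimes h\otimes \ell\otimes 1&\mapsto 1\otimes g\otimes h\otimes \ell\otimes 1,\\ 1\otimes g\otimes h\otimes v\otimes 1&\mapsto 1\otimes g\otimes h\otimes v\otimes 1-1\otimes g\otimes{}^hv\otimes h\otimes 1+1\otimes{}^{gh}v\otimes g\otimes h\otimes 1,\\ 1\otimes g\otimes v\wedge w\otimes 1&\mapsto B(v,w)-B(w,v),\\ 1\otimes v_1\wedge v_2\wedge v_3\otimes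 1&\mapsto\sum_{\sigma\in \mathrm{Sym}_3}\operatorname{sgn}\sigma\otimes v_{\sigma(1)}\otimes v_{\sigma(2)}\otimes v_{\sigma(3)}\otimes 1, \end{aligned}$$ where $B(v,w)=1\otimes g\otimes v\otimes w\otimes 1+1\otimes{}^gv\otimes{}^gw\otimes g\otimes 1-1\otimes{}^gv\otimes g\otimes w\otimes 1$. Let $\psi_\bullet:A^{\otimes(\bullet+2)}\to X_\bullet$ be any chain map of $A$-bimodules of degree $0$ with $\psi_0=\mathrm{id}_{A\otimes A}$ such that, for all $g,h\in G$ and $v,w\in V$: $\psi_1(1\otimes g\otimes1)=1\otimes g\otimes1$; $\psi_1(1\otimes v\otimes1)=1\otimes v\otimes 1$; $\psi_1(1\otimes vg\otimes1)=1\otimes v\otimes g+v\otimes g\otimes1$ if $g\ne1$; $\psi_2(1\otimes g\otimes h\otimes1)=1\otimes g\otimes h\otimes1\in X_{2,0}$; $\psi_2(1\otimes g\otimes v\otimes1-1\otimes{}^gv\otimes g\otimes1)=1\otimes g\otimes v\otimes1\in X_{1,1}$; $\psi_2(1\otimes v\otimes g\otimes1)=0$ if $g\neq1$; $\psi_2(1\otimes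 v\otimes w\otimes1-1\otimes w\otimes v\otimes1)=1\otimes v\wedge w\otimes1\in X_{0,2}$. *Bracket.* For 2-cochains $f,g$ on $X_\bullet$ write $\psi^*f(a\otimes b)=f(\psi_2(1\otimes a\otimes b\otimes 1))$ and, for linear $\mu,\nu:A\otimes A\to A$, $(\mu\circ\nu)(a\otimes b\otimes c)=\mu(\nu(a\otimes b)\otimes c)-\mu(a\otimes\nu(b\otimes c))$. The Gerstenhaber bracket on $X_\bullet$ is $[f,g]=\phi_3^*\bigl(\psi^*f\circ\psi^*g+\psi^*g\circ\psi^*f\bigr)$, and we set $\tfrac12[f,f]:=\phi_3^*(\psi^*f\circ\psi^*f)$, which makes sense in every characteristic. A noncommutative Poisson structure is a 2-cochain $f$ with $d^*f=0$ and $[f,f]=d^*\eta$ for some 2-cochain $\eta$. *Statement.* Let $\lambda$ be a noncommutative Poisson structure on $A$, given as a 2-cochain on $X_\bullet$ of degree $-1$ that vanishes on $X_{0,2}$, and let $\kappa$ be a 2-cochain on $X_\bullet$ such that $$\tfrac12[\lambda,\lambda]=d^*\kappa\qquad\text{and}\qquad[\lambda,\kappa]=0$$ as cochains on $X_\bullet$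 (in characteristic $\ne2$ the first equation is $[\lambda,\lambda]=2d^*\kappa$). Then $\lambda$ lifts to a graded deformation of $A$. That is, there is an associative $k[t]$-bilinear product $*$ on $A[t]$ with identity $1_A$ such that $a*b=ab+\mu_1(a\otimes b)t+\mu_2(a\otimes b)t^2+\cdots$ (a finite sum) for all $a,b\in A$, where each $\mu_j:A\otimes A\to A$ is $k$-linear and homogeneous of degree $-j$, and $$\mu_1=\psi^*\lambda .$$ Moreover the deformation can be chosen such that its fiber $A[t]/(t-1)A[t]$ at $t=1$ is isomorphic as a $k$-algebra to $\mathcal H_{\lambda,\kappa}$, the $k$-algebra generated by the vector space $V$ and the group algebra $kG$ with relations $$vw-wv=\kappa(v,w),\qquad gv-{}^gv\,g=\lambda(g,v)\qquad(v,w\in V,\ g\in G),$$ where $\lambda(g,v)=\lambda(1\otimes g\otimes v\otimes1)\in kG$ and $\kappa(v,w)\in kG$ is the degree $0$ component of $\kappa(1\otimes v\wedge w\otimes1)$ (which is all of it when $\kappa$ has degree $-2$). -/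

import Mathlib

open scoped TensorProduct

noncomputable section

namespace SkewDeformation

open MulOpposite Polynomial

/-! ### The skew group algebra `A = S(V) # G` and its grading -/

section SkewGroupAlgebra

variable (k V G : Type*) [Field k] [AddCommGroup V] [Module k V] [Group G]
  [DistribMulAction G V] [SMulCommClass G k V]

/-- The automorphism of `S(V)` which extends the action of `g` on `V`. -/
def symAct (g : G) : SymmetricAlgebra k V →ₐ[k] SymmetricAlgebra k V :=
  SymmetricAlgebra.lift (SymmetricAlgebra.ι k V ∘ₗ DistribSMul.toLinearMap k V g)

theorem symAct_one : symAct k V G 1 = AlgHom.id k _ := by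
  apply SymmetricAlgebra.algHom_ext
  ext v
  simp [symAct]

theorem symAct_mul (g h : G) :
    symAct k V G (g * h) = (symAct k V G g).comp (symAct k V G h) := by
  apply SymmetricAlgebra.algHom_ext
  ext v
  simp [symAct, mul_smul]

/-- `G` acts on `S(V)` by algebra automorphisms. -/
instance symMulSemiringAction : MulSemiringAction G (SymmetricAlgebra k V) where
  smul g s := symAct k V G g s
  one_smul s := by
    change symAct k V G 1 s = s
    rw [symAct_one]; rfl
  mul_smul g h s := by
    change symAct k V G (g * h) s = symAct k V G g (symAct k V G h s)
    rw [symAct_mul]; rfl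
  smul_zero g := map_zero (symAct k V G g)
  smul_add g := map_add (symAct k V G g)
  smul_one g := map_one (symAct k V G g)
  smul_mul g := map_mul (symAct k V G g)

instance symSMulCommClass : SMulCommClass G k (SymmetricAlgebra k V) where
  smul_comm g c s := map_smul (symAct k V G g) c s

/-- The skew group algebra `S(V) # G`: its elements are the finite sums `∑ s_g g` with `s_g` in
`S(V)`, and `(r g) (s h) = r (g • s) (g h)`. -/
def Skew := SkewMonoidAlgebra (SymmetricAlgebra k V) G

instance skewRing : Ring (Skew k V G) :=
  inferInstanceAs (Ring (SkewMonoidAlgebra (SymmetricAlgebra k V) G))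

instance skewAlgebra : Algebra k (Skew k V G) :=
  inferInstanceAs (Algebra k (SkewMonoidAlgebra (SymmetricAlgebra k V) G))

/-- The element `s g` of `S(V) # G`, as a linear function of `s`. -/
def mono (g : G) : SymmetricAlgebra k V →ₗ[k] Skew k V G where
  toFun s := (SkewMonoidAlgebra.single g s : SkewMonoidAlgebra (SymmetricAlgebra k V) G)
  map_add' s t := SkewMonoidAlgebra.single_add g s t
  map_smul' c s := (SkewMonoidAlgebra.smul_single c g s).symm

theorem mono_mul_mono (g h : G) (r s : SymmetricAlgebra k V) :
    mono k V G g r * mono k V G h s = mono k V G (g * h) (r * g • s) :=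
  SkewMonoidAlgebra.single_mul_single

variable {G} in
/-- A group element, as an element of `A`. -/
def gA (g : G) : Skew k V G := mono k V G g 1

/-- The inclusion of `V` in `A`. -/
def vA : V →ₗ[k] Skew k V G := mono k V G 1 ∘ₗ SymmetricAlgebra.ι k V

variable {V} in
theorem gA_mul_vA (g : G) (v : V) :
    gA k V g * vA k V G v = vA k V G (g • v) * gA k V g := by
  have h : g • SymmetricAlgebra.ι k V v = SymmetricAlgebra.ι k V (g • v) := by
    change symAct k V G g _ = _
    simp [symAct]
  simp [gA, vA, mono_mul_mono, h]

/-- The homogeneous component `A_n`, spanned by the `s g` with `g ∈ G` and `s ∈ S^n(V)`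
(here `deg v = 1` and `deg g = 0`); it is zero for `n < 0`. -/
def aGr (n : ℤ) : Submodule k (Skew k V G) :=
  Submodule.span k {x | ∃ (m : ℕ) (g : G) (s : SymmetricAlgebra k V), (m : ℤ) = n ∧
    s ∈ (LinearMap.range (SymmetricAlgebra.ι k V)) ^ m ∧ x = mono k V G g s}

/-- The projection of `A` onto its degree zero component `A_0 = kG`. -/
def projkG : Skew k V G →ₗ[k] MonoidAlgebra k G :=
  (MonoidAlgebra.coeffLinearEquiv k).symm.toLinearMap ∘ₗ
    Finsupp.mapRange.linearMap (SymmetricAlgebra.algebraMapInv (R := k) (M := V)).toLinearMap ∘ₗ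
      (SkewMonoidAlgebra.coeffLinearEquiv (S := k) (k := SymmetricAlgebra k V)
        (G := G)).toLinearMap

/-! ### Free `A`-bimodules -/

/-- The enveloping algebra `A ⊗ Aᵒᵖ`. -/
def Env := Skew k V G ⊗[k] (Skew k V G)ᵐᵒᵖ

instance envRing : Ring (Env k V G) :=
  inferInstanceAs (Ring (Skew k V G ⊗[k] (Skew k V G)ᵐᵒᵖ))

instance envAlgebra : Algebra k (Env k V G) :=
  inferInstanceAs (Algebra k (Skew k V G ⊗[k] (Skew k V G)ᵐᵒᵖ))

/-- The element `a ⊗ b` of the enveloping algebra, as a bilinear function of `a` and `b`. -/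
def env : Skew k V G →ₗ[k] Skew k V G →ₗ[k] Env k V G :=
  (TensorProduct.mk k (Skew k V G) (Skew k V G)ᵐᵒᵖ).compl₂
    (MulOpposite.opLinearEquiv k).toLinearMap

theorem env_mul_env (a b a' b' : Skew k V G) :
    env k V G a b * env k V G a' b' = env k V G (a * a') (b' * b) :=
  Algebra.TensorProduct.tmul_mul_tmul a a' (op b) (op b')

theorem env_one_one : env k V G 1 1 = 1 := rfl

/-- `A` is a module over its enveloping algebra through `(a ⊗ b) • x = a * x * b`. -/
instance envModule : Module (Env k V G) (Skew k V G) :=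
  Module.compHom (Skew k V G) (AlgHom.mulLeftRight k (Skew k V G)).toRingHom

theorem env_smul (a b x : Skew k V G) : env k V G a b • x = a * x * b :=
  AlgHom.mulLeftRight_apply k (Skew k V G) a (op b) x

instance envIsScalarTower : IsScalarTower k (Env k V G) (Skew k V G) where
  smul_assoc c e x := LinearMap.congr_fun
    (map_smul (AlgHom.mulLeftRight k (Skew k V G)).toLinearMap c e) x

/-- The free bimodule `A ⊗ W ⊗ A` on a `k`-module `W`, realized as `(A ⊗ Aᵒᵖ) ⊗ W`. Bimodules
are treated as left modules over the enveloping algebra. -/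
def Bimod (W : Type*) [AddCommGroup W] [Module k W] := Env k V G ⊗[k] W

section Bimod

variable (W : Type*) [AddCommGroup W] [Module k W]

instance bimodAddCommGroup : AddCommGroup (Bimod k V G W) :=
  inferInstanceAs (AddCommGroup (Env k V G ⊗[k] W))

instance bimodModule : Module k (Bimod k V G W) :=
  inferInstanceAs (Module k (Env k V G ⊗[k] W))

instance bimodEnvModule : Module (Env k V G) (Bimod k V G W) :=
  inferInstanceAs (Module (Env k V G) (Env k V G ⊗[k] W))

instance bimodIsScalarTower : IsScalarTower k (Env k V G) (Bimod k V G W) :=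
  inferInstanceAs (IsScalarTower k (Env k V G) (Env k V G ⊗[k] W))

end Bimod

variable {W N : Type*} [AddCommGroup W] [Module k W] [AddCommGroup N] [Module k N]
  [Module (Env k V G) N] [IsScalarTower k (Env k V G) N]

/-- The element `a ⊗ w ⊗ b` of `A ⊗ W ⊗ A` is `tri a b w`. -/
def tri : Skew k V G →ₗ[k] Skew k V G →ₗ[k] W →ₗ[k] Bimod k V G W :=
  (env k V G).compr₂ (TensorProduct.mk k (Env k V G) W)

theorem env_smul_tri (a b a' b' : Skew k V G) (w : W) :
    env k V G a b • tri k V G a' b' w = tri k V G (a * a') (b' * b) w := by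
  change (env k V G a b * env k V G a' b') ⊗ₜ[k] w = _
  rw [env_mul_env]
  rfl

/-- The bimodule map `A ⊗ W ⊗ A → N` with `1 ⊗ w ⊗ 1 ↦ f w`. -/
def bimodLift (f : W →ₗ[k] N) : Bimod k V G W →ₗ[Env k V G] N :=
  TensorProduct.AlgebraTensorModule.lift
    { toFun := fun e => (Algebra.lsmul k k N e) ∘ₗ f
      map_add' := fun e e' => by ext w; simp
      map_smul' := fun c e => by ext w; simp }

theorem bimodLift_tri (f : W →ₗ[k] N) (a b : Skew k V G) (w : W) :
    bimodLift k V G f (tri k V G a b w) = env k V G a b • f w := rfl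

/-- The map `A ⊗ W → A ⊗ W ⊗ A`, `a ⊗ w ↦ a ⊗ w ⊗ 1`. -/
def outL : Skew k V G ⊗[k] W →ₗ[k] Bimod k V G W :=
  TensorProduct.lift ((tri k V G).flip 1)

/-- The map `W ⊗ A → A ⊗ W ⊗ A`, `w ⊗ b ↦ 1 ⊗ w ⊗ b`. -/
def outR : W ⊗[k] Skew k V G →ₗ[k] Bimod k V G W :=
  TensorProduct.lift (tri k V G 1).flip

/-- The grading of `A ⊗ W ⊗ A` induced by a grading of `W`. -/
def bimodGr (gr : ℤ → Submodule k W) (n : ℤ) : Submodule k (Bimod k V G W) :=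
  Submodule.span k {x | ∃ (p q r : ℤ) (a b : Skew k V G) (w : W), p + q + r = n ∧
    a ∈ aGr k V G p ∧ b ∈ aGr k V G q ∧ w ∈ gr r ∧ x = tri k V G a b w}

/-- The grading of `M ⊗ M'` induced by gradings of `M` and `M'`. -/
def tensorGr {k M M' : Type*} [Field k] [AddCommGroup M] [Module k M] [AddCommGroup M']
    [Module k M'] (gr : ℤ → Submodule k M) (gr' : ℤ → Submodule k M') (n : ℤ) :
    Submodule k (M ⊗[k] M') :=
  Submodule.span k {x | ∃ (p q : ℤ) (m : M) (m' : M'), p + q = n ∧ m ∈ gr p ∧ m' ∈ gr' q ∧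
    x = m ⊗ₜ m'}

/-- A map is homogeneous of degree `d` with respect to the given gradings. -/
def HasDegree {k M M' : Type*} [Field k] [AddCommGroup M] [Module k M] [AddCommGroup M']
    [Module k M'] (gr : ℤ → Submodule k M) (gr' : ℤ → Submodule k M') (f : M → M') (d : ℤ) :
    Prop :=
  ∀ n, ∀ x ∈ gr n, f x ∈ gr' (n + d)

/-! ### The bar resolution of `A` in degrees `0, …, 3` -/

/-- The term `A ⊗ A` of the bar resolution. -/
abbrev Bar0 := Env k V G
/-- The term `A ⊗ A ⊗ A` of the bar resolution. -/
abbrev Bar1 := Bimod k V G (Skew k V G)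
/-- The term `A ⊗ (A ⊗ A) ⊗ A` of the bar resolution. -/
abbrev Bar2 := Bimod k V G (Skew k V G ⊗[k] Skew k V G)
/-- The term `A ⊗ (A ⊗ A ⊗ A) ⊗ A` of the bar resolution. -/
abbrev Bar3 := Bimod k V G (Skew k V G ⊗[k] (Skew k V G ⊗[k] Skew k V G))

/-- `1 ⊗ a ⊗ 1 ↦ a ⊗ 1 - 1 ⊗ a`. -/
def δ₁ : Bar1 k V G →ₗ[Env k V G] Bar0 k V G :=
  bimodLift k V G ((env k V G).flip 1 - env k V G 1)

/-- `1 ⊗ a ⊗ b ⊗ 1 ↦ a ⊗ b ⊗ 1 - 1 ⊗ ab ⊗ 1 + 1 ⊗ a ⊗ b`. -/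
def δ₂ : Bar2 k V G →ₗ[Env k V G] Bar1 k V G :=
  bimodLift k V G (outL k V G - tri k V G 1 1 ∘ₗ LinearMap.mul' k (Skew k V G) + outR k V G)

/-- `1 ⊗ a ⊗ b ⊗ c ⊗ 1 ↦ a ⊗ b ⊗ c ⊗ 1 - 1 ⊗ ab ⊗ c ⊗ 1 + 1 ⊗ a ⊗ bc ⊗ 1 - 1 ⊗ a ⊗ b ⊗ c`. -/
def δ₃ : Bar3 k V G →ₗ[Env k V G] Bar2 k V G :=
  bimodLift k V G (outL k V G
    - tri k V G 1 1 ∘ₗ LinearMap.rTensor _ (LinearMap.mul' k (Skew k V G)) ∘ₗ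
        (TensorProduct.assoc k _ _ _).symm.toLinearMap
    + tri k V G 1 1 ∘ₗ LinearMap.lTensor _ (LinearMap.mul' k (Skew k V G))
    - outR k V G ∘ₗ (TensorProduct.assoc k _ _ _).symm.toLinearMap)

theorem δ₁_apply (a : Skew k V G) :
    δ₁ k V G (tri k V G 1 1 a) = env k V G a 1 - env k V G 1 a := by
  rw [δ₁, bimodLift_tri, env_one_one, one_smul]
  simp

theorem δ₂_apply (a b : Skew k V G) :
    δ₂ k V G (tri k V G 1 1 (a ⊗ₜ b)) =
      tri k V G a 1 b - tri k V G 1 1 (a * b) + tri k V G 1 b a := by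
  rw [δ₂, bimodLift_tri, env_one_one, one_smul]
  simp [outL, outR]

theorem δ₃_apply (a b c : Skew k V G) :
    δ₃ k V G (tri k V G 1 1 (a ⊗ₜ (b ⊗ₜ c))) =
      tri k V G a 1 (b ⊗ₜ c) - tri k V G 1 1 ((a * b) ⊗ₜ c) + tri k V G 1 1 (a ⊗ₜ (b * c))
        - tri k V G 1 c (a ⊗ₜ b) := by
  rw [δ₃, bimodLift_tri, env_one_one, one_smul]
  simp [outL, outR]

/-- The grading of `A ⊗ A ⊗ A`. -/
def bar1Gr : ℤ → Submodule k (Bar1 k V G) := bimodGr k V G (aGr k V G)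
/-- The grading of `A ⊗ (A ⊗ A) ⊗ A`. -/
def bar2Gr : ℤ → Submodule k (Bar2 k V G) :=
  bimodGr k V G (tensorGr (aGr k V G) (aGr k V G))
/-- The grading of `A ⊗ (A ⊗ A ⊗ A) ⊗ A`. -/
def bar3Gr : ℤ → Submodule k (Bar3 k V G) :=
  bimodGr k V G (tensorGr (aGr k V G) (tensorGr (aGr k V G) (aGr k V G)))

/-! ### The resolution `X` -/

/-- `(kG)^{⊗ i} ⊗ ⋀^j V`, where `(kG)^{⊗ i}` is the free `k`-module on `G^i`:
`Finsupp.single ![g₁, …, gᵢ] x` is `g₁ ⊗ ⋯ ⊗ gᵢ ⊗ x`. -/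
abbrev XGen (i j : ℕ) := (Fin i → G) →₀ ⋀[k]^j V

/-- `X_{i,j} = A ⊗ (kG)^{⊗ i} ⊗ ⋀^j V ⊗ A`. -/
abbrev X (i j : ℕ) := Bimod k V G (XGen k V G i j)

/-- The horizontal differential `X_{i+1,j} → X_{i,j}`:
`1 ⊗ g₁ ⊗ ⋯ ⊗ gᵢ₊₁ ⊗ x ⊗ 1` is mapped to
`g₁ ⊗ g₂ ⊗ ⋯ ⊗ gᵢ₊₁ ⊗ x ⊗ 1 + ∑_{1 ≤ l ≤ i} (-1)^l ⊗ g₁ ⊗ ⋯ ⊗ g_l g_{l+1} ⊗ ⋯ ⊗ gᵢ₊₁ ⊗ x ⊗ 1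
+ (-1)^{i+1} ⊗ g₁ ⊗ ⋯ ⊗ gᵢ ⊗ gᵢ₊₁ • x ⊗ gᵢ₊₁`. -/
def dh (i j : ℕ) : X k V G (i + 1) j →ₗ[Env k V G] X k V G i j :=
  bimodLift k V G (Finsupp.lsum k fun g : Fin (i + 1) → G =>
    tri k V G (gA k V (g 0)) 1 ∘ₗ Finsupp.lsingle (Fin.tail g)
    + ∑ l : Fin i, (-1 : k) ^ ((l : ℕ) + 1) •
        (tri k V G 1 1 ∘ₗ Finsupp.lsingle (Fin.contractNth l.castSucc (· * ·) g))
    + (-1 : k) ^ (i + 1) • (tri k V G 1 (gA k V (g (Fin.last i))) ∘ₗ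
        Finsupp.lsingle (Fin.init g) ∘ₗ
          exteriorPower.map j (DistribSMul.toLinearMap k V (g (Fin.last i)))))

/-- For `g = (g₁, …, gᵢ)`, the map with `v ↦ (w₁, …, w_j) ↦
(g₁ ⋯ gᵢ) • v ⊗ g ⊗ w₁ ∧ ⋯ ∧ w_j ⊗ 1 - 1 ⊗ g ⊗ w₁ ∧ ⋯ ∧ w_j ⊗ v`. -/
def dvAux {i : ℕ} (j : ℕ) (g : Fin i → G) : V →ₗ[k] V [⋀^Fin j]→ₗ[k] X k V G i j where
  toFun v := ((tri k V G (vA k V G ((List.ofFn g).prod • v)) 1 - tri k V G 1 (vA k V G v)) ∘ₗ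
    Finsupp.lsingle g).compAlternatingMap (exteriorPower.ιMulti k j)
  map_add' v w := by
    ext x
    simp only [smul_add, map_add, LinearMap.add_apply, LinearMap.sub_apply,
      LinearMap.compAlternatingMap_apply, LinearMap.comp_apply, AlternatingMap.add_apply]
    abel
  map_smul' c v := by
    ext x
    simp only [smul_comm _ c v, map_smul, LinearMap.smul_apply, LinearMap.sub_apply,
      LinearMap.compAlternatingMap_apply, LinearMap.comp_apply, AlternatingMap.smul_apply,
      smul_sub, RingHom.id_apply]

/-- The vertical differential `X_{i,j+1} → X_{i,j}`:
`1 ⊗ g₁ ⊗ ⋯ ⊗ gᵢ ⊗ v₀ ∧ ⋯ ∧ v_j ⊗ 1` is mapped to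
`(-1)^i ∑_{0 ≤ l ≤ j} (-1)^l ((g₁ ⋯ gᵢ) • v_l ⊗ g₁ ⊗ ⋯ ⊗ gᵢ ⊗ v₀ ∧ ⋯ v̂_l ⋯ ∧ v_j ⊗ 1
- 1 ⊗ g₁ ⊗ ⋯ ⊗ gᵢ ⊗ v₀ ∧ ⋯ v̂_l ⋯ ∧ v_j ⊗ v_l)`. -/
def dv (i j : ℕ) : X k V G i (j + 1) →ₗ[Env k V G] X k V G i j :=
  bimodLift k V G (Finsupp.lsum k fun g : Fin i → G => (-1 : k) ^ i •
    exteriorPower.alternatingMapLinearEquiv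
      (AlternatingMap.alternatizeUncurryFin (dvAux k V G j g)))

/-- `X_0`. -/
abbrev X0 := X k V G 0 0
/-- `X_1 = X_{1,0} ⊕ X_{0,1}`. -/
abbrev X1 := X k V G 1 0 × X k V G 0 1
/-- `X_2 = X_{2,0} ⊕ X_{1,1} ⊕ X_{0,2}`. -/
abbrev X2 := X k V G 2 0 × X k V G 1 1 × X k V G 0 2
/-- `X_3 = X_{3,0} ⊕ X_{2,1} ⊕ X_{1,2} ⊕ X_{0,3}`. -/
abbrev X3 := X k V G 3 0 × X k V G 2 1 × X k V G 1 2 × X k V G 0 3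

/-- The differential `X_1 → X_0`. -/
def d₁ : X1 k V G →ₗ[Env k V G] X0 k V G := (dh k V G 0 0).coprod (dv k V G 0 0)

/-- The differential `X_2 → X_1`. -/
def d₂ : X2 k V G →ₗ[Env k V G] X1 k V G where
  toFun x := (dh k V G 1 0 x.1 + dv k V G 1 0 x.2.1, dh k V G 0 1 x.2.1 + dv k V G 0 1 x.2.2)
  map_add' x y := by ext <;> simp <;> abel
  map_smul' c x := by ext <;> simp [smul_add]

/-- The differential `X_3 → X_2`. -/
def d₃ : X3 k V G →ₗ[Env k V G] X2 k V G where
  toFun x := (dh k V G 2 0 x.1 + dv k V G 2 0 x.2.1, dh k V G 1 1 x.2.1 + dv k V G 1 1 x.2.2.1,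
    dh k V G 0 2 x.2.2.1 + dv k V G 0 2 x.2.2.2)
  map_add' x y := by ext <;> simp <;> abel
  map_smul' c x := by ext <;> simp [smul_add]

/-- The grading of `(kG)^{⊗ i} ⊗ ⋀^j V`, which is concentrated in degree `j`. -/
def xGenGr (i j : ℕ) (n : ℤ) : Submodule k (XGen k V G i j) := if n = j then ⊤ else ⊥

/-- The grading of `X_{i,j}`. -/
def xGr (i j : ℕ) : ℤ → Submodule k (X k V G i j) := bimodGr k V G (xGenGr k V G i j)

/-- The grading of `X_1`. -/
def x1Gr (n : ℤ) : Submodule k (X1 k V G) := (xGr k V G 1 0 n).prod (xGr k V G 0 1 n)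
/-- The grading of `X_2`. -/
def x2Gr (n : ℤ) : Submodule k (X2 k V G) :=
  (xGr k V G 2 0 n).prod ((xGr k V G 1 1 n).prod (xGr k V G 0 2 n))
/-- The grading of `X_3`. -/
def x3Gr (n : ℤ) : Submodule k (X3 k V G) :=
  (xGr k V G 3 0 n).prod ((xGr k V G 2 1 n).prod ((xGr k V G 1 2 n).prod (xGr k V G 0 3 n)))

variable {V G}

/-- The element `1 ⊗ 1` of `X_0`. -/
def e00 : X k V G 0 0 :=
  tri k V G 1 1 (Finsupp.single (![] : Fin 0 → G) (exteriorPower.ιMulti k 0 ![]))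
/-- The element `1 ⊗ g ⊗ 1` of `X_{1,0}`. -/
def e10 (g : G) : X k V G 1 0 :=
  tri k V G 1 1 (Finsupp.single ![g] (exteriorPower.ιMulti k 0 ![]))
variable (G) in
/-- The element `1 ⊗ v ⊗ 1` of `X_{0,1}`. -/
def e01 (v : V) : X k V G 0 1 :=
  tri k V G 1 1 (Finsupp.single (![] : Fin 0 → G) (exteriorPower.ιMulti k 1 ![v]))
/-- The element `1 ⊗ g ⊗ h ⊗ 1` of `X_{2,0}`. -/
def e20 (g h : G) : X k V G 2 0 :=
  tri k V G 1 1 (Finsupp.single ![g, h] (exteriorPower.ιMulti k 0 ![]))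
/-- The element `1 ⊗ g ⊗ v ⊗ 1` of `X_{1,1}`. -/
def e11 (g : G) (v : V) : X k V G 1 1 :=
  tri k V G 1 1 (Finsupp.single ![g] (exteriorPower.ιMulti k 1 ![v]))
variable (G) in
/-- The element `1 ⊗ v ∧ w ⊗ 1` of `X_{0,2}`. -/
def e02 (v w : V) : X k V G 0 2 :=
  tri k V G 1 1 (Finsupp.single (![] : Fin 0 → G) (exteriorPower.ιMulti k 2 ![v, w]))

/-! ### The chain map from `X` to the bar resolution in degree 3 -/

variable (V G)

/-- A bilinear map, as a multilinear map. -/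
def multi2 {N : Type*} [AddCommGroup N] [Module k N] (B : V →ₗ[k] V →ₗ[k] N) :
    MultilinearMap k (fun _ : Fin 2 => V) N :=
  MultilinearMap.mk' (fun m => B (m 0) (m 1))
    (fun m i x y => by fin_cases i <;> simp) (fun m i c x => by fin_cases i <;> simp)

/-- A trilinear map, as a multilinear map. -/
def multi3 {N : Type*} [AddCommGroup N] [Module k N] (B : V →ₗ[k] V →ₗ[k] V →ₗ[k] N) :
    MultilinearMap k (fun _ : Fin 3 => V) N :=
  MultilinearMap.mk' (fun m => B (m 0) (m 1) (m 2))
    (fun m i x y => by fin_cases i <;> simp) (fun m i c x => by fin_cases i <;> simp)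

/-- `(a, b, c) ↦ a ⊗ b ⊗ c`. -/
def tmul3 : Skew k V G →ₗ[k] Skew k V G →ₗ[k] Skew k V G →ₗ[k]
    Skew k V G ⊗[k] (Skew k V G ⊗[k] Skew k V G) :=
  LinearMap.mk₂ k (fun a b => TensorProduct.mk k _ _ a ∘ₗ TensorProduct.mk k _ _ b)
    (fun a a' b => by ext; simp)
    (fun c a b => by ext; simp [TensorProduct.smul_tmul'])
    (fun a b b' => by ext; simp [TensorProduct.tmul_add])
    (fun c a b => by ext; simp)

/-- `φ` on `X_{3,0}`: `1 ⊗ g ⊗ h ⊗ l ⊗ 1 ↦ 1 ⊗ g ⊗ h ⊗ l ⊗ 1`. -/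
def φ30 : X k V G 3 0 →ₗ[Env k V G] Bar3 k V G :=
  bimodLift k V G (Finsupp.lsum k fun g : Fin 3 → G =>
    (tri k V G 1 1 ∘ₗ LinearMap.toSpanSingleton k _
      (tmul3 k V G (gA k V (g 0)) (gA k V (g 1)) (gA k V (g 2)))) ∘ₗ
      (exteriorPower.zeroEquiv k V).toLinearMap)

/-- The linear map `v ↦ g ⊗ h ⊗ v - g ⊗ (h • v) ⊗ h + (gh • v) ⊗ g ⊗ h`. -/
def φ21Aux (g h : G) : V →ₗ[k] Skew k V G ⊗[k] (Skew k V G ⊗[k] Skew k V G) where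
  toFun v := tmul3 k V G (gA k V g) (gA k V h) (vA k V G v)
    - tmul3 k V G (gA k V g) (vA k V G (h • v)) (gA k V h)
    + tmul3 k V G (vA k V G ((g * h) • v)) (gA k V g) (gA k V h)
  map_add' v w := by
    simp only [smul_add, map_add, LinearMap.add_apply]
    abel
  map_smul' c v := by
    simp only [smul_comm _ c v, map_smul, LinearMap.smul_apply, smul_add, smul_sub,
      RingHom.id_apply]

/-- `φ` on `X_{2,1}`:
`1 ⊗ g ⊗ h ⊗ v ⊗ 1 ↦ 1 ⊗ g ⊗ h ⊗ v ⊗ 1 - 1 ⊗ g ⊗ (h • v) ⊗ h ⊗ 1 + 1 ⊗ (gh • v) ⊗ g ⊗ h ⊗ 1`. -/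
def φ21 : X k V G 2 1 →ₗ[Env k V G] Bar3 k V G :=
  bimodLift k V G (Finsupp.lsum k fun g : Fin 2 → G =>
    (tri k V G 1 1 ∘ₗ φ21Aux k V G (g 0) (g 1)) ∘ₗ (exteriorPower.oneEquiv k V).toLinearMap)

/-- The bilinear map `(v, w) ↦ g ⊗ v ⊗ w + (g • v) ⊗ (g • w) ⊗ g - (g • v) ⊗ g ⊗ w`. -/
def φ12Aux (g : G) : V →ₗ[k] V →ₗ[k] Skew k V G ⊗[k] (Skew k V G ⊗[k] Skew k V G) :=
  LinearMap.mk₂ k (fun v w => tmul3 k V G (gA k V g) (vA k V G v) (vA k V G w)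
      + tmul3 k V G (vA k V G (g • v)) (vA k V G (g • w)) (gA k V g)
      - tmul3 k V G (vA k V G (g • v)) (gA k V g) (vA k V G w))
    (fun v v' w => by
      simp only [smul_add, map_add, LinearMap.add_apply]
      abel)
    (fun c v w => by
      simp only [smul_comm _ c v, map_smul, LinearMap.smul_apply, smul_add, smul_sub])
    (fun v w w' => by
      simp only [smul_add, map_add, LinearMap.add_apply]
      abel)
    (fun c v w => by
      simp only [smul_comm _ c w, map_smul, LinearMap.smul_apply, smul_add, smul_sub])

/-- `φ` on `X_{1,2}`: `1 ⊗ g ⊗ v ∧ w ⊗ 1 ↦ B(v, w) - B(w, v)` with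
`B(v, w) = 1 ⊗ g ⊗ v ⊗ w ⊗ 1 + 1 ⊗ (g • v) ⊗ (g • w) ⊗ g ⊗ 1 - 1 ⊗ (g • v) ⊗ g ⊗ w ⊗ 1`. -/
def φ12 : X k V G 1 2 →ₗ[Env k V G] Bar3 k V G :=
  bimodLift k V G (Finsupp.lsum k fun g : Fin 1 → G =>
    tri k V G 1 1 ∘ₗ exteriorPower.alternatingMapLinearEquiv
      (MultilinearMap.alternatization (multi2 k V (φ12Aux k V G (g 0)))))

/-- `φ` on `X_{0,3}`:
`1 ⊗ v₁ ∧ v₂ ∧ v₃ ⊗ 1 ↦ ∑_σ sgn σ ⊗ v_{σ(1)} ⊗ v_{σ(2)} ⊗ v_{σ(3)} ⊗ 1`. -/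
def φ03 : X k V G 0 3 →ₗ[Env k V G] Bar3 k V G :=
  bimodLift k V G (Finsupp.lsum k fun _ : Fin 0 → G =>
    tri k V G 1 1 ∘ₗ exteriorPower.alternatingMapLinearEquiv
      (MultilinearMap.alternatization ((multi3 k (Skew k V G) (tmul3 k V G)).compLinearMap
        fun _ => vA k V G)))

/-- The degree 3 component `X_3 → A ⊗ (A ⊗ A ⊗ A) ⊗ A` of the chain map `φ`. -/
def φ₃ : X3 k V G →ₗ[Env k V G] Bar3 k V G :=
  (φ30 k V G).coprod ((φ21 k V G).coprod ((φ12 k V G).coprod (φ03 k V G)))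

/-! ### Chain maps from the bar resolution to `X` -/

/-- A chain map `ψ` of degree 0 from the bar resolution to `X`, in degrees `0, …, 3`, which is the
identity of `A ⊗ A` in degree 0 and has the prescribed values in degrees 1 and 2. -/
structure BarToX where
  /-- The component in degree 1. -/
  ψ₁ : Bar1 k V G →ₗ[Env k V G] X1 k V G
  /-- The component in degree 2. -/
  ψ₂ : Bar2 k V G →ₗ[Env k V G] X2 k V G
  /-- The component in degree 3. -/
  ψ₃ : Bar3 k V G →ₗ[Env k V G] X3 k V G
  comm₁ : ∀ z, d₁ k V G (ψ₁ z) = δ₁ k V G z • e00 k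
  comm₂ : ∀ z, d₂ k V G (ψ₂ z) = ψ₁ (δ₂ k V G z)
  comm₃ : ∀ z, d₃ k V G (ψ₃ z) = ψ₂ (δ₃ k V G z)
  deg₁ : HasDegree (bar1Gr k V G) (x1Gr k V G) ψ₁ 0
  deg₂ : HasDegree (bar2Gr k V G) (x2Gr k V G) ψ₂ 0
  deg₃ : HasDegree (bar3Gr k V G) (x3Gr k V G) ψ₃ 0
  ψ₁_g : ∀ g : G, ψ₁ (tri k V G 1 1 (gA k V g)) = (e10 k g, 0)
  ψ₁_v : ∀ v : V, ψ₁ (tri k V G 1 1 (vA k V G v)) = (0, e01 k G v)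
  ψ₁_vg : ∀ (v : V) (g : G), g ≠ 1 → ψ₁ (tri k V G 1 1 (vA k V G v * gA k V g)) =
    (env k V G (vA k V G v) 1 • e10 k g, env k V G 1 (gA k V g) • e01 k G v)
  ψ₂_gh : ∀ g h : G, ψ₂ (tri k V G 1 1 (gA k V g ⊗ₜ gA k V h)) = (e20 k g h, 0, 0)
  ψ₂_gv : ∀ (g : G) (v : V),
    ψ₂ (tri k V G 1 1 (gA k V g ⊗ₜ vA k V G v - vA k V G (g • v) ⊗ₜ gA k V g)) =
      (0, e11 k g v, 0)
  ψ₂_vg : ∀ (v : V) (g : G), g ≠ 1 → ψ₂ (tri k V G 1 1 (vA k V G v ⊗ₜ gA k V g)) = 0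
  ψ₂_vw : ∀ v w : V,
    ψ₂ (tri k V G 1 1 (vA k V G v ⊗ₜ vA k V G w - vA k V G w ⊗ₜ vA k V G v)) =
      (0, 0, e02 k G v w)

/-! ### Cochains and the Gerstenhaber bracket -/

/-- The 2-cochains on `X` with values in `A`. -/
abbrev Cochain2 := X2 k V G →ₗ[Env k V G] Skew k V G
/-- The 3-cochains on `X` with values in `A`. -/
abbrev Cochain3 := X3 k V G →ₗ[Env k V G] Skew k V G

variable {V G}

/-- The coboundary of a 2-cochain on `X`. -/
def dStar (f : Cochain2 k V G) : Cochain3 k V G := f ∘ₗ d₃ k V G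

/-- The circle product `(f ∘ g)(a ⊗ b ⊗ c) = f(g(a ⊗ b) ⊗ c) - f(a ⊗ g(b ⊗ c))` of Hochschild
2-cochains of an algebra. -/
def circ {k A : Type*} [Field k] [Ring A] [Algebra k A] (f g : A ⊗[k] A →ₗ[k] A) :
    A ⊗[k] (A ⊗[k] A) →ₗ[k] A :=
  f ∘ₗ LinearMap.rTensor A g ∘ₗ (TensorProduct.assoc k A A A).symm.toLinearMap
    - f ∘ₗ LinearMap.lTensor A g

/-- The Gerstenhaber bracket `[f, g] = f ∘ g + g ∘ f` of Hochschild 2-cochains. -/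
def gerstenhaber {k A : Type*} [Field k] [Ring A] [Algebra k A] (f g : A ⊗[k] A →ₗ[k] A) :
    A ⊗[k] (A ⊗[k] A) →ₗ[k] A :=
  circ f g + circ g f

variable {k}

/-- The pullback `ψ^*(f)`, as a map `A ⊗ A → A`. -/
def pullψ (Ψ : BarToX k V G) (f : Cochain2 k V G) : Skew k V G ⊗[k] Skew k V G →ₗ[k] Skew k V G :=
  f.restrictScalars k ∘ₗ Ψ.ψ₂.restrictScalars k ∘ₗ tri k V G 1 1

/-- The pullback `φ^*(F)` of a Hochschild 3-cochain `F : A ⊗ A ⊗ A → A`. -/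
def pullφ (F : Skew k V G ⊗[k] (Skew k V G ⊗[k] Skew k V G) →ₗ[k] Skew k V G) :
    Cochain3 k V G :=
  bimodLift k V G F ∘ₗ φ₃ k V G

/-- The Gerstenhaber bracket `[f, g] = φ^* [ψ^* f, ψ^* g]` of 2-cochains on `X`. -/
def bracket (Ψ : BarToX k V G) (f g : Cochain2 k V G) : Cochain3 k V G :=
  pullφ (gerstenhaber (pullψ Ψ f) (pullψ Ψ g))

/-- Half of the bracket `[f, f]`, that is, `φ^* (ψ^* f ∘ ψ^* f)`; this makes sense in every
characteristic. -/
def halfSquare (Ψ : BarToX k V G) (f : Cochain2 k V G) : Cochain3 k V G :=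
  pullφ (circ (pullψ Ψ f) (pullψ Ψ f))

theorem bracket_self (Ψ : BarToX k V G) (f : Cochain2 k V G) :
    bracket Ψ f f = halfSquare Ψ f + halfSquare Ψ f := by
  have h : ∀ F F' : Skew k V G ⊗[k] (Skew k V G ⊗[k] Skew k V G) →ₗ[k] Skew k V G,
      bimodLift k V G (F + F') = bimodLift k V G F + bimodLift k V G F' := by
    intro F F'
    ext x
    induction x using TensorProduct.induction_on with
    | zero => exact (map_zero _).trans (map_zero _).symm
    | tmul e w => exact smul_add e (F w) (F' w)
    | add x y hx hy =>
      exact (map_add _ x y).trans ((congrArg₂ (· + ·) hx hy).trans (map_add _ x y).symm)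
  simp only [bracket, halfSquare, pullφ, gerstenhaber, h, LinearMap.add_comp]

/-- A noncommutative Poisson structure: a 2-cocycle whose bracket with itself vanishes in
cohomology. -/
structure IsNCPoisson (Ψ : BarToX k V G) (f : Cochain2 k V G) : Prop where
  cocycle : dStar k f = 0
  bracket : ∃ η : Cochain2 k V G, bracket Ψ f f = dStar k η

/-! ### The algebra `H_{λ,κ}` -/

/-- The parameter `λ(g, v) = λ(1 ⊗ g ⊗ v ⊗ 1)` of a 2-cochain on `X`, or more precisely its
component in degree zero; there is no other component if the cochain has degree `-1`. -/
def paramLam (f : Cochain2 k V G) (g : G) (v : V) : MonoidAlgebra k G :=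
  projkG k V G (f (0, e11 k g v, 0))

/-- The parameter `κ(v, w) = κ(1 ⊗ v ∧ w ⊗ 1)` of a 2-cochain on `X`, or more precisely its
component in degree zero; there is no other component if the cochain has degree `-2`. -/
def paramKap (f : Cochain2 k V G) (v w : V) : MonoidAlgebra k G :=
  projkG k V G (f (0, 0, e02 k G v w))

/-- The image of an element of `kG` in the free algebra on `V` and `G`. -/
def ofkG (x : MonoidAlgebra k G) : FreeAlgebra k (V ⊕ G) :=
  x.coeff.sum fun g c => c • FreeAlgebra.ι k (Sum.inr g)

/-- The relations of `H_{λ,κ}`: those which make `V` and `kG` embed linearly, respectively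
multiplicatively, together with `v w - w v = κ(v, w)` and `g v - (g • v) g = λ(g, v)`. -/
inductive HRel (lam : G → V → MonoidAlgebra k G) (kap : V → V → MonoidAlgebra k G) :
    FreeAlgebra k (V ⊕ G) → FreeAlgebra k (V ⊕ G) → Prop
  | add (v w : V) : HRel lam kap (FreeAlgebra.ι k (Sum.inl (v + w)))
      (FreeAlgebra.ι k (Sum.inl v) + FreeAlgebra.ι k (Sum.inl w))
  | smul (c : k) (v : V) : HRel lam kap (FreeAlgebra.ι k (Sum.inl (c • v)))
      (c • FreeAlgebra.ι k (Sum.inl v))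
  | one : HRel lam kap (FreeAlgebra.ι k (Sum.inr 1)) 1
  | mul (g h : G) : HRel lam kap (FreeAlgebra.ι k (Sum.inr (g * h)))
      (FreeAlgebra.ι k (Sum.inr g) * FreeAlgebra.ι k (Sum.inr h))
  | vw (v w : V) : HRel lam kap
      (FreeAlgebra.ι k (Sum.inl v) * FreeAlgebra.ι k (Sum.inl w)
        - FreeAlgebra.ι k (Sum.inl w) * FreeAlgebra.ι k (Sum.inl v))
      (ofkG (kap v w))
  | gv (g : G) (v : V) : HRel lam kap
      (FreeAlgebra.ι k (Sum.inr g) * FreeAlgebra.ι k (Sum.inl v)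
        - FreeAlgebra.ι k (Sum.inl (g • v)) * FreeAlgebra.ι k (Sum.inr g))
      (ofkG (lam g v))

/-- The algebra `H_{λ,κ}`. -/
abbrev HAlg (lam : G → V → MonoidAlgebra k G) (kap : V → V → MonoidAlgebra k G) :=
  RingQuot (HRel lam kap)

end SkewGroupAlgebra

/-! ### Graded deformations -/

section Deformation

variable (k A : Type*) [Field k] [Ring A] [Algebra k A]

/-- A graded deformation over `k[t]` of an algebra `A` with homogeneous components `gr n`: an
associative `k[t]`-bilinear product `*` on `A[t] = k[t] ⊗ A` with identity `1_A` such that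
`a * b = ab + μ₁(a, b) t + μ₂(a, b) t² + ⋯` for `a, b ∈ A`, a finite sum for each pair `a, b`, where
the `k`-bilinear map `μ_j` is homogeneous of degree `-j`. -/
structure GradedDeformation (gr : ℤ → Submodule k A) where
  /-- The multiplication maps. -/
  μ : ℕ → A →ₗ[k] A →ₗ[k] A
  /-- The product on `A[t]`. -/
  star : (k[X] ⊗[k] A) →ₗ[k[X]] (k[X] ⊗[k] A) →ₗ[k[X]] (k[X] ⊗[k] A)
  μ_zero : ∀ a b, μ 0 a b = a * b
  finite : ∀ a b, {j | μ j a b ≠ 0}.Finite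
  star_tmul : ∀ a b, star (1 ⊗ₜ a) (1 ⊗ₜ b) = ∑ᶠ j : ℕ, ((Polynomial.X : k[X]) ^ j) ⊗ₜ[k] μ j a b
  star_assoc : ∀ x y z, star (star x y) z = star x (star y z)
  one_star : ∀ x, star (1 ⊗ₜ 1) x = x
  star_one : ∀ x, star x (1 ⊗ₜ 1) = x
  graded : ∀ (j : ℕ) (p q : ℤ), ∀ a ∈ gr p, ∀ b ∈ gr q, μ j a b ∈ gr (p + q - j)

variable {k A} {gr : ℤ → Submodule k A}

namespace GradedDeformation

/-- The vector space `A[t]`, to be equipped with the product of the deformation. -/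
def Total (_ : GradedDeformation k A gr) := k[X] ⊗[k] A

variable (D : GradedDeformation k A gr)

instance : AddCommGroup D.Total := inferInstanceAs (AddCommGroup (k[X] ⊗[k] A))

instance : Module k[X] D.Total := inferInstanceAs (Module k[X] (k[X] ⊗[k] A))

instance : Ring D.Total where
  __ := (inferInstance : AddCommGroup D.Total)
  mul x y := D.star x y
  one := (1 : k[X]) ⊗ₜ[k] (1 : A)
  left_distrib x y z := map_add (D.star x) y z
  right_distrib x y z := LinearMap.map_add₂ D.star x y z
  zero_mul x := LinearMap.map_zero₂ D.star x
  mul_zero x := map_zero (D.star x)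
  mul_assoc x y z := D.star_assoc x y z
  one_mul x := D.one_star x
  mul_one x := D.star_one x

instance : Algebra k[X] D.Total :=
  Algebra.ofModule (fun p x y => LinearMap.map_smul₂ D.star p x y)
    (fun p x y => map_smul (D.star x) p y)

instance : Algebra k D.Total := Algebra.compHom D.Total (C : k →+* k[X])

/-- The fiber of the deformation at `t = 1`: the quotient of `A[t]` by the two-sided ideal generated
by `t - 1`. -/
abbrev FiberOne :=
  RingQuot fun x y : D.Total => x = algebraMap k[X] D.Total Polynomial.X ∧ y = 1

end GradedDeformation

end Deformation

end SkewDeformation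

end

/-! The deformation is the Rees construction of `H_{λ,κ}`, with its first order term corrected by a
change of linear coordinates. Four ingredients carry this.

Conditions on parameters. The cocycle identity for `ψ^*λ`, the equation ½[λ,λ] = d^*κ on X_{1,2} and
X_{0,3}, and [λ,κ] = 0 on X_{0,3} are projected onto suitable components of degree 0 or 1. There
they involve only λ(g,v) and the degree 0 part of κ(v,w), and become the conditions of `PBWDatum`:
see `pullBil_gA_mul`, `linLam_swap`, `linKap_smul`, `linKap_cyclic`, `linLam_cyclic`. Symmetric
terms ψ^*λ(v,w) drop out because λ vanishes on X_{0,2}.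

PBW theorem. On the space spanned by pairs of a word in basis letters and a group element, `kG` acts
by moving group elements to the right with gv = (gv)g + λ(g,v); this is an action because λ is a
twisted derivation. The relations vw - wv = κ(v,w) are then used to sort words. The diamond lemma
applies: disjoint rewritings commute modulo shorter relations, and the only overlap, of three
decreasing letters, is resolved by the two cyclic identities (`opRel_cyclic`, `confluence`,
`nfMap_relLE`). Consequently A carries an action of `H_{λ,κ}`, and acting on 1 inverts the map which
sends sorted monomials to products in `H_{λ,κ}` (`pbw`). The transported product has the product of
A as its leading term (`pbw_leading_term`).

Rees construction. For homogeneous a, b of degrees p, q, the component of degree p + q - j of the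
transported product is multiplied by t^j. This is an associative graded deformation, and setting t =
1 gives back `H_{λ,κ}` (`FilteredIso.deformation`, `FilteredIso.fiberEquiv`).

First order term. The resulting μ₁ need not be ψ^*λ, but the two are cocycles of degree -1 with the
same values on the pairs (g,h), (g,v), (v,g), and both are symmetric on V. Their difference defines
a square zero extension of A in which the generators of A lift with all relations preserved. Since A
is presented by these generators and relations (the PBW theorem for zero parameters), the extension
splits, so the difference is the coboundary of some β of degree -1 (`exists_coboundary`). Composing
the PBW isomorphism with the invertible map 1 + β changes μ₁ by exactly that coboundary and leaves
the algebra at t = 1 untouched (`FilteredIso.twist_μ_one`). -/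

open scoped TensorProduct

noncomputable section

set_option linter.unusedSectionVars false

namespace SkewDeformation

open MulOpposite Polynomial

/-! ### Linear maps and induction on `kG` -/

section GroupAlgebra

variable {k G N : Type*} [Field k] [AddCommGroup N] [Module k N]

/-- The linear map on `kG` with the given values on group elements. -/
def kgLift (f : G → N) : MonoidAlgebra k G →ₗ[k] N :=
  Finsupp.linearCombination k f ∘ₗ (MonoidAlgebra.coeffLinearEquiv k).toLinearMap

@[simp]
theorem kgLift_single (f : G → N) (g : G) (c : k) :
    kgLift f (MonoidAlgebra.single g c) = c • f g := by
  simp [kgLift]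

theorem kg_hom_ext {f f' : MonoidAlgebra k G →ₗ[k] N}
    (h : ∀ g, f (MonoidAlgebra.single g 1) = f' (MonoidAlgebra.single g 1)) : f = f' := by
  ext g
  simpa using h g

/-- A property of elements of `kG` which is stable under linear combinations holds for all of them
if it holds for the group elements. -/
theorem kg_induction {P : MonoidAlgebra k G → Prop} (c : MonoidAlgebra k G)
    (single : ∀ g, P (MonoidAlgebra.single g 1)) (zero : P 0)
    (add : ∀ c d, P c → P d → P (c + d)) (smul : ∀ (a : k) c, P c → P (a • c)) : P c := by
  induction c using MonoidAlgebra.induction_linear with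
  | zero => exact zero
  | add c d hc hd => exact add c d hc hd
  | single g a => simpa using smul a _ (single g)

end GroupAlgebra

/-! ### The PBW conditions on λ and κ -/

section Datum

variable (k V G : Type*) [Field k] [AddCommGroup V] [Module k V] [Group G]
  [DistribMulAction G V] [SMulCommClass G k V]

/-- The bilinear map `(g, v) ↦ (g • v) ⊗ g`. -/
def twist : MonoidAlgebra k G →ₗ[k] V →ₗ[k] V ⊗[k] MonoidAlgebra k G :=
  kgLift fun g => (TensorProduct.mk k V (MonoidAlgebra k G)).flip (MonoidAlgebra.single g 1) ∘ₗ
    DistribSMul.toLinearMap k V g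

@[simp]
theorem twist_single (g : G) (v : V) :
    twist k V G (MonoidAlgebra.single g 1) v = (g • v) ⊗ₜ MonoidAlgebra.single g 1 := by
  simp [twist]

/-- Parameters `λ` and `κ` satisfying the conditions under which `H_{λ,κ}` has the PBW property. -/
structure PBWDatum where
  /-- The parameter `λ`. -/
  lam : MonoidAlgebra k G →ₗ[k] V →ₗ[k] MonoidAlgebra k G
  /-- The parameter `κ`. -/
  kap : V →ₗ[k] V →ₗ[k] MonoidAlgebra k G
  kap_self : ∀ v, kap v v = 0
  lam_mul : ∀ g h v, lam (MonoidAlgebra.single (g * h) 1) v =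
    lam (MonoidAlgebra.single g 1) (h • v) * MonoidAlgebra.single h 1
      + MonoidAlgebra.single g 1 * lam (MonoidAlgebra.single h 1) v
  kap_smul : ∀ (g : G) u v, kap (g • u) (g • v) * MonoidAlgebra.single g 1
      - MonoidAlgebra.single g 1 * kap u v =
    lam (lam (MonoidAlgebra.single g 1) v) u - lam (lam (MonoidAlgebra.single g 1) u) v
  lam_swap : ∀ (g : G) u v,
    twist k V G (lam (MonoidAlgebra.single g 1) v) u
        - (g • u) ⊗ₜ lam (MonoidAlgebra.single g 1) v =
      twist k V G (lam (MonoidAlgebra.single g 1) u) v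
        - (g • v) ⊗ₜ lam (MonoidAlgebra.single g 1) u
  kap_cyclic : ∀ u v w,
    (twist k V G (kap u v) w - w ⊗ₜ kap u v) + (twist k V G (kap v w) u - u ⊗ₜ kap v w)
      + (twist k V G (kap w u) v - v ⊗ₜ kap w u) = 0
  lam_cyclic : ∀ u v w, lam (kap u v) w + lam (kap v w) u + lam (kap w u) v = 0

/-- The parameters `λ = 0` and `κ = 0`. -/
def PBWDatum.zero : PBWDatum k V G where
  lam := 0
  kap := 0
  kap_self := by simp
  lam_mul := by simp
  kap_smul := by simp
  lam_swap := by simp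
  kap_cyclic := by simp
  lam_cyclic := by simp

end Datum

namespace PBWDatum

variable {k V G : Type*} [Field k] [AddCommGroup V] [Module k V] [Group G]
  [DistribMulAction G V] [SMulCommClass G k V]

section Basic

variable (D : PBWDatum k V G)

theorem kap_swap (u v : V) : D.kap u v = - D.kap v u := by
  have h := D.kap_self (u + v)
  simp only [map_add, LinearMap.add_apply, D.kap_self, zero_add, add_zero] at h
  rw [add_comm] at h
  exact eq_neg_of_add_eq_zero_left h

theorem lam_one (v : V) : D.lam 1 v = 0 := by
  have h := D.lam_mul 1 1 v
  simp only [mul_one, one_smul, ← MonoidAlgebra.one_def, one_mul] at h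
  simpa using h

end Basic

/-! ### Operators on the space of words -/

variable {n : ℕ}

variable (k G n) in
/-- The space with basis the pairs of a word in the letters `x_i` and an element of `G`. -/
abbrev WordSpace := (List (Fin n) × G) →₀ k

variable (k) in
/-- The basis element given by the word `w` and `g`. -/
def word (w : List (Fin n)) (g : G) : WordSpace k G n := Finsupp.single (w, g) 1

theorem word_hom_ext {N : Type*} [AddCommGroup N] [Module k N] {f f' : WordSpace k G n →ₗ[k] N}
    (h : ∀ w g, f (word k w g) = f' (word k w g)) : f = f' := by
  ext ⟨w, g⟩
  simpa [word] using h w g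

variable (k G) in
/-- Left multiplication by the letter `x_i`. -/
def opLetter (i : Fin n) : WordSpace k G n →ₗ[k] WordSpace k G n :=
  Finsupp.lmapDomain k k fun q => (i :: q.1, q.2)

@[simp]
theorem opLetter_word (i : Fin n) (w : List (Fin n)) (g : G) :
    opLetter k G i (word k w g) = word k (i :: w) g := by
  simp [opLetter, word]

variable (D : PBWDatum k V G) (x : Module.Basis (Fin n) k V)

variable (G) in
/-- Left multiplication by `v ∈ V`. -/
def opV : V →ₗ[k] WordSpace k G n →ₗ[k] WordSpace k G n := x.constr k (opLetter k G)

@[simp]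
theorem opV_basis (i : Fin n) : opV G x (x i) = opLetter k G i := by
  simp [opV]

/-- The product of an element of `kG` with a word, written as a combination of words. -/
def kgMulWord : List (Fin n) → G → MonoidAlgebra k G →ₗ[k] WordSpace k G n
  | [], h => kgLift fun g => word k [] (g * h)
  | i :: w, h => kgLift fun g => opV G x (g • x i) (kgMulWord w h (MonoidAlgebra.single g 1))
      + kgMulWord w h (D.lam (MonoidAlgebra.single g 1) (x i))

/-- Left multiplication by an element of `kG`. -/
def opG : MonoidAlgebra k G →ₗ[k] WordSpace k G n →ₗ[k] WordSpace k G n :=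
  (Finsupp.lift (MonoidAlgebra k G →ₗ[k] WordSpace k G n) k (List (Fin n) × G)
    fun q => D.kgMulWord x q.1 q.2).flip

theorem opG_word (c : MonoidAlgebra k G) (w : List (Fin n)) (h : G) :
    D.opG x c (word k w h) = D.kgMulWord x w h c := by
  simp [opG, word]

@[simp]
theorem opG_word_nil (g h : G) :
    D.opG x (MonoidAlgebra.single g 1) (word k [] h) = word k [] (g * h) := by
  simp [opG_word, kgMulWord]

/-- For a letter this is the recursion in `kgMulWord`; both sides are linear in v. It is the
relation gv = (gv)g + λ(g,v) as an identity of operators. -/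
theorem opG_single_opV (g : G) (v : V) (f : WordSpace k G n) :
    D.opG x (MonoidAlgebra.single g 1) (opV G x v f) =
      opV G x (g • v) (D.opG x (MonoidAlgebra.single g 1) f)
        + D.opG x (D.lam (MonoidAlgebra.single g 1) v) f := by
  have key : ∀ i, D.opG x (MonoidAlgebra.single g 1) ∘ₗ opLetter k G i =
      opV G x (g • x i) ∘ₗ D.opG x (MonoidAlgebra.single g 1)
        + D.opG x (D.lam (MonoidAlgebra.single g 1) (x i)) := fun i => word_hom_ext fun w h => by
    simp [opG_word, kgMulWord]
  have : (LinearMap.llcomp k _ _ _ (D.opG x (MonoidAlgebra.single g 1))) ∘ₗ opV G x =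
      (LinearMap.lcomp k _ (D.opG x (MonoidAlgebra.single g 1))) ∘ₗ opV G x ∘ₗ
          DistribSMul.toLinearMap k V g
        + D.opG x ∘ₗ D.lam (MonoidAlgebra.single g 1) := x.ext fun i => by
    simp only [LinearMap.comp_apply, opV_basis, LinearMap.add_apply]
    exact key i
  exact LinearMap.congr_fun (LinearMap.congr_fun this v) f

/-- The operator `X_v ∘ R_c` attached to `v ⊗ c`. -/
def opVG : V ⊗[k] MonoidAlgebra k G →ₗ[k] WordSpace k G n →ₗ[k] WordSpace k G n :=
  TensorProduct.lift ((LinearMap.llcomp k _ _ _ ∘ₗ opV G x).compl₂ (D.opG x))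

@[simp]
theorem opVG_tmul (v : V) (c : MonoidAlgebra k G) (f : WordSpace k G n) :
    D.opVG x (v ⊗ₜ c) f = opV G x v (D.opG x c f) := rfl

theorem opG_opV (c : MonoidAlgebra k G) (v : V) (f : WordSpace k G n) :
    D.opG x c (opV G x v f) = D.opVG x (twist k V G c v) f + D.opG x (D.lam c v) f := by
  induction c using kg_induction with
  | single g => simp [opG_single_opV]
  | zero => simp
  | add c d hc hd => simp only [map_add, LinearMap.add_apply, hc, hd]; abel
  | smul a c hc => simp only [map_smul, LinearMap.smul_apply, hc, smul_add]

/-- Moving gh past a letter in one stroke or in two leaves the corrections λ(gh,v) and λ(g,hv)h +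
gλ(h,v), which agree by `lam_mul`. -/
theorem opG_mul (c d : MonoidAlgebra k G) (f : WordSpace k G n) :
    D.opG x (c * d) f = D.opG x c (D.opG x d f) := by
  -- The induction on the word must keep c and d arbitrary: the corrections λ(g,v) are general
  -- elements of `kG`, not group elements.
  suffices h : ∀ (w : List (Fin n)) (l : G) (c d : MonoidAlgebra k G),
      D.opG x (c * d) (word k w l) = D.opG x c (D.opG x d (word k w l)) from
    LinearMap.congr_fun (word_hom_ext (f := D.opG x (c * d)) (f' := D.opG x c ∘ₗ D.opG x d)
      fun w l => h w l c d) f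
  intro w l
  induction w with
  | nil =>
    intro c d
    induction c using kg_induction with
    | single g =>
      induction d using kg_induction with
      | single h => simp [MonoidAlgebra.single_mul_single, mul_assoc]
      | zero => simp
      | add c d hc hd => simp only [mul_add, map_add, LinearMap.add_apply, hc, hd]
      | smul a c hc => simp only [mul_smul_comm, map_smul, LinearMap.smul_apply, hc]
    | zero => simp
    | add c d hc hd => simp only [add_mul, map_add, LinearMap.add_apply, hc, hd]
    | smul a c hc => simp only [smul_mul_assoc, map_smul, LinearMap.smul_apply, hc]
  | cons i w ih =>
    intro c d
    induction c using kg_induction with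
    | single g =>
      induction d using kg_induction with
      | single h =>
        rw [← opLetter_word, ← opV_basis x, MonoidAlgebra.single_mul_single, one_mul,
          opG_single_opV, opG_single_opV, D.lam_mul, map_add, map_add, opG_single_opV,
          LinearMap.add_apply, ← ih, ← ih, ← ih, MonoidAlgebra.single_mul_single, one_mul, mul_smul]
        abel
      | zero => simp
      | add c d hc hd => simp only [mul_add, map_add, LinearMap.add_apply, hc, hd]
      | smul a c hc => simp only [mul_smul_comm, map_smul, LinearMap.smul_apply, hc]
    | zero => simp
    | add c d hc hd => simp only [add_mul, map_add, LinearMap.add_apply, hc, hd]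
    | smul a c hc => simp only [smul_mul_assoc, map_smul, LinearMap.smul_apply, hc]

theorem opG_one (f : WordSpace k G n) : D.opG x 1 f = f := by
  suffices h : ∀ (w : List (Fin n)) (l : G), D.opG x 1 (word k w l) = word k w l from
    LinearMap.congr_fun (word_hom_ext (f := D.opG x 1) (f' := LinearMap.id) h) f
  intro w l
  induction w with
  | nil => rw [MonoidAlgebra.one_def, opG_word_nil, one_mul]
  | cons i w ih =>
    have h := D.opG_single_opV x 1 (x i) (word k w l)
    rw [← MonoidAlgebra.one_def, D.lam_one, ih, one_smul] at h
    simpa using h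

/-- Left multiplication by `u v - v u - κ(u, v)`. -/
def opRel (u v : V) : WordSpace k G n →ₗ[k] WordSpace k G n :=
  opV G x u ∘ₗ opV G x v - opV G x v ∘ₗ opV G x u - D.opG x (D.kap u v)

theorem opRel_apply (u v : V) (f : WordSpace k G n) :
    D.opRel x u v f = opV G x u (opV G x v f) - opV G x v (opV G x u f)
      - D.opG x (D.kap u v) f := rfl

/-- Moving g past two letters produces corrections with one letter left and with none.
Antisymmetrized in u and v, the former cancel by `lam_swap`, and the latter match the change of κ by
`kap_smul`. This makes the span of the relations stable under `kG`. -/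
theorem opG_opRel (g : G) (u v : V) (f : WordSpace k G n) :
    D.opG x (MonoidAlgebra.single g 1) (D.opRel x u v f) =
      D.opRel x (g • u) (g • v) (D.opG x (MonoidAlgebra.single g 1) f) := by
  have h₁ := congr(D.opVG x $(D.lam_swap g u v) f)
  have h₂ := congr(D.opG x $(D.kap_smul g u v) f)
  simp only [map_sub, LinearMap.sub_apply, opG_mul, opVG_tmul] at h₁ h₂
  simp only [opRel_apply, map_sub, opG_single_opV, map_add]
  rw [sub_eq_iff_eq_add] at h₁ h₂
  rw [opG_opV, opG_opV, h₁, h₂]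
  abel

/-- The Jacobi identity behind the overlap of three letters. After elements of `kG` are moved to the
right, the part with a letter vanishes by `kap_cyclic` and the part without by `lam_cyclic`. -/
theorem opRel_cyclic (u v w : V) (f : WordSpace k G n) :
    (D.opG x (D.kap u v) (opV G x w f) - opV G x w (D.opG x (D.kap u v) f))
      + (D.opG x (D.kap v w) (opV G x u f) - opV G x u (D.opG x (D.kap v w) f))
      + (D.opG x (D.kap w u) (opV G x v f) - opV G x v (D.opG x (D.kap w u) f)) = 0 := by
  have h₁ := congr(D.opVG x $(D.kap_cyclic u v w) f)
  have h₂ := congr(D.opG x $(D.lam_cyclic u v w) f)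
  simp only [map_sub, map_add, LinearMap.sub_apply, LinearMap.add_apply, opVG_tmul, map_zero,
    LinearMap.zero_apply] at h₁ h₂
  simp only [opG_opV]
  refine Eq.trans ?_ ((congrArg₂ (· + ·) h₁ h₂).trans (add_zero 0))
  abel

end PBWDatum

namespace PBWDatum

variable {k V G : Type*} [Field k] [AddCommGroup V] [Module k V] [Group G]
  [DistribMulAction G V] [SMulCommClass G k V] {n : ℕ}

theorem basis_induction {P : V → Prop} (x : Module.Basis (Fin n) k V) (v : V)
    (basis : ∀ i, P (x i)) (zero : P 0) (add : ∀ u v, P u → P v → P (u + v))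
    (smul : ∀ (a : k) v, P v → P (a • v)) : P v := by
  have hv : v ∈ Submodule.span k (Set.range x) := x.mem_span v
  induction hv using Submodule.span_induction with
  | mem u hu => obtain ⟨i, rfl⟩ := hu; exact basis i
  | zero => exact zero
  | add u v _ _ hu hv => exact add u v hu hv
  | smul a v _ hv => exact smul a v hv

/-! ### Lengths of words -/

variable (k G n) in
/-- The span of the words of length at most `m`. -/
def lenLE (m : ℕ) : Submodule k (WordSpace k G n) :=
  Submodule.span k {f | ∃ w g, w.length ≤ m ∧ f = word k w g}

theorem word_mem_lenLE {m : ℕ} {w : List (Fin n)} (hw : w.length ≤ m) (g : G) :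
    word k w g ∈ lenLE k G n m :=
  Submodule.subset_span ⟨w, g, hw, rfl⟩

theorem lenLE_mono {m m' : ℕ} (h : m ≤ m') : lenLE k G n m ≤ lenLE k G n m' :=
  Submodule.span_mono fun _ ⟨w, g, hw, e⟩ => ⟨w, g, hw.trans h, e⟩

theorem exists_mem_lenLE (f : WordSpace k G n) : ∃ m, f ∈ lenLE k G n m := by
  induction f using Finsupp.induction_linear with
  | zero => exact ⟨0, zero_mem _⟩
  | add f f' hf hf' =>
    obtain ⟨m, hm⟩ := hf
    obtain ⟨m', hm'⟩ := hf'
    exact ⟨max m m', add_mem (lenLE_mono (le_max_left _ _) hm) (lenLE_mono (le_max_right _ _) hm')⟩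
  | single q c =>
    refine ⟨q.1.length, ?_⟩
    have : Finsupp.single q c = c • word k q.1 q.2 := by simp [word]
    rw [this]
    exact Submodule.smul_mem _ _ (word_mem_lenLE le_rfl _)

theorem length_le_of_mem_support {m : ℕ} {f : WordSpace k G n} (hf : f ∈ lenLE k G n m)
    {q : List (Fin n) × G} (hq : q ∈ f.support) : q.1.length ≤ m := by
  have : lenLE k G n m ≤ Finsupp.supported k k {q | q.1.length ≤ m} := by
    rw [lenLE, Submodule.span_le]
    rintro _ ⟨w, g, hw, rfl⟩
    exact Finsupp.single_mem_supported k _ hw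
  exact this hf hq

theorem map_lenLE_le {m : ℕ} (T : WordSpace k G n →ₗ[k] WordSpace k G n)
    (S : Submodule k (WordSpace k G n)) (h : ∀ w g, w.length ≤ m → T (word k w g) ∈ S)
    {f : WordSpace k G n} (hf : f ∈ lenLE k G n m) : T f ∈ S := by
  have : lenLE k G n m ≤ S.comap T := by
    rw [lenLE, Submodule.span_le]
    rintro _ ⟨w, g, hw, rfl⟩
    exact h w g hw
  exact this hf

theorem opLetter_mem_lenLE {m : ℕ} (i : Fin n) {f : WordSpace k G n} (hf : f ∈ lenLE k G n m) :
    opLetter k G i f ∈ lenLE k G n (m + 1) :=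
  map_lenLE_le _ _ (fun w g hw => by
    rw [opLetter_word]; exact word_mem_lenLE (by simpa using hw) g) hf

variable (D : PBWDatum k V G) (x : Module.Basis (Fin n) k V)

theorem opV_mem_lenLE {m : ℕ} (v : V) {f : WordSpace k G n} (hf : f ∈ lenLE k G n m) :
    opV G x v f ∈ lenLE k G n (m + 1) := by
  induction v using basis_induction x with
  | basis i => rw [opV_basis]; exact opLetter_mem_lenLE i hf
  | zero => simp
  | add u v hu hv => rw [map_add]; exact add_mem hu hv
  | smul a v hv => rw [map_smul]; exact Submodule.smul_mem _ _ hv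

/-- Moving a group element past a letter either keeps one letter or replaces it by an element of
`kG`, so lengths never grow. -/
theorem opG_word_mem_lenLE (w : List (Fin n)) (g : G) (c : MonoidAlgebra k G) :
    D.opG x c (word k w g) ∈ lenLE k G n w.length := by
  induction w generalizing c with
  | nil =>
    induction c using kg_induction with
    | single h => rw [opG_word_nil]; exact word_mem_lenLE le_rfl _
    | zero => simp
    | add c d hc hd => rw [map_add]; exact add_mem hc hd
    | smul a c hc => rw [map_smul]; exact Submodule.smul_mem _ _ hc
  | cons i w ih =>
    induction c using kg_induction with
    | single h =>
      rw [← opLetter_word, ← opV_basis x, opG_single_opV]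
      exact add_mem (opV_mem_lenLE x _ (ih _)) (lenLE_mono (by simp) (ih _))
    | zero => simp
    | add c d hc hd => rw [map_add]; exact add_mem hc hd
    | smul a c hc => rw [map_smul]; exact Submodule.smul_mem _ _ hc

theorem opG_mem_lenLE {m : ℕ} (c : MonoidAlgebra k G) {f : WordSpace k G n}
    (hf : f ∈ lenLE k G n m) : D.opG x c f ∈ lenLE k G n m :=
  map_lenLE_le _ _ (fun w g hw => lenLE_mono hw (D.opG_word_mem_lenLE x w g c)) hf

variable (k G) in
/-- Left multiplication by a word. -/
def opWord : List (Fin n) → WordSpace k G n →ₗ[k] WordSpace k G n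
  | [] => LinearMap.id
  | i :: a => opLetter k G i ∘ₗ opWord a

@[simp]
theorem opWord_nil (f : WordSpace k G n) : opWord k G [] f = f := rfl

@[simp]
theorem opWord_cons (i : Fin n) (a : List (Fin n)) (f : WordSpace k G n) :
    opWord k G (i :: a) f = opLetter k G i (opWord k G a f) := rfl

theorem opWord_append (a b : List (Fin n)) (f : WordSpace k G n) :
    opWord k G (a ++ b) f = opWord k G a (opWord k G b f) := by
  induction a with
  | nil => rfl
  | cons i a ih => simp [ih]

theorem opWord_word (a b : List (Fin n)) (g : G) :
    opWord k G a (word k b g) = word k (a ++ b) g := by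
  induction a with
  | nil => rfl
  | cons i a ih => simp [ih]

theorem opWord_mem_lenLE {m : ℕ} (a : List (Fin n)) {f : WordSpace k G n}
    (hf : f ∈ lenLE k G n m) : opWord k G a f ∈ lenLE k G n (a.length + m) := by
  induction a with
  | nil => simpa using hf
  | cons i a ih =>
    rw [opWord_cons, List.length_cons, add_right_comm]
    exact opLetter_mem_lenLE i ih

/-! ### The span of the relations -/

/-- The span of the elements `a (u v - v u - κ(u, v)) f`, where `a` is a word, `u` and `v` are in
`V` and the total length is at most `m`. -/
def relLE (m : ℕ) : Submodule k (WordSpace k G n) :=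
  Submodule.span k {f' | ∃ (a : List (Fin n)) (u v : V) (l : ℕ) (f : WordSpace k G n),
    f ∈ lenLE k G n l ∧ a.length + l + 2 ≤ m ∧ f' = opWord k G a (D.opRel x u v f)}

theorem mem_relLE {m l : ℕ} (a : List (Fin n)) (u v : V) {f : WordSpace k G n}
    (hf : f ∈ lenLE k G n l) (h : a.length + l + 2 ≤ m) :
    opWord k G a (D.opRel x u v f) ∈ D.relLE x m :=
  Submodule.subset_span ⟨a, u, v, l, f, hf, h, rfl⟩

theorem relLE_mono {m m' : ℕ} (h : m ≤ m') : D.relLE x m ≤ D.relLE x m' :=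
  Submodule.span_mono fun _ ⟨a, u, v, l, f, hf, hl, e⟩ => ⟨a, u, v, l, f, hf, hl.trans h, e⟩

theorem map_relLE_le {N : Type*} [AddCommGroup N] [Module k N] {m : ℕ}
    (T : WordSpace k G n →ₗ[k] N) (S : Submodule k N)
    (h : ∀ a u v l f, f ∈ lenLE k G n l → a.length + l + 2 ≤ m →
      T (opWord k G a (D.opRel x u v f)) ∈ S)
    {f : WordSpace k G n} (hf : f ∈ D.relLE x m) : T f ∈ S := by
  have : D.relLE x m ≤ S.comap T := by
    rw [relLE, Submodule.span_le]
    rintro _ ⟨a, u, v, l, f, hf, hl, rfl⟩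
    exact h a u v l f hf hl
  exact this hf

theorem opLetter_mem_relLE {m : ℕ} (i : Fin n) {f : WordSpace k G n} (hf : f ∈ D.relLE x m) :
    opLetter k G i f ∈ D.relLE x (m + 1) :=
  D.map_relLE_le x _ _ (fun a u v l f hf hl =>
    D.mem_relLE x (i :: a) u v hf (by rw [List.length_cons]; omega)) hf

theorem opWord_mem_relLE {m : ℕ} (a : List (Fin n)) {f : WordSpace k G n}
    (hf : f ∈ D.relLE x m) : opWord k G a f ∈ D.relLE x (a.length + m) := by
  induction a with
  | nil => simpa using hf
  | cons i a ih =>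
    rw [opWord_cons, List.length_cons, add_right_comm]
    exact D.opLetter_mem_relLE x i ih

theorem opV_mem_relLE {m : ℕ} (v : V) {f : WordSpace k G n} (hf : f ∈ D.relLE x m) :
    opV G x v f ∈ D.relLE x (m + 1) := by
  induction v using basis_induction x with
  | basis i => rw [opV_basis]; exact D.opLetter_mem_relLE x i hf
  | zero => simp
  | add u v hu hv => rw [map_add]; exact add_mem hu hv
  | smul a v hv => rw [map_smul]; exact Submodule.smul_mem _ _ hv

/-- A group element is moved through the prefix until it meets the relation, where `opG_opRel` takes
over; the corrections on the way shorten the prefix. -/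
theorem opG_mem_relLE {m : ℕ} (c : MonoidAlgebra k G) {f : WordSpace k G n}
    (hf : f ∈ D.relLE x m) : D.opG x c f ∈ D.relLE x m := by
  refine D.map_relLE_le x _ _ (fun a u v l f hf hl => ?_) hf
  clear * - hf hl
  induction a generalizing c m with
  | nil =>
    induction c using kg_induction with
    | single g =>
      rw [opWord_nil, opG_opRel]
      exact D.mem_relLE x [] _ _ (D.opG_mem_lenLE x _ hf) hl
    | zero => simp
    | add c d hc hd => rw [map_add]; exact add_mem hc hd
    | smul a c hc => rw [map_smul]; exact Submodule.smul_mem _ _ hc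
  | cons i a ih =>
    rw [List.length_cons] at hl
    induction c using kg_induction with
    | single g =>
      rw [opWord_cons, ← opV_basis x, opG_single_opV]
      obtain ⟨m, rfl⟩ : ∃ m', m = m' + 1 := ⟨m - 1, by omega⟩
      exact add_mem (D.opV_mem_relLE x _ (ih _ (by omega)))
        (D.relLE_mono x (Nat.le_succ m) (ih _ (by omega)))
    | zero => simp
    | add c d hc hd => rw [map_add]; exact add_mem hc hd
    | smul a c hc => rw [map_smul]; exact Submodule.smul_mem _ _ hc

/-! ### Normal forms -/

/-- A weight which decreases when two letters in the wrong order are exchanged. -/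
def weight : List (Fin n) → ℕ
  | [] => 0
  | i :: w => i * w.length + weight w

/-- The exchange lowers the weight by j - i, whatever stands before or after the two letters. -/
theorem weight_swap_lt (a b : List (Fin n)) {i j : Fin n} (h : i < j) :
    weight (a ++ i :: j :: b) < weight (a ++ j :: i :: b) := by
  induction a with
  | nil =>
    simp only [List.nil_append, weight, List.length_cons]
    have : (i : ℕ) < j := h
    nlinarith
  | cons l a ih => simp only [List.cons_append, weight, List.length_append, List.length_cons]; omega

/-- A pair of consecutive letters in the wrong order. -/
def IsDescent (w : List (Fin n)) (q : List (Fin n) × Fin n × Fin n × List (Fin n)) : Prop :=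
  w = q.1 ++ q.2.1 :: q.2.2.1 :: q.2.2.2 ∧ q.2.2.1 < q.2.1

variable {N : Type*} [AddCommGroup N] [Module k N] (s : List (Fin n) → G → N)

open Classical in
/-- The normal form of a word, where `s` gives the normal forms of the words without descents. -/
def nf (w : List (Fin n)) (g : G) : N :=
  if h : ∃ q, IsDescent w q then
    nf (h.choose.1 ++ h.choose.2.2.1 :: h.choose.2.1 :: h.choose.2.2.2) g
      + (opWord k G h.choose.1 (D.opG x (D.kap (x h.choose.2.1) (x h.choose.2.2.1))
          (word k h.choose.2.2.2 g))).sum fun q c =>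
        -- The guard only serves termination. It holds for every word in the support, since κ
        -- replaces two letters by an element of `kG`.
        if _h' : q.1.length < w.length then c • nf q.1 q.2 else 0
  else s w g
termination_by (w.length, weight w)
decreasing_by
  · have hq := h.choose_spec
    have hw := hq.1
    have hlt := weight_swap_lt h.choose.1 h.choose.2.2.2 hq.2
    rw [← hw] at hlt
    have hlen : (h.choose.1 ++ h.choose.2.2.1 :: h.choose.2.1 :: h.choose.2.2.2).length
        = w.length := by
      conv_rhs => rw [hw]
      simp
    rw [hlen]
    exact Prod.Lex.right _ hlt
  · exact Prod.Lex.left _ _ _h'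

/-- The linear map which sends words to their normal forms. -/
def nfMap : WordSpace k G n →ₗ[k] N :=
  Finsupp.linearCombination k fun q => D.nf x s q.1 q.2

@[simp]
theorem nfMap_word (w : List (Fin n)) (g : G) : D.nfMap x s (word k w g) = D.nf x s w g := by
  simp [nfMap, word]

theorem nf_of_forall_not (w : List (Fin n)) (g : G) (h : ∀ q, ¬ IsDescent w q) :
    D.nf x s w g = s w g := by
  rw [nf, dif_neg (by simpa using h)]

/-- The recursion without its guard. The descent is the one picked by choice; that any descent would
do is the content of `confluence` and `nf_rule`. -/
theorem exists_nf_eq (w : List (Fin n)) (g : G) (h : ∃ q, IsDescent w q) :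
    ∃ q, IsDescent w q ∧ D.nf x s w g = D.nf x s (q.1 ++ q.2.2.1 :: q.2.1 :: q.2.2.2) g
      + D.nfMap x s (opWord k G q.1 (D.opG x (D.kap (x q.2.1) (x q.2.2.1))
          (word k q.2.2.2 g))) := by
  refine ⟨h.choose, h.choose_spec, ?_⟩
  rw [nf, dif_pos h, nfMap, Finsupp.linearCombination_apply]
  congr 1
  refine Finsupp.sum_congr fun q hq => ?_
  rw [dif_pos]
  have h₁ := length_le_of_mem_support (opWord_mem_lenLE h.choose.1
    (D.opG_mem_lenLE x _ (word_mem_lenLE (le_refl h.choose.2.2.2.length) g))) hq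
  have hw := congrArg List.length h.choose_spec.1
  simp only [List.length_append, List.length_cons] at hw
  omega

/-- Two ways to begin the reduction of a word lead to the same result. -/
theorem confluence {L W : ℕ} (kill : ∀ m < L, ∀ f ∈ D.relLE x m, D.nfMap x s f = 0)
    (rule : ∀ a j i b g, (a ++ j :: i :: b).length = L → weight (a ++ j :: i :: b) < W → i < j →
      D.nf x s (a ++ j :: i :: b) g = D.nf x s (a ++ i :: j :: b) g
        + D.nfMap x s (opWord k G a (D.opG x (D.kap (x j) (x i)) (word k b g))))
    {a a' b b' : List (Fin n)} {i j i' j' : Fin n} (g : G)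
    (e : a ++ j :: i :: b = a' ++ j' :: i' :: b')
    (hL : (a ++ j :: i :: b).length = L) (hW : weight (a ++ j :: i :: b) = W)
    (hij : i < j) (hij' : i' < j') (ha : a'.length ≤ a.length) :
    D.nf x s (a ++ i :: j :: b) g
        + D.nfMap x s (opWord k G a (D.opG x (D.kap (x j) (x i)) (word k b g))) =
      D.nf x s (a' ++ i' :: j' :: b') g
        + D.nfMap x s (opWord k G a' (D.opG x (D.kap (x j') (x i')) (word k b' g))) := by
  obtain ⟨t, rfl⟩ : ∃ t, a = a' ++ t := by
    have : a' <+: a := List.prefix_of_prefix_length_le (l₃ := a ++ j :: i :: b)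
      ⟨_, e.symm⟩ ⟨_, rfl⟩ ha
    obtain ⟨t, ht⟩ := this
    exact ⟨t, ht.symm⟩
  rw [List.append_assoc, List.append_cancel_left_eq] at e
  rw [List.append_assoc] at hL hW
  -- The length of t separates the possible positions of the two descents: the same place (0), a
  -- common letter (1), disjoint (at least 2).
  match t, e with
  | [], e =>
    simp only [List.nil_append, List.cons.injEq] at e
    obtain ⟨rfl, rfl, rfl⟩ := e
    simp
  | [l], e =>
    simp only [List.cons_append, List.nil_append, List.cons.injEq] at e
    obtain ⟨rfl, rfl, rfl⟩ := e
    simp only [List.cons_append, List.nil_append] at hL hW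
    have w₁ := weight_swap_lt (a' ++ [l]) b hij
    have w₂ := weight_swap_lt a' (i :: b) hij'
    have w₃ := weight_swap_lt a' (j :: b) (hij.trans hij')
    have w₄ := weight_swap_lt (a' ++ [j]) b (hij.trans hij')
    simp only [List.append_assoc, List.cons_append, List.nil_append] at w₁ w₂ w₃ w₄
    -- Here l > j > i. Both reductions of l j i are continued to i j l, through l i j, i l j on one
    -- side and j l i, j i l on the other. The six corrections left over are the terms of the cyclic
    -- identity c.
    have r₁ := rule a' l i (j :: b) g (by simpa using hL) (by omega) (hij.trans hij')
    have r₂ := rule (a' ++ [i]) l j b g (by simpa using hL)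
      (by simpa only [List.append_assoc, List.cons_append, List.nil_append] using by omega) hij'
    have r₃ := rule (a' ++ [j]) l i b g (by simpa using hL)
      (by simpa only [List.append_assoc, List.cons_append, List.nil_append] using by omega)
      (hij.trans hij')
    have r₄ := rule a' j i (l :: b) g (by simpa using hL) (by omega) hij
    have c := congrArg (fun f => D.nfMap x s (opWord k G a' f))
      (D.opRel_cyclic x (x l) (x j) (x i) (word k b g))
    simp only [D.kap_swap (x i) (x l), map_neg, LinearMap.neg_apply, map_add, map_sub, map_zero,
      opV_basis, opLetter_word] at c
    simp only [List.append_assoc, List.cons_append, List.nil_append, opWord_append, opWord_cons,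
      opWord_nil] at r₁ r₂ r₃ r₄ ⊢
    rw [r₁, r₂, r₃, r₄, ← sub_eq_zero, ← neg_eq_zero, ← c]
    abel
  | l :: l' :: t, e =>
    simp only [List.cons_append, List.cons.injEq] at e
    obtain ⟨rfl, rfl, rfl⟩ := e
    simp only [List.cons_append] at hL hW
    have w₁ := weight_swap_lt (a' ++ l :: l' :: t) b hij
    have w₂ := weight_swap_lt a' (t ++ j :: i :: b) hij'
    simp only [List.append_assoc, List.cons_append] at w₁ w₂
    have r₁ := rule a' l l' (t ++ i :: j :: b) g (by simpa using hL) (by omega) hij'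
    have r₂ := rule (a' ++ l' :: l :: t) j i b g (by simpa using hL)
      (by simpa only [List.append_assoc, List.cons_append] using by omega) hij
    have hlen : a'.length + t.length + b.length + 4 = L := by
      rw [← hL]; simp only [List.length_append, List.length_cons]; omega
    have hb : word k b g ∈ lenLE k G n b.length := word_mem_lenLE le_rfl g
    -- Each exchange leaves a correction in which the other descent has not yet been reduced.
    -- Comparing them costs one relation to the right of a value of κ (k₁) and one to the left of
    -- such a value (k₂), both of length below L.
    have k₁ := kill (a'.length + (t.length + b.length + 2)) (by omega) _
      (D.opWord_mem_relLE x a' (D.opG_mem_relLE x (D.kap (x l) (x l'))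
        (D.mem_relLE x t (x j) (x i) hb le_rfl)))
    have k₂ := kill (a'.length + (t.length + b.length) + 2) (by omega) _
      (D.mem_relLE x a' (x l) (x l') (opWord_mem_lenLE t
        (D.opG_mem_lenLE x (D.kap (x j) (x i)) hb)) le_rfl)
    simp only [opRel_apply, map_sub, opV_basis, opLetter_word, opWord_word] at k₁ k₂
    simp only [List.append_assoc, List.cons_append, opWord_append, opWord_cons] at r₁ r₂ ⊢
    rw [r₁, r₂, ← sub_eq_zero]
    rw [← sub_eq_zero, ← sub_eq_zero, sub_zero] at k₁
    refine Eq.trans ?_ ((congrArg₂ (· - ·) k₂ k₁).trans (sub_zero 0))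
    abel

/-- The given descent is compared with the one used by the recursion through `confluence`; the
induction on the weight supplies the rule for all intermediate words. -/
theorem nf_rule (L : ℕ) (kill : ∀ m < L, ∀ f ∈ D.relLE x m, D.nfMap x s f = 0) (W : ℕ) :
    ∀ a j i b g, (a ++ j :: i :: b).length = L → weight (a ++ j :: i :: b) = W → i < j →
      D.nf x s (a ++ j :: i :: b) g = D.nf x s (a ++ i :: j :: b) g
        + D.nfMap x s (opWord k G a (D.opG x (D.kap (x j) (x i)) (word k b g))) := by
  induction W using Nat.strong_induction_on with
  | _ W ih =>
    intro a j i b g hL hW hij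
    have rule := fun a j i b g hL hW hij => ih _ hW a j i b g hL rfl hij
    obtain ⟨⟨a', j', i', b'⟩, ⟨e, hij'⟩, h⟩ :=
      D.exists_nf_eq x s (a ++ j :: i :: b) g ⟨(a, j, i, b), rfl, hij⟩
    simp only at e hij' h
    rw [h]
    rcases le_total a'.length a.length with ha | ha
    · exact (D.confluence x s kill rule g e hL hW hij hij' ha).symm
    · exact D.confluence x s kill rule g e.symm (e ▸ hL) (e ▸ hW) hij' hij ha

/-- The diamond lemma. By multilinearity only words and basis letters matter; for two distinct
letters the claim is `nf_rule`, up to sign, with relations of smaller length already killed by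
induction. -/
theorem nfMap_relLE (L : ℕ) : ∀ f ∈ D.relLE x L, D.nfMap x s f = 0 := by
  induction L using Nat.strong_induction_on with
  | _ L ih =>
    intro f hf
    rw [← Submodule.mem_bot k]
    refine D.map_relLE_le x _ _ (fun a u v l f hf hl => ?_) hf
    rw [Submodule.mem_bot]
    rcases hl.lt_or_eq with hl | hl
    · exact ih _ hl _ (D.mem_relLE x a u v hf le_rfl)
    induction hf using Submodule.span_induction with
    | zero => simp
    | add f f' _ _ hf hf' => simp only [map_add, hf, hf', add_zero]
    | smul c f _ hf => simp only [map_smul, hf, smul_zero]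
    | mem f hf =>
      obtain ⟨b, g, hb, rfl⟩ := hf
      rcases hb.lt_or_eq with hb | hb
      · exact ih _ (by omega) _ (D.mem_relLE x a u v (word_mem_lenLE le_rfl g) le_rfl)
      have key : ∀ i j, i < j → D.nfMap x s (opWord k G a (D.opRel x (x j) (x i) (word k b g)))
          = 0 := fun i j hij => by
        have := D.nf_rule x s L ih _ a j i b g
          (by simp only [List.length_append, List.length_cons]; omega) rfl hij
        simp only [opRel_apply, map_sub, opV_basis, opLetter_word, opWord_word, nfMap_word, this]
        abel
      induction u using basis_induction x with
      | zero => simp [opRel_apply]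
      | add u u' hu hu' =>
        refine Eq.trans ?_ ((congrArg₂ (· + ·) hu hu').trans (add_zero 0))
        simp only [opRel_apply, map_add, map_sub, LinearMap.add_apply]
        abel
      | smul c u hu =>
        rw [← smul_zero c, ← hu]
        simp only [opRel_apply, map_smul, map_sub, LinearMap.smul_apply, smul_sub]
      | basis i =>
        induction v using basis_induction x with
        | zero => simp [opRel_apply]
        | add u u' hu hu' =>
          refine Eq.trans ?_ ((congrArg₂ (· + ·) hu hu').trans (add_zero 0))
          simp only [opRel_apply, map_add, map_sub, LinearMap.add_apply]
          abel
        | smul c u hu =>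
          rw [← smul_zero c, ← hu]
          simp only [opRel_apply, map_smul, map_sub, LinearMap.smul_apply, smul_sub]
        | basis j =>
          rcases lt_trichotomy i j with h | rfl | h
          · rw [← neg_eq_zero, ← key i j h]
            simp only [opRel_apply, D.kap_swap (x i), map_sub, map_neg, LinearMap.neg_apply]
            abel
          -- Equal letters need κ(v,v) = 0 itself; antisymmetry would not suffice in characteristic
          -- 2.
          · simp [opRel_apply, D.kap_self]
          · exact key j i h

end PBWDatum

/-! ### The monomial basis of A and its grading -/

section SkewBasis

variable {k V G : Type*} [Field k] [AddCommGroup V] [Module k V] [Group G]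
  [DistribMulAction G V] [SMulCommClass G k V] {n : ℕ} (x : Module.Basis (Fin n) k V)

theorem smul_ι (g : G) (v : V) :
    g • SymmetricAlgebra.ι k V v = SymmetricAlgebra.ι k V (g • v) := by
  change symAct k V G g _ = _
  simp [symAct]

theorem gA_one : gA k V (1 : G) = 1 := rfl

theorem gA_mul_gA (g h : G) : gA k V g * gA k V h = gA k V (g * h) := by
  simp [gA, mono_mul_mono]

theorem vA_mul_mono (v : V) (g : G) (s : SymmetricAlgebra k V) :
    vA k V G v * mono k V G g s = mono k V G g (SymmetricAlgebra.ι k V v * s) := by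
  simp [vA, mono_mul_mono]

/-- The product of basis elements of `V`, as an element of `S(V)`. -/
def symMonomial (m : Multiset (Fin n)) : SymmetricAlgebra k V :=
  (m.map fun i => SymmetricAlgebra.ι k V (x i)).prod

@[simp]
theorem symMonomial_zero : symMonomial x 0 = 1 := by simp [symMonomial]

@[simp]
theorem symMonomial_cons (i : Fin n) (m : Multiset (Fin n)) :
    symMonomial x (i ::ₘ m) = SymmetricAlgebra.ι k V (x i) * symMonomial x m := by
  simp [symMonomial]

/-- The basis of `S(V)` which consists of the monomials. -/
def symBasis : Module.Basis (Multiset (Fin n)) k (SymmetricAlgebra k V) :=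
  x.symmetricAlgebra.reindex Multiset.toFinsupp.symm.toEquiv

theorem symBasis_apply (m : Multiset (Fin n)) : symBasis x m = symMonomial x m := by
  have h : symBasis x m = (SymmetricAlgebra.equivMvPolynomial x).symm
      (MvPolynomial.monomial (Multiset.toFinsupp m) 1) := by
    simp [symBasis, Module.Basis.symmetricAlgebra]
  rw [h]
  induction m using Multiset.induction with
  | empty => simp
  | cons i m ih =>
    have h' : (MvPolynomial.monomial (Multiset.toFinsupp (i ::ₘ m)) (1 : k)) =
        MvPolynomial.X i * MvPolynomial.monomial (Multiset.toFinsupp m) 1 := by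
      rw [← Multiset.singleton_add, map_add, Multiset.toFinsupp_singleton, MvPolynomial.X,
        MvPolynomial.monomial_mul, one_mul]
    rw [h', map_mul, SymmetricAlgebra.equivMvPolynomial_symm_X, symMonomial_cons]
    rw [ih]
    simp [symBasis, Module.Basis.symmetricAlgebra]

variable (k V G) in
/-- The coefficients in `S(V)` of an element of `S(V) # G`. -/
def skewCoeff : Skew k V G ≃ₗ[k] G →₀ SymmetricAlgebra k V :=
  SkewMonoidAlgebra.coeffLinearEquiv (S := k) (k := SymmetricAlgebra k V) (G := G)

theorem skewCoeff_mono (g : G) (s : SymmetricAlgebra k V) :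
    skewCoeff k V G (mono k V G g s) = Finsupp.single g s := rfl

variable (G) in
/-- The basis of `S(V) # G` which consists of the products of monomials and group elements. -/
def skewBasis : Module.Basis (Multiset (Fin n) × G) k (Skew k V G) :=
  ((Finsupp.basis fun _ : G => symBasis x).map (skewCoeff k V G).symm).reindex
    ((Equiv.sigmaEquivProd G (Multiset (Fin n))).trans (Equiv.prodComm _ _))

theorem skewBasis_apply (m : Multiset (Fin n)) (g : G) :
    skewBasis G x (m, g) = mono k V G g (symMonomial x m) := by
  rw [← symBasis_apply, skewBasis, Module.Basis.reindex_apply, Module.Basis.map_apply]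
  have : (Finsupp.basis fun _ : G => symBasis x)
      (((Equiv.sigmaEquivProd G (Multiset (Fin n))).trans (Equiv.prodComm _ _)).symm (m, g)) =
      Finsupp.single g (symBasis x m) := by
    simp
  rw [this]
  rfl

theorem skewBasis_zero (g : G) : skewBasis G x (0, g) = gA k V g := by
  rw [skewBasis_apply, symMonomial_zero]
  rfl

theorem vA_mul_skewBasis (i : Fin n) (m : Multiset (Fin n)) (g : G) :
    vA k V G (x i) * skewBasis G x (m, g) = skewBasis G x (i ::ₘ m, g) := by
  rw [skewBasis_apply, skewBasis_apply, vA_mul_mono, symMonomial_cons]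

theorem symMonomial_mem (m : Multiset (Fin n)) :
    symMonomial x m ∈ (LinearMap.range (SymmetricAlgebra.ι k V)) ^ m.card := by
  induction m using Multiset.induction with
  | empty => simp
  | cons i m ih =>
    rw [symMonomial_cons, Multiset.card_cons, pow_succ']
    exact Submodule.mul_mem_mul ⟨_, rfl⟩ ih

theorem range_ι_pow_le (m : ℕ) : (LinearMap.range (SymmetricAlgebra.ι k V)) ^ m ≤
    Submodule.span k {s | ∃ q : Multiset (Fin n), q.card = m ∧ s = symMonomial x q} := by
  induction m with
  | zero =>
    rw [pow_zero, Submodule.one_le]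
    exact Submodule.subset_span ⟨0, rfl, (symMonomial_zero x).symm⟩
  | succ m ih =>
    rw [pow_succ', Submodule.mul_le]
    rintro _ ⟨v, rfl⟩ s hs
    replace hs := ih hs
    induction v using PBWDatum.basis_induction x with
    | zero => simp
    | add u v hu hv => rw [map_add, add_mul]; exact add_mem hu hv
    | smul a v hv => rw [map_smul, smul_mul_assoc]; exact Submodule.smul_mem _ _ hv
    | basis i =>
      induction hs using Submodule.span_induction with
      | zero => simp
      | add u v _ _ hu hv => rw [mul_add]; exact add_mem hu hv
      | smul a v _ hv => rw [mul_smul_comm]; exact Submodule.smul_mem _ _ hv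
      | mem s hs =>
        obtain ⟨q, hq, rfl⟩ := hs
        exact Submodule.subset_span ⟨i ::ₘ q, by simp [hq], (symMonomial_cons x i q).symm⟩

/-- This makes the monomials a homogeneous basis, so that degree arguments in A become statements
about cardinalities of multisets. -/
theorem aGr_eq_span (d : ℤ) : aGr k V G d =
    Submodule.span k {y | ∃ q : Multiset (Fin n) × G, (q.1.card : ℤ) = d ∧ y = skewBasis G x q} := by
  apply le_antisymm
  · rw [aGr, Submodule.span_le]
    rintro _ ⟨m, g, s, hm, hs, rfl⟩
    replace hs := range_ι_pow_le x m hs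
    rw [SetLike.mem_coe]
    induction hs using Submodule.span_induction with
    | zero => simp
    | add u v _ _ hu hv => rw [map_add]; exact add_mem hu hv
    | smul a v _ hv => rw [map_smul]; exact Submodule.smul_mem _ _ hv
    | mem s hs =>
      obtain ⟨q, hq, rfl⟩ := hs
      exact Submodule.subset_span ⟨(q, g), by simpa [hq] using hm, (skewBasis_apply x q g).symm⟩
  · rw [Submodule.span_le]
    rintro _ ⟨⟨m, g⟩, hq, rfl⟩
    exact Submodule.subset_span ⟨m.card, g, _, hq, symMonomial_mem x m, skewBasis_apply x m g⟩

theorem smul_mem_range_ι_pow (g : G) {m : ℕ} {s : SymmetricAlgebra k V}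
    (hs : s ∈ (LinearMap.range (SymmetricAlgebra.ι k V)) ^ m) :
    g • s ∈ (LinearMap.range (SymmetricAlgebra.ι k V)) ^ m := by
  have h : ((LinearMap.range (SymmetricAlgebra.ι k V)) ^ m).map (symAct k V G g).toLinearMap ≤
      (LinearMap.range (SymmetricAlgebra.ι k V)) ^ m := by
    rw [Submodule.map_pow]
    refine pow_le_pow_left' ?_ m
    rintro _ ⟨_, ⟨v, rfl⟩, rfl⟩
    exact ⟨g • v, (smul_ι g v).symm⟩
  exact h ⟨s, hs, rfl⟩

theorem aGr_mul_mem {p q : ℤ} {a b : Skew k V G} (ha : a ∈ aGr k V G p) (hb : b ∈ aGr k V G q) :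
    a * b ∈ aGr k V G (p + q) := by
  have h : aGr k V G p * aGr k V G q ≤ aGr k V G (p + q) := by
    rw [aGr, aGr, Submodule.span_mul_span, Submodule.span_le]
    rintro _ ⟨_, ⟨m, g, s, rfl, hs, rfl⟩, _, ⟨m', g', s', rfl, hs', rfl⟩, rfl⟩
    refine Submodule.subset_span ⟨m + m', g * g', s * g • s', by simp, ?_, mono_mul_mono ..⟩
    rw [pow_add]
    exact Submodule.mul_mem_mul hs (smul_mem_range_ι_pow g hs')
  exact h (Submodule.mul_mem_mul ha hb)

theorem gA_mem_aGr (g : G) : gA k V g ∈ aGr k V G 0 :=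
  Submodule.subset_span ⟨0, g, 1, rfl, by simp, rfl⟩

theorem one_mem_aGr : (1 : Skew k V G) ∈ aGr k V G 0 := gA_mem_aGr 1

theorem vA_mem_aGr (v : V) : vA k V G v ∈ aGr k V G 1 :=
  Submodule.subset_span ⟨1, 1, _, rfl, by rw [pow_one]; exact ⟨v, rfl⟩, rfl⟩

theorem aGr_of_neg {d : ℤ} (hd : d < 0) : aGr k V G d = ⊥ := by
  rw [aGr, Submodule.span_eq_bot]
  rintro _ ⟨m, g, s, hm, -⟩
  omega

variable (k V G) in
/-- The inclusion of `kG` in `A`. -/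
def kgA : MonoidAlgebra k G →ₗ[k] Skew k V G := kgLift (gA k V)

@[simp]
theorem kgA_single (g : G) : kgA k V G (MonoidAlgebra.single g 1) = gA k V g := by simp [kgA]

theorem kgA_mem_aGr (c : MonoidAlgebra k G) : kgA k V G c ∈ aGr k V G 0 := by
  induction c using kg_induction with
  | single g => rw [kgA_single]; exact gA_mem_aGr g
  | zero => simp
  | add c d hc hd => rw [map_add]; exact add_mem hc hd
  | smul a c hc => rw [map_smul]; exact Submodule.smul_mem _ _ hc

theorem projkG_mono (g : G) (s : SymmetricAlgebra k V) :
    projkG k V G (mono k V G g s) = MonoidAlgebra.single g (SymmetricAlgebra.algebraMapInv s) := by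
  change (MonoidAlgebra.coeffLinearEquiv k).symm (Finsupp.mapRange.linearMap
    (SymmetricAlgebra.algebraMapInv (R := k) (M := V)).toLinearMap (Finsupp.single g s)) = _
  rw [Finsupp.mapRange.linearMap_apply, Finsupp.mapRange_single]
  rfl

theorem projkG_gA (g : G) : projkG k V G (gA k V g) = MonoidAlgebra.single g 1 := by
  rw [gA, projkG_mono, map_one]

/-- Products of zero vectors are scalars, so A_0 is `kG`. This recovers a value of ψ^*λ in A_0 from
the parameter in `kG`. -/
theorem kgA_projkG {a : Skew k V G} (ha : a ∈ aGr k V G 0) : kgA k V G (projkG k V G a) = a := by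
  rw [aGr] at ha
  induction ha using Submodule.span_induction with
  | zero => simp
  | add u v _ _ hu hv => rw [map_add, map_add, hu, hv]
  | smul a v _ hv => rw [map_smul, map_smul, hv]
  | mem a ha =>
    obtain ⟨m, g, s, hm, hs, rfl⟩ := ha
    obtain rfl : m = 0 := by omega
    rw [pow_zero, Submodule.mem_one] at hs
    obtain ⟨c, rfl⟩ := hs
    rw [Algebra.algebraMap_eq_smul_one, map_smul, ← gA, map_smul, projkG_gA, map_smul, kgA_single]

end SkewBasis

/-! ### Bases with degrees -/

section Below

variable {k A J : Type*} [Field k] [Ring A] [Algebra k A] (e : Module.Basis J k A) (deg : J → ℕ)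

/-- The span of the basis elements of degree less than `m`. -/
def below (m : ℕ) : Submodule k A := Submodule.span k {a | ∃ q, deg q < m ∧ a = e q}

theorem basis_mem_below {m : ℕ} {q : J} (h : deg q < m) : e q ∈ below e deg m :=
  Submodule.subset_span ⟨q, h, rfl⟩

theorem below_mono {m m' : ℕ} (h : m ≤ m') : below e deg m ≤ below e deg m' :=
  Submodule.span_mono fun _ ⟨q, hq, e⟩ => ⟨q, hq.trans_le h, e⟩

end Below

namespace PBWDatum

variable {k V G : Type*} [Field k] [AddCommGroup V] [Module k V] [Group G]
  [DistribMulAction G V] [SMulCommClass G k V] {n : ℕ}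
  (D : PBWDatum k V G) (x : Module.Basis (Fin n) k V)

/-! ### The projection of the space of words onto `A` and its section -/

/-- The product of the letters of a word, in `A`. -/
def commWord : WordSpace k G n →ₗ[k] Skew k V G :=
  Finsupp.linearCombination k fun q => skewBasis G x (↑q.1, q.2)

@[simp]
theorem commWord_word (w : List (Fin n)) (g : G) :
    commWord x (word k w g) = skewBasis G x (↑w, g) := by
  simp [commWord, word]

/-- The normal form of a word, as an element of `A`. -/
def proj : WordSpace k G n →ₗ[k] Skew k V G :=
  D.nfMap x fun w g => skewBasis G x (↑w, g)

/-- The section of `proj` which sends monomials to sorted words. -/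
def sec : Skew k V G →ₗ[k] WordSpace k G n :=
  (skewBasis G x).constr k fun q => word k (q.1.sort (· ≤ ·)) q.2

@[simp]
theorem sec_skewBasis (m : Multiset (Fin n)) (g : G) :
    sec x (skewBasis G x (m, g)) = word k (m.sort (· ≤ ·)) g := by
  simp [sec]

theorem not_isDescent_of_sortedLE {w : List (Fin n)} (hw : w.SortedLE)
    (q : List (Fin n) × Fin n × Fin n × List (Fin n)) : ¬ IsDescent w q := by
  rintro ⟨h, hlt⟩
  rw [h] at hw
  have := List.pairwise_append.1 hw.pairwise
  have h' := (List.pairwise_cons.1 this.2.1).1 q.2.2.1 (by simp)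
  exact absurd hlt (not_lt.2 h')

theorem sortedLE_of_forall_not_isDescent {w : List (Fin n)} (h : ∀ q, ¬ IsDescent w q) :
    w.SortedLE := by
  rw [List.sortedLE_iff_isChain, List.isChain_iff_forall_rel_of_append_cons_cons]
  intro a b l₁ l₂ e
  by_contra hab
  exact h (l₁, a, b, l₂) ⟨e, not_le.1 hab⟩

theorem proj_word_of_sortedLE {w : List (Fin n)} (hw : w.SortedLE) (g : G) :
    D.proj x (word k w g) = skewBasis G x (↑w, g) := by
  rw [proj, nfMap_word, nf_of_forall_not _ _ _ _ _ (not_isDescent_of_sortedLE hw)]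

theorem proj_sec (a : Skew k V G) : D.proj x (sec x a) = a := by
  have : D.proj x ∘ₗ sec x = LinearMap.id := (skewBasis G x).ext fun ⟨m, g⟩ => by
    rw [LinearMap.comp_apply, sec_skewBasis,
      D.proj_word_of_sortedLE x (Multiset.pairwise_sort m (· ≤ ·)).sortedLE, Multiset.sort_eq]
    rfl
  exact LinearMap.congr_fun this a

theorem proj_relLE {m : ℕ} {f : WordSpace k G n} (hf : f ∈ D.relLE x m) : D.proj x f = 0 :=
  D.nfMap_relLE x _ m f hf

/-- Every rewriting step changes a word by a relation of no larger length. With `proj_relLE` this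
identifies the kernel of `proj` with the span of all relations. -/
theorem sec_proj_sub_mem (L : ℕ) :
    ∀ f ∈ lenLE k G n L, sec x (D.proj x f) - f ∈ D.relLE x L := by
  induction L using Nat.strong_induction_on with
  | _ L ih =>
    have key : ∀ W w, weight w = W → w.length = L → ∀ g,
        sec x (D.proj x (word k w g)) - word k w g ∈ D.relLE x L := by
      intro W
      induction W using Nat.strong_induction_on with
      | _ W ihW =>
        intro w hW hL g
        by_cases h : ∃ q, IsDescent w q
        · obtain ⟨⟨a, j, i, b⟩, ⟨rfl, hij⟩, h⟩ := D.exists_nf_eq x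
            (fun w g => skewBasis G x (↑w, g)) w g h
          simp only at hij h hL hW
          simp only [List.length_append, List.length_cons] at hL
          have hb : word k b g ∈ lenLE k G n b.length := word_mem_lenLE le_rfl g
          have h₁ := ihW _ (hW ▸ weight_swap_lt a b hij) (a ++ i :: j :: b) rfl
            (by simp only [List.length_append, List.length_cons]; omega) g
          have h₂ := D.relLE_mono x (m := a.length + b.length) (m' := L) (by omega) (ih (a.length + b.length) (by omega) _
            (opWord_mem_lenLE a (D.opG_mem_lenLE x (D.kap (x j) (x i)) hb)))
          have h₃ := D.mem_relLE x (m := L) a (x j) (x i) hb (by omega)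
          simp only [opRel_apply, map_sub, opV_basis, opLetter_word, opWord_word] at h₃
          have h' : D.proj x (word k (a ++ j :: i :: b) g) = D.proj x (word k (a ++ i :: j :: b) g)
              + D.proj x (opWord k G a (D.opG x (D.kap (x j) (x i)) (word k b g))) := by
            rw [proj, nfMap_word, nfMap_word]
            exact h
          rw [h', map_add]
          convert sub_mem (add_mem h₁ h₂) h₃ using 1
          abel
        · have hw := sortedLE_of_forall_not_isDescent (not_exists.1 h)
          have e : w = (w : Multiset (Fin n)).sort (· ≤ ·) := by
            rw [Multiset.coe_sort, List.mergeSort_eq_self]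
            exact hw.pairwise
          rw [D.proj_word_of_sortedLE x hw, sec_skewBasis, ← e, sub_self]
          exact zero_mem _
    intro f hf
    have := map_lenLE_le (sec x ∘ₗ D.proj x - LinearMap.id) (D.relLE x L) (fun w g hw => ?_) hf
    · exact this
    · rcases hw.lt_or_eq with hw | hw
      · exact D.relLE_mono x hw.le (ih _ hw _ (word_mem_lenLE le_rfl g))
      · exact key _ w rfl hw g

theorem exists_sec_proj_sub_mem (f : WordSpace k G n) :
    ∃ m, sec x (D.proj x f) - f ∈ D.relLE x m := by
  obtain ⟨m, hm⟩ := exists_mem_lenLE f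
  exact ⟨m, D.sec_proj_sub_mem x m f hm⟩

/-- Left multiplication by v preserves the span of the relations, hence descends along `proj` to an
operator on A. -/
theorem proj_opV_sec_proj (v : V) (f : WordSpace k G n) :
    D.proj x (opV G x v (sec x (D.proj x f))) = D.proj x (opV G x v f) := by
  obtain ⟨m, hm⟩ := D.exists_sec_proj_sub_mem x f
  rw [← sub_eq_zero, ← map_sub, ← map_sub]
  exact D.proj_relLE x (D.opV_mem_relLE x v hm)

theorem proj_opG_sec_proj (c : MonoidAlgebra k G) (f : WordSpace k G n) :
    D.proj x (D.opG x c (sec x (D.proj x f))) = D.proj x (D.opG x c f) := by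
  obtain ⟨m, hm⟩ := D.exists_sec_proj_sub_mem x f
  rw [← sub_eq_zero, ← map_sub, ← map_sub]
  exact D.proj_relLE x (D.opG_mem_relLE x c hm)

/-! ### The algebra `H_{λ,κ}` and its action on `A` -/

/-- The algebra `H_{λ,κ}`. -/
abbrev Alg := HAlg (fun (g : G) (v : V) => D.lam (MonoidAlgebra.single g 1) v)
  (fun v w => D.kap v w)

/-- The image of a generator or relation in `H_{λ,κ}`. -/
def toAlg : FreeAlgebra k (V ⊕ G) →ₐ[k] D.Alg := RingQuot.mkAlgHom k _

/-- The map `V → H_{λ,κ}`. -/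
def hV : V →ₗ[k] D.Alg where
  toFun v := D.toAlg (FreeAlgebra.ι k (Sum.inl v))
  map_add' v w := by rw [← map_add]; exact RingQuot.mkAlgHom_rel k (HRel.add v w)
  map_smul' c v := by
    rw [RingHom.id_apply, ← map_smul]; exact RingQuot.mkAlgHom_rel k (HRel.smul c v)

/-- The map `kG → H_{λ,κ}`. -/
def hG : MonoidAlgebra k G →ₐ[k] D.Alg :=
  MonoidAlgebra.lift k D.Alg G
    { toFun := fun g => D.toAlg (FreeAlgebra.ι k (Sum.inr g))
      map_one' := (RingQuot.mkAlgHom_rel k HRel.one).trans (map_one _)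
      map_mul' := fun g h => (RingQuot.mkAlgHom_rel k (HRel.mul g h)).trans (map_mul _ _ _) }

theorem hG_single (g : G) :
    D.hG (MonoidAlgebra.single g 1) = D.toAlg (FreeAlgebra.ι k (Sum.inr g)) := by
  simp [hG]
  rfl

theorem lift_ofkG {B : Type*} [Ring B] [Algebra k B] (F : FreeAlgebra k (V ⊕ G) →ₐ[k] B)
    (f : MonoidAlgebra k G →ₗ[k] B)
    (h : ∀ g, F (FreeAlgebra.ι k (Sum.inr g)) = f (MonoidAlgebra.single g 1))
    (c : MonoidAlgebra k G) : F (ofkG c) = f c := by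
  have : F.toLinearMap ∘ₗ kgLift (fun g => FreeAlgebra.ι k (Sum.inr g)) = f :=
    kg_hom_ext fun g => by simpa using h g
  exact LinearMap.congr_fun this c

theorem toAlg_ofkG (c : MonoidAlgebra k G) : D.toAlg (ofkG c) = D.hG c :=
  lift_ofkG D.toAlg D.hG.toLinearMap (fun g => (D.hG_single g).symm) c

theorem hV_mul_hV (v w : V) :
    D.hV v * D.hV w - D.hV w * D.hV v = D.hG (D.kap v w) := by
  rw [← toAlg_ofkG]
  refine Eq.trans ?_ (RingQuot.mkAlgHom_rel k (HRel.vw v w))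
  simp only [map_sub, map_mul]
  rfl

theorem hG_mul_hV (g : G) (v : V) :
    D.hG (MonoidAlgebra.single g 1) * D.hV v
      - D.hV (g • v) * D.hG (MonoidAlgebra.single g 1) =
        D.hG (D.lam (MonoidAlgebra.single g 1) v) := by
  rw [← D.toAlg_ofkG (D.lam _ v), hG_single]
  refine Eq.trans ?_ (RingQuot.mkAlgHom_rel k (HRel.gv g v))
  simp only [map_sub, map_mul]
  rfl

section Lift

variable {B : Type*} [Ring B] [Algebra k B] (fV : V →ₗ[k] B) (fG : MonoidAlgebra k G →ₐ[k] B)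
  (hvw : ∀ v w, fV v * fV w - fV w * fV v = fG (D.kap v w))
  (hgv : ∀ g v, fG (MonoidAlgebra.single g 1) * fV v - fV (g • v) * fG (MonoidAlgebra.single g 1) =
    fG (D.lam (MonoidAlgebra.single g 1) v))

/-- The universal property of `H_{λ,κ}`. -/
def algLift : D.Alg →ₐ[k] B :=
  RingQuot.liftAlgHom k ⟨FreeAlgebra.lift k (Sum.elim fV fun g => fG (MonoidAlgebra.single g 1)), by
    have h := lift_ofkG (FreeAlgebra.lift k (Sum.elim fV fun g => fG (MonoidAlgebra.single g 1)))
      fG.toLinearMap (fun g => by simp)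
    rintro _ _ (⟨v, w⟩ | ⟨c, v⟩ | _ | ⟨g, g'⟩ | ⟨v, w⟩ | ⟨g, v⟩)
    · simp
    · simp
    · rw [map_one, FreeAlgebra.lift_ι_apply]
      exact (congrArg fG MonoidAlgebra.one_def.symm).trans (map_one fG)
    · rw [map_mul]
      simp only [FreeAlgebra.lift_ι_apply, Sum.elim_inr]
      rw [← map_mul, MonoidAlgebra.single_mul_single, one_mul]
    · rw [h]; simpa using hvw v w
    · rw [h]; simpa using hgv g v⟩

theorem algLift_toAlg (a : FreeAlgebra k (V ⊕ G)) : D.algLift fV fG hvw hgv (D.toAlg a) =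
    FreeAlgebra.lift k (Sum.elim fV fun g => fG (MonoidAlgebra.single g 1)) a :=
  RingQuot.liftAlgHom_mkAlgHom_apply k _ _ _

theorem algLift_hV (v : V) : D.algLift fV fG hvw hgv (D.hV v) = fV v := by
  refine (D.algLift_toAlg fV fG hvw hgv _).trans ?_
  simp

theorem algLift_hG (c : MonoidAlgebra k G) : D.algLift fV fG hvw hgv (D.hG c) = fG c := by
  have : (D.algLift fV fG hvw hgv).toLinearMap ∘ₗ D.hG.toLinearMap = fG.toLinearMap :=
    kg_hom_ext fun g => by
      simp only [LinearMap.comp_apply, AlgHom.toLinearMap_apply]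
      rw [hG_single]
      rw [algLift_toAlg]
      simp
  exact LinearMap.congr_fun this c

end Lift

/-- An induction principle for `H_{λ,κ}`. -/
theorem alg_induction {P : D.Alg → Prop} (a : D.Alg) (V : ∀ v, P (D.hV v))
    (G : ∀ g : G, P (D.hG (MonoidAlgebra.single g 1)))
    (scalar : ∀ c : k, P (algebraMap k _ c)) (add : ∀ a b, P a → P b → P (a + b))
    (mul : ∀ a b, P a → P b → P (a * b)) : P a := by
  obtain ⟨a, rfl⟩ := RingQuot.mkAlgHom_surjective k _ a
  induction a using FreeAlgebra.induction with
  | grade0 c => rw [AlgHom.commutes]; exact scalar c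
  | grade1 y =>
    rcases y with v | g
    · exact V v
    · have := G g
      rwa [hG_single] at this
  | mul a b ha hb => rw [map_mul]; exact mul _ _ ha hb
  | add a b ha hb => rw [map_add]; exact add _ _ ha hb

/-- The product of the letters of a word, in `H_{λ,κ}`. -/
def wordAlg : WordSpace k G n →ₗ[k] D.Alg :=
  Finsupp.linearCombination k fun q =>
    (q.1.map fun i => D.hV (x i)).prod * D.hG (MonoidAlgebra.single q.2 1)

theorem wordAlg_word (w : List (Fin n)) (g : G) : D.wordAlg x (word k w g) =
    (w.map fun i => D.hV (x i)).prod * D.hG (MonoidAlgebra.single g 1) := by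
  simp [wordAlg, word]

theorem wordAlg_opV (v : V) (f : WordSpace k G n) :
    D.wordAlg x (opV G x v f) = D.hV v * D.wordAlg x f := by
  induction v using basis_induction x with
  | zero => simp
  | add u v hu hv => simp only [map_add, LinearMap.add_apply, hu, hv, add_mul]
  | smul a v hv => simp only [map_smul, LinearMap.smul_apply, hv, smul_mul_assoc]
  | basis i =>
    have : D.wordAlg x ∘ₗ opV G x (x i) = LinearMap.mulLeft k (D.hV (x i)) ∘ₗ D.wordAlg x :=
      word_hom_ext fun w g => by simp [wordAlg_word, mul_assoc]
    exact LinearMap.congr_fun this f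

theorem wordAlg_opG (c : MonoidAlgebra k G) (f : WordSpace k G n) :
    D.wordAlg x (D.opG x c f) = D.hG c * D.wordAlg x f := by
  have key : ∀ w g c, D.wordAlg x (D.opG x c (word k w g)) = D.hG c * D.wordAlg x (word k w g) := by
    intro w h
    induction w with
    | nil =>
      intro c
      induction c using kg_induction with
      | zero => simp
      | add u v hu hv => simp only [map_add, LinearMap.add_apply, hu, hv, add_mul]
      | smul a v hv => simp only [map_smul, LinearMap.smul_apply, hv, smul_mul_assoc]
      | single g =>
        rw [opG_word_nil, wordAlg_word, wordAlg_word]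
        simp [← map_mul, MonoidAlgebra.single_mul_single]
    | cons i w ih =>
      intro c
      induction c using kg_induction with
      | zero => simp
      | add u v hu hv => simp only [map_add, LinearMap.add_apply, hu, hv, add_mul]
      | smul a v hv => simp only [map_smul, LinearMap.smul_apply, hv, smul_mul_assoc]
      | single g =>
        rw [← opLetter_word, ← opV_basis x, opG_single_opV, map_add, wordAlg_opV, wordAlg_opV, ih,
          ih, ← hG_mul_hV, sub_mul, mul_assoc, mul_assoc, add_sub_cancel]
  have : D.wordAlg x ∘ₗ D.opG x c = LinearMap.mulLeft k (D.hG c) ∘ₗ D.wordAlg x :=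
    word_hom_ext fun w g => key w g c
  exact LinearMap.congr_fun this f

theorem wordAlg_opWord (a : List (Fin n)) (f : WordSpace k G n) :
    D.wordAlg x (opWord k G a f) = (a.map fun i => D.hV (x i)).prod * D.wordAlg x f := by
  induction a with
  | nil => simp
  | cons i a ih => rw [opWord_cons, ← opV_basis x, wordAlg_opV, ih]; simp [mul_assoc]

/-- The operators on words become left multiplications in `H_{λ,κ}`, where vw - wv - κ(v,w) is zero.
-/
theorem wordAlg_relLE {m : ℕ} {f : WordSpace k G n} (hf : f ∈ D.relLE x m) :
    D.wordAlg x f = 0 := by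
  rw [← Submodule.mem_bot k]
  refine D.map_relLE_le x _ _ (fun a u v l f _ _ => ?_) hf
  rw [Submodule.mem_bot, wordAlg_opWord, opRel_apply]
  simp only [map_sub, wordAlg_opV, wordAlg_opG, ← hV_mul_hV]
  simp only [sub_mul, mul_assoc, sub_self, mul_zero]

/-- The image contains 1 and is stable under left multiplication by the generators, so it is a left
ideal containing 1. -/
theorem wordAlg_surjective : Function.Surjective (D.wordAlg x) := by
  have h1 : D.wordAlg x (word k [] 1) = 1 := by
    rw [wordAlg_word]
    simp [← MonoidAlgebra.one_def]
  suffices h : ∀ a f, ∃ f', D.wordAlg x f' = a * D.wordAlg x f by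
    intro a
    obtain ⟨f', hf'⟩ := h a (word k [] 1)
    exact ⟨f', by rw [hf', h1, mul_one]⟩
  intro a
  induction a using D.alg_induction with
  | V v => exact fun f => ⟨_, D.wordAlg_opV x v f⟩
  | G g => exact fun f => ⟨_, D.wordAlg_opG x _ f⟩
  | scalar c => exact fun f => ⟨c • f, by rw [map_smul, Algebra.smul_def]⟩
  | add a b ha hb =>
    intro f
    obtain ⟨f₁, h₁⟩ := ha f
    obtain ⟨f₂, h₂⟩ := hb f
    exact ⟨f₁ + f₂, by rw [map_add, h₁, h₂, add_mul]⟩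
  | mul a b ha hb =>
    intro f
    obtain ⟨f₂, h₂⟩ := hb f
    obtain ⟨f₁, h₁⟩ := ha f₂
    exact ⟨f₁, by rw [h₁, h₂, mul_assoc]⟩

/-- The action of `V` on `A`. -/
def actV : V →ₗ[k] Module.End k (Skew k V G) where
  toFun v := D.proj x ∘ₗ opV G x v ∘ₗ sec x
  map_add' v w := by ext a; simp
  map_smul' c v := by ext a; simp

theorem actV_proj (v : V) (f : WordSpace k G n) :
    D.actV x v (D.proj x f) = D.proj x (opV G x v f) :=
  D.proj_opV_sec_proj x v f

/-- The action of `kG` on `A`. -/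
def actG : MonoidAlgebra k G →ₐ[k] Module.End k (Skew k V G) :=
  AlgHom.ofLinearMap
    { toFun := fun c => D.proj x ∘ₗ D.opG x c ∘ₗ sec x
      map_add' := fun c d => by ext a; simp
      map_smul' := fun c d => by ext a; simp }
    (by
      ext a
      change D.proj x (D.opG x 1 (sec x a)) = a
      rw [opG_one, proj_sec])
    (fun c d => by
      ext a
      change D.proj x (D.opG x (c * d) (sec x a)) =
        D.proj x (D.opG x c (sec x (D.proj x (D.opG x d (sec x a)))))
      rw [proj_opG_sec_proj, opG_mul])

theorem actG_proj (c : MonoidAlgebra k G) (f : WordSpace k G n) :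
    D.actG x c (D.proj x f) = D.proj x (D.opG x c f) :=
  D.proj_opG_sec_proj x c f

/-- The action of `H_{λ,κ}` on `A`. -/
def act : D.Alg →ₐ[k] Module.End k (Skew k V G) :=
  D.algLift (D.actV x) (D.actG x)
    (fun v w => by
      ext a
      rw [← D.proj_sec x a]
      simp only [LinearMap.sub_apply, Module.End.mul_apply, actV_proj, actG_proj]
      rw [← sub_eq_zero, ← map_sub, ← map_sub, ← opRel_apply]
      exact D.proj_relLE x (D.mem_relLE x [] v w (exists_mem_lenLE (sec x a)).choose_spec le_rfl))
    (fun g v => by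
      ext a
      rw [← D.proj_sec x a]
      simp only [LinearMap.sub_apply, Module.End.mul_apply, actV_proj, actG_proj, opG_single_opV,
        map_add, add_sub_cancel_left])

theorem act_hV_proj (v : V) (f : WordSpace k G n) :
    D.act x (D.hV v) (D.proj x f) = D.proj x (opV G x v f) := by
  rw [act, algLift_hV, actV_proj]

theorem act_hG_proj (c : MonoidAlgebra k G) (f : WordSpace k G n) :
    D.act x (D.hG c) (D.proj x f) = D.proj x (D.opG x c f) := by
  rw [act, algLift_hG, actG_proj]

theorem act_wordAlg_proj (w : List (Fin n)) (g : G) (f : WordSpace k G n) :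
    D.act x (D.wordAlg x (word k w g)) (D.proj x f) =
      D.proj x (opWord k G w (D.opG x (MonoidAlgebra.single g 1) f)) := by
  rw [wordAlg_word, map_mul, Module.End.mul_apply, act_hG_proj]
  induction w with
  | nil => simp
  | cons i w ih =>
    rw [List.map_cons, List.prod_cons, map_mul, Module.End.mul_apply, ih, act_hV_proj, opV_basis,
      opWord_cons]

theorem proj_word_nil (g : G) : D.proj x (word k [] g) = gA k V g := by
  rw [D.proj_word_of_sortedLE x List.Pairwise.nil.sortedLE, Multiset.coe_nil, skewBasis_zero]

/-- A product of generators applied to 1 rebuilds the word and then sorts it. This is why h ↦ h · 1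
inverts the PBW map. -/
theorem act_wordAlg_one (f : WordSpace k G n) : D.act x (D.wordAlg x f) 1 = D.proj x f := by
  have : LinearMap.applyₗ (1 : Skew k V G) ∘ₗ (D.act x).toLinearMap ∘ₗ D.wordAlg x = D.proj x :=
    word_hom_ext fun w g => by
      change D.act x (D.wordAlg x (word k w g)) 1 = _
      rw [← gA_one, ← D.proj_word_nil x, act_wordAlg_proj, opG_word_nil, mul_one, opWord_word,
        List.append_nil]
  exact LinearMap.congr_fun this f

theorem wordAlg_sec_proj (f : WordSpace k G n) :
    D.wordAlg x (sec x (D.proj x f)) = D.wordAlg x f := by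
  obtain ⟨m, hm⟩ := D.exists_sec_proj_sub_mem x f
  rw [← sub_eq_zero, ← map_sub]
  exact D.wordAlg_relLE x hm

/-- The PBW theorem: the linear isomorphism `A ≃ H_{λ,κ}` which sends monomials to the products of
their letters in increasing order. -/
def pbw : Skew k V G ≃ₗ[k] D.Alg :=
  LinearEquiv.ofLinearMap (D.wordAlg x ∘ₗ sec x)
    (LinearMap.applyₗ (1 : Skew k V G) ∘ₗ (D.act x).toLinearMap)
    (by
      ext a
      obtain ⟨f, rfl⟩ := D.wordAlg_surjective x a
      change D.wordAlg x (sec x (D.act x (D.wordAlg x f) 1)) = D.wordAlg x f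
      rw [act_wordAlg_one, wordAlg_sec_proj])
    (by
      ext a
      change D.act x (D.wordAlg x (sec x a)) 1 = a
      rw [act_wordAlg_one, proj_sec])

theorem pbw_proj (f : WordSpace k G n) : D.pbw x (D.proj x f) = D.wordAlg x f :=
  D.wordAlg_sec_proj x f

theorem pbw_gA (g : G) : D.pbw x (gA k V g) = D.hG (MonoidAlgebra.single g 1) := by
  rw [← D.proj_word_nil x, pbw_proj, wordAlg_word]
  simp

theorem pbw_one : D.pbw x 1 = 1 := by
  rw [← gA_one, pbw_gA, ← MonoidAlgebra.one_def, map_one]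

theorem pbw_kgA (c : MonoidAlgebra k G) : D.pbw x (kgA k V G c) = D.hG c := by
  induction c using kg_induction with
  | zero => simp
  | add u v hu hv => rw [map_add, map_add, map_add, hu, hv]
  | smul a v hv => rw [map_smul, map_smul, map_smul, hv]
  | single g => rw [kgA_single, pbw_gA]

/-- A word with one letter is already sorted, so no correction appears. -/
theorem pbw_vA_mul_gA (v : V) (g : G) :
    D.pbw x (vA k V G v * gA k V g) = D.hV v * D.hG (MonoidAlgebra.single g 1) := by
  induction v using basis_induction x with
  | zero => simp
  | add u v hu hv => simp only [map_add, hu, hv, add_mul]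
  | smul a v hv => simp only [map_smul, hv, smul_mul_assoc]
  | basis i =>
    rw [← skewBasis_zero x, vA_mul_skewBasis,
      show (i ::ₘ 0 : Multiset (Fin n)) = ↑[i] from rfl, ← D.proj_word_of_sortedLE x (List.pairwise_singleton _ i).sortedLE,
      pbw_proj, wordAlg_word]
    simp

theorem pbw_vA (v : V) : D.pbw x (vA k V G v) = D.hV v := by
  have := D.pbw_vA_mul_gA x v 1
  rwa [gA_one, mul_one, ← MonoidAlgebra.one_def, map_one, mul_one] at this

/-- The inverse of `pbw` is h ↦ h · 1, so a product in `H_{λ,κ}` can be computed by letting its left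
factor act on A. -/
theorem pbw_symm_mul (a b : Skew k V G) :
    (D.pbw x).symm (D.pbw x a * D.pbw x b) = D.act x (D.pbw x a) b := by
  change D.act x (D.pbw x a * D.pbw x b) 1 = _
  rw [map_mul, Module.End.mul_apply]
  congr 1
  exact (D.pbw x).symm_apply_apply b

/-! ### Leading terms -/

/-- The degree of the elements of the basis of `A`. -/
abbrev degBasis (q : Multiset (Fin n) × G) : ℕ := q.1.card

variable (G) in
/-- The span of the basis elements of `A` of degree less than `m`. -/
abbrev skewBelow (m : ℕ) : Submodule k (Skew k V G) := below (skewBasis G x) degBasis m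

theorem commWord_mem_below {m : ℕ} {f : WordSpace k G n} (hf : f ∈ lenLE k G n m) :
    commWord x f ∈ skewBelow G x (m + 1) := by
  have : lenLE k G n m ≤ (skewBelow G x (m + 1)).comap (commWord x) := by
    rw [lenLE, Submodule.span_le]
    rintro _ ⟨w, g, hw, rfl⟩
    rw [SetLike.mem_coe, Submodule.mem_comap, commWord_word]
    exact basis_mem_below (skewBasis G x) degBasis (Nat.lt_succ_of_le hw)
  exact this hf

/-- Exchanging letters does not alter the commutative monomial, and the corrections κ lose two
letters, so sorting only affects lower degrees. -/
theorem proj_sub_commWord_mem (L : ℕ) : ∀ f ∈ lenLE k G n L,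
    D.proj x f - commWord x f ∈ skewBelow G x L := by
  induction L using Nat.strong_induction_on with
  | _ L ih =>
    have key : ∀ W w, weight w = W → w.length = L → ∀ g,
        D.proj x (word k w g) - commWord x (word k w g) ∈ skewBelow G x L := by
      intro W
      induction W using Nat.strong_induction_on with
      | _ W ihW =>
        intro w hW hL g
        by_cases h : ∃ q, IsDescent w q
        · obtain ⟨⟨a, j, i, b⟩, ⟨rfl, hij⟩, h⟩ := D.exists_nf_eq x
            (fun w g => skewBasis G x (↑w, g)) w g h
          simp only at hij h hL hW
          simp only [List.length_append, List.length_cons] at hL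
          have hb : word k b g ∈ lenLE k G n b.length := word_mem_lenLE le_rfl g
          have h₁ := ihW _ (hW ▸ weight_swap_lt a b hij) (a ++ i :: j :: b) rfl
            (by simp only [List.length_append, List.length_cons]; omega) g
          have h₂ := opWord_mem_lenLE a (D.opG_mem_lenLE x (D.kap (x j) (x i)) hb)
          have h₃ := Submodule.add_mem (skewBelow G x (a.length + b.length + 1))
            (below_mono (skewBasis G x) degBasis (Nat.le_succ _) (ih (a.length + b.length) (by omega) _ h₂))
            (commWord_mem_below x h₂)
          rw [sub_add_cancel] at h₃
          have h' : D.proj x (word k (a ++ j :: i :: b) g) = D.proj x (word k (a ++ i :: j :: b) g)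
              + D.proj x (opWord k G a (D.opG x (D.kap (x j) (x i)) (word k b g))) := by
            rw [proj, nfMap_word, nfMap_word]
            exact h
          have hp : ((a ++ j :: i :: b : List (Fin n)) : Multiset (Fin n)) =
              ((a ++ i :: j :: b : List (Fin n)) : Multiset (Fin n)) :=
            Multiset.coe_eq_coe.2 ((List.Perm.swap _ _ _).append_left a)
          rw [commWord_word, hp, ← commWord_word, h', add_sub_right_comm]
          exact add_mem h₁ (below_mono (skewBasis G x) degBasis (by omega) h₃)
        · rw [D.proj_word_of_sortedLE x (sortedLE_of_forall_not_isDescent (not_exists.1 h)),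
            commWord_word, sub_self]
          exact zero_mem _
    intro f hf
    have : lenLE k G n L ≤ (skewBelow G x L).comap (D.proj x - commWord x) := by
      rw [lenLE, Submodule.span_le]
      rintro _ ⟨w, g, hw, rfl⟩
      rcases hw.lt_or_eq with hw | hw
      · exact below_mono (skewBasis G x) degBasis hw.le (ih _ hw _ (word_mem_lenLE le_rfl g))
      · exact key _ w rfl hw g
    exact this hf

theorem vA_mul_mem_below (v : V) {m : ℕ} {a : Skew k V G} (ha : a ∈ skewBelow G x m) :
    vA k V G v * a ∈ skewBelow G x (m + 1) := by
  induction v using basis_induction x with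
  | zero => simp
  | add u v hu hv => rw [map_add, add_mul]; exact add_mem hu hv
  | smul a v hv => rw [map_smul, smul_mul_assoc]; exact Submodule.smul_mem _ _ hv
  | basis i =>
    have : skewBelow G x m ≤ (skewBelow G x (m + 1)).comap
        (LinearMap.mulLeft k (vA k V G (x i))) := by
      rw [skewBelow, below, Submodule.span_le]
      rintro _ ⟨⟨q, g⟩, hq, rfl⟩
      rw [SetLike.mem_coe, Submodule.mem_comap, LinearMap.mulLeft_apply, vA_mul_skewBasis]
      exact basis_mem_below (skewBasis G x) degBasis (by simpa [degBasis] using hq)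
    exact this ha

theorem commWord_opV (v : V) (f : WordSpace k G n) :
    commWord x (opV G x v f) = vA k V G v * commWord x f := by
  induction v using basis_induction x with
  | zero => simp
  | add u v hu hv => simp only [map_add, LinearMap.add_apply, hu, hv, add_mul]
  | smul a v hv => simp only [map_smul, LinearMap.smul_apply, hv, smul_mul_assoc]
  | basis i =>
    have : commWord x ∘ₗ opV G x (x i) =
        LinearMap.mulLeft k (vA k V G (x i)) ∘ₗ commWord x :=
      word_hom_ext fun w g => by simp [vA_mul_skewBasis]
    exact LinearMap.congr_fun this f

/-- Each letter passed by g costs only a term λ(g,v) with one letter fewer; without these terms the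
product is that of A. -/
theorem commWord_opG_word_sub_mem (g : G) (w : List (Fin n)) (h : G) :
    commWord x (D.opG x (MonoidAlgebra.single g 1) (word k w h))
      - gA k V g * commWord x (word k w h) ∈ skewBelow G x w.length := by
  induction w with
  | nil =>
    rw [opG_word_nil, commWord_word, commWord_word, Multiset.coe_nil, skewBasis_zero,
      skewBasis_zero, gA_mul_gA, sub_self]
    exact zero_mem _
  | cons i w ih =>
    rw [← opLetter_word, ← opV_basis x, opG_single_opV, map_add, commWord_opV, commWord_opV,
      ← mul_assoc, gA_mul_vA, add_sub_right_comm, mul_assoc, ← mul_sub]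
    exact Submodule.add_mem (skewBelow G x (w.length + 1)) (vA_mul_mem_below x _ ih)
      (commWord_mem_below x (D.opG_word_mem_lenLE x w h _))

theorem commWord_opWord_sub_mem (w : List (Fin n)) (g : G) {m : ℕ} {f : WordSpace k G n}
    {a : Skew k V G} (h : commWord x f - gA k V g * a ∈ skewBelow G x m) :
    commWord x (opWord k G w f) - skewBasis G x (↑w, g) * a ∈ skewBelow G x (w.length + m) := by
  induction w with
  | nil => simpa [skewBasis_zero] using h
  | cons i w ih =>
    rw [opWord_cons, ← opV_basis x, commWord_opV, ← Multiset.cons_coe, ← vA_mul_skewBasis,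
      mul_assoc, ← mul_sub, List.length_cons, add_right_comm]
    exact vA_mul_mem_below x _ ih

/-- The product of `H_{λ,κ}` differs from the product of `A` by terms of lower degree. -/
theorem pbw_leading_term (q r : Multiset (Fin n) × G) :
    (D.pbw x).symm (D.pbw x (skewBasis G x q) * D.pbw x (skewBasis G x r))
      - skewBasis G x q * skewBasis G x r ∈ skewBelow G x (degBasis q + degBasis r) := by
  obtain ⟨m, g⟩ := q
  obtain ⟨m', h⟩ := r
  have e : ∀ (m : Multiset (Fin n)) (g : G),
      skewBasis G x (m, g) = D.proj x (word k (m.sort (· ≤ ·)) g) := fun m g => by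
    rw [← sec_skewBasis x m g, proj_sec]
  -- Lower terms have two sources: moving g through the second word, and then prefixing the first
  -- word (h₁, h₂), and sorting the result (h₃).
  have h₁ := D.commWord_opG_word_sub_mem x g (m'.sort (· ≤ ·)) h
  have h₂ := commWord_opWord_sub_mem x (m.sort (· ≤ ·)) g h₁
  have h₃ := D.proj_sub_commWord_mem x _ _ (opWord_mem_lenLE (m.sort (· ≤ ·))
    (D.opG_word_mem_lenLE x (m'.sort (· ≤ ·)) h (MonoidAlgebra.single g 1)))
  rw [commWord_word, Multiset.sort_eq, Multiset.sort_eq, Multiset.length_sort,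
    Multiset.length_sort] at h₂
  rw [Multiset.length_sort, Multiset.length_sort] at h₃
  have h₄ : D.pbw x (skewBasis G x (m, g)) = D.wordAlg x (word k (m.sort (· ≤ ·)) g) := by
    rw [e, pbw_proj]
  have h₅ : D.act x (D.pbw x (skewBasis G x (m, g))) (skewBasis G x (m', h)) = D.proj x
      (opWord k G (m.sort (· ≤ ·)) (D.opG x (MonoidAlgebra.single g 1)
        (word k (m'.sort (· ≤ ·)) h))) := by
    rw [h₄, e m' h, act_wordAlg_proj]
  rw [pbw_symm_mul, h₅]
  have := Submodule.add_mem _ h₃ h₂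
  rwa [sub_add_sub_cancel] at this

end PBWDatum

/-! ### Coefficients of elements of A[t] and evaluation at t = 1 -/

section PolynomialTensor

variable {k A : Type*} [Field k] [AddCommGroup A] [Module k A]

variable (k A) in
/-- The coefficient of `t^j` of an element of `A[t]`. -/
def tcoeff (j : ℕ) : k[X] ⊗[k] A →ₗ[k] A :=
  TensorProduct.lift (LinearMap.lsmul k A ∘ₗ Polynomial.lcoeff k j)

@[simp]
theorem tcoeff_tmul (j : ℕ) (p : k[X]) (a : A) : tcoeff k A j (p ⊗ₜ a) = p.coeff j • a := rfl

/-- The expansion is stated for every cutoff beyond N, so that two elements can be expanded up to a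
common one. -/
theorem exists_eq_sum_tcoeff (y : k[X] ⊗[k] A) : ∃ N, (∀ j, N ≤ j → tcoeff k A j y = 0) ∧
    ∀ M, N ≤ M → y = ∑ j ∈ Finset.range M, ((Polynomial.X : k[X]) ^ j) ⊗ₜ[k] tcoeff k A j y := by
  induction y using TensorProduct.induction_on with
  | zero => exact ⟨0, by simp, by simp⟩
  | tmul p a =>
    refine ⟨p.natDegree + 1, fun j hj => ?_, fun M hM => ?_⟩
    · rw [tcoeff_tmul, Polynomial.coeff_eq_zero_of_natDegree_lt (by omega), zero_smul]
    · conv_lhs => rw [p.as_sum_range' M (by omega)]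
      rw [TensorProduct.sum_tmul]
      refine Finset.sum_congr rfl fun j _ => ?_
      rw [tcoeff_tmul, TensorProduct.tmul_smul, TensorProduct.smul_tmul',
        ← Polynomial.C_mul_X_pow_eq_monomial, Polynomial.smul_eq_C_mul]
  | add y z hy hz =>
    obtain ⟨N, h₁, h₂⟩ := hy
    obtain ⟨N', h₁', h₂'⟩ := hz
    refine ⟨max N N', fun j hj => ?_, fun M hM => ?_⟩
    · rw [map_add, h₁ j (by omega), h₁' j (by omega), add_zero]
    · simp only [map_add, TensorProduct.tmul_add, Finset.sum_add_distrib]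
      rw [← h₂ M (by omega), ← h₂' M (by omega)]

theorem finite_tcoeff_ne_zero (y : k[X] ⊗[k] A) : {j | tcoeff k A j y ≠ 0}.Finite := by
  obtain ⟨N, h, -⟩ := exists_eq_sum_tcoeff y
  refine (Finset.range N).finite_toSet.subset fun j hj => ?_
  by_contra hjN
  exact hj (h j (by simpa using hjN))

theorem eq_finsum_tcoeff (y : k[X] ⊗[k] A) :
    y = ∑ᶠ j : ℕ, ((Polynomial.X : k[X]) ^ j) ⊗ₜ[k] tcoeff k A j y := by
  obtain ⟨N, h, h'⟩ := exists_eq_sum_tcoeff y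
  rw [finsum_eq_sum_of_support_subset (s := Finset.range N)]
  · exact h' N le_rfl
  · intro j hj
    by_contra hjN
    refine hj ?_
    simp only
    rw [h j (by simpa using hjN), TensorProduct.tmul_zero]

theorem polyTensor_induction {P : k[X] ⊗[k] A → Prop} (y : k[X] ⊗[k] A)
    (one : ∀ a, P (1 ⊗ₜ a)) (add : ∀ y z, P y → P z → P (y + z))
    (smul : ∀ (p : k[X]) y, P y → P (p • y)) : P y := by
  induction y using TensorProduct.induction_on with
  | zero => simpa using one 0
  | add y z hy hz => exact add y z hy hz
  | tmul p a =>
    have := smul p _ (one a)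
    rwa [TensorProduct.smul_tmul', smul_eq_mul, mul_one] at this

variable (k A) in
/-- The value of an element of `A[t]` at `t = 1`. -/
def teval : k[X] ⊗[k] A →ₗ[k] A :=
  TensorProduct.lift (LinearMap.lsmul k A ∘ₗ (Polynomial.aeval (1 : k)).toLinearMap)

@[simp]
theorem teval_tmul (p : k[X]) (a : A) : teval k A (p ⊗ₜ a) = Polynomial.eval 1 p • a := rfl

theorem teval_smul (p : k[X]) (y : k[X] ⊗[k] A) :
    teval k A (p • y) = Polynomial.eval 1 p • teval k A y := by
  induction y using TensorProduct.induction_on with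
  | zero => simp
  | add y z hy hz => rw [smul_add, map_add, map_add, hy, hz, smul_add]
  | tmul q a =>
    rw [TensorProduct.smul_tmul', teval_tmul, teval_tmul, smul_eq_mul, Polynomial.eval_mul, mul_smul]

theorem teval_C_smul (c : k) (y : k[X] ⊗[k] A) :
    teval k A (Polynomial.C c • y) = c • teval k A y := by
  rw [teval_smul, Polynomial.eval_C]

end PolynomialTensor

/-! ### Homogenization with respect to a graded basis -/

section Homogenize

variable {k A J : Type*} [Field k] [Ring A] [Algebra k A] (e : Module.Basis J k A) (deg : J → ℕ)

/-- The homogenization of degree `N`: it maps `a ∈ A_d` to `t^(N-d) a` for `d ≤ N`. -/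
def homogenize (N : ℕ) : A →ₗ[k] k[X] ⊗[k] A :=
  e.constr k fun q => ((Polynomial.X : k[X]) ^ (N - deg q)) ⊗ₜ e q

theorem homogenize_basis (N : ℕ) (q : J) :
    homogenize e deg N (e q) = ((Polynomial.X : k[X]) ^ (N - deg q)) ⊗ₜ e q := by
  simp [homogenize]

/-- Degrees at most M are required because the exponent of t is a truncated difference of natural
numbers. -/
theorem homogenize_add {M : ℕ} (s : ℕ) {a : A} (ha : a ∈ below e deg (M + 1)) :
    homogenize e deg (M + s) a = (Polynomial.X : k[X]) ^ s • homogenize e deg M a := by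
  rw [below] at ha
  induction ha using Submodule.span_induction with
  | zero => simp
  | add a b _ _ ha hb => rw [map_add, map_add, ha, hb, smul_add]
  | smul c a _ ha => rw [map_smul, map_smul, ha, smul_comm]
  | mem a ha =>
    obtain ⟨q, hq, rfl⟩ := ha
    rw [homogenize_basis, homogenize_basis, TensorProduct.smul_tmul', smul_eq_mul, ← pow_add]
    congr 2
    omega

theorem teval_homogenize (N : ℕ) (a : A) : teval k A (homogenize e deg N a) = a := by
  have : teval k A ∘ₗ homogenize e deg N = LinearMap.id := e.ext fun q => by
    simp [homogenize_basis]
  exact LinearMap.congr_fun this a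

theorem tcoeff_homogenize_below {N j : ℕ} {a : A} (ha : a ∈ below e deg (N - j)) :
    tcoeff k A j (homogenize e deg N a) = 0 := by
  rw [below] at ha
  induction ha using Submodule.span_induction with
  | zero => simp
  | add a b _ _ ha hb => rw [map_add, map_add, ha, hb, add_zero]
  | smul c a _ ha => rw [map_smul, map_smul, ha, smul_zero]
  | mem a ha =>
    obtain ⟨q, hq, rfl⟩ := ha
    rw [homogenize_basis, tcoeff_tmul, Polynomial.coeff_X_pow, if_neg (by omega), zero_smul]

end Homogenize

/-! ### Graded deformations from filtered products -/

section FilteredProduct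

variable {k A J H : Type*} [Field k] [Ring A] [Algebra k A] [Ring H] [Algebra k H]

/-- A linear isomorphism from a graded algebra `A` to an algebra `H` such that the product of `H` is
a filtered deformation of the product of `A`. -/
structure FilteredIso (k A J H : Type*) [Field k] [Ring A] [Algebra k A] [Ring H] [Algebra k H]
    (gr : ℤ → Submodule k A) where
  /-- A homogeneous basis. -/
  e : Module.Basis J k A
  /-- The degrees of the basis elements. -/
  deg : J → ℕ
  gr_eq : ∀ d, gr d = Submodule.span k {y | ∃ q, (deg q : ℤ) = d ∧ y = e q}
  one_mem : (1 : A) ∈ gr 0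
  mul_mem : ∀ p q a b, a ∈ gr p → b ∈ gr q → a * b ∈ gr (p + q)
  /-- The isomorphism. -/
  Φ : A ≃ₗ[k] H
  Φ_one : Φ 1 = 1
  leading : ∀ q r, Φ.symm (Φ (e q) * Φ (e r)) - e q * e r ∈ below e deg (deg q + deg r)

namespace FilteredIso

variable {gr : ℤ → Submodule k A} (F : FilteredIso k A J H gr)

theorem gr_induction {P : A → Prop} {d : ℤ} {a : A} (ha : a ∈ gr d)
    (basis : ∀ q, (F.deg q : ℤ) = d → P (F.e q)) (zero : P 0)
    (add : ∀ a b, P a → P b → P (a + b)) (smul : ∀ (c : k) a, P a → P (c • a)) : P a := by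
  rw [F.gr_eq] at ha
  induction ha using Submodule.span_induction with
  | zero => exact zero
  | add a b _ _ ha hb => exact add a b ha hb
  | smul c a _ ha => exact smul c a ha
  | mem a ha => obtain ⟨q, hq, rfl⟩ := ha; exact basis q hq

theorem e_mem (q : J) : F.e q ∈ gr (F.deg q) := by
  rw [F.gr_eq]
  exact Submodule.subset_span ⟨q, rfl, rfl⟩

theorem mem_below_of_mem_gr {d : ℤ} {m : ℕ} (h : d < m) {a : A} (ha : a ∈ gr d) :
    a ∈ below F.e F.deg m := by
  refine F.gr_induction ha (fun q hq => basis_mem_below _ _ (by omega)) (zero_mem _)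
    (fun a b => add_mem) (fun c a => Submodule.smul_mem _ c)

theorem homogenize_of_mem_gr {d N : ℕ} {a : A} (ha : a ∈ gr d) :
    homogenize F.e F.deg N a = ((Polynomial.X : k[X]) ^ (N - d)) ⊗ₜ a := by
  refine F.gr_induction (P := fun a => homogenize F.e F.deg N a =
    ((Polynomial.X : k[X]) ^ (N - d)) ⊗ₜ a) ha (fun q hq => ?_) (by simp)
    (fun a b ha hb => by rw [map_add, ha, hb, TensorProduct.tmul_add])
    (fun c a ha => by rw [map_smul, ha, TensorProduct.tmul_smul])
  rw [homogenize_basis, Nat.cast_inj.1 hq]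

/-- The product of `H`, transported to `A`. -/
def mul : A →ₗ[k] A →ₗ[k] A :=
  ((LinearMap.mul k H).compl₁₂ F.Φ.toLinearMap F.Φ.toLinearMap).compr₂ F.Φ.symm.toLinearMap

theorem mul_apply (a b : A) : F.mul a b = F.Φ.symm (F.Φ a * F.Φ b) := rfl

theorem mul_assoc' (a b c : A) : F.mul (F.mul a b) c = F.mul a (F.mul b c) := by
  simp [mul_apply, mul_assoc]

theorem one_mul' (a : A) : F.mul 1 a = a := by simp [mul_apply, F.Φ_one]

theorem mul_one' (a : A) : F.mul a 1 = a := by simp [mul_apply, F.Φ_one]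

theorem mul_basis_mem_below (q r : J) :
    F.mul (F.e q) (F.e r) ∈ below F.e F.deg (F.deg q + F.deg r + 1) := by
  have h₁ := below_mono F.e F.deg (Nat.le_succ (F.deg q + F.deg r)) (F.leading q r)
  have h₂ := F.mem_below_of_mem_gr (m := F.deg q + F.deg r + 1) (by push_cast; omega)
    (F.mul_mem _ _ _ _ (F.e_mem q) (F.e_mem r))
  have := add_mem h₁ h₂
  rwa [sub_add_cancel] at this

/-- The product of the deformation, on `A`. -/
def prodA : A →ₗ[k] A →ₗ[k] k[X] ⊗[k] A :=
  F.e.constr k fun q => F.e.constr k fun r =>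
    homogenize F.e F.deg (F.deg q + F.deg r) (F.mul (F.e q) (F.e r))

theorem prodA_basis (q r : J) : F.prodA (F.e q) (F.e r) =
    homogenize F.e F.deg (F.deg q + F.deg r) (F.mul (F.e q) (F.e r)) := by
  simp [prodA]

theorem prodA_of_mem {p q : ℕ} {a b : A} (ha : a ∈ gr p) (hb : b ∈ gr q) :
    F.prodA a b = homogenize F.e F.deg (p + q) (F.mul a b) := by
  refine F.gr_induction (P := fun a => F.prodA a b = homogenize F.e F.deg (p + q) (F.mul a b)) ha
    (fun r hr => ?_) (by simp)
    (fun a b ha hb => by simp only [map_add, LinearMap.add_apply, ha, hb])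
    (fun c a ha => by simp only [map_smul, LinearMap.smul_apply, ha])
  refine F.gr_induction (P := fun b => F.prodA (F.e r) b =
      homogenize F.e F.deg (p + q) (F.mul (F.e r) b)) hb (fun s hs => ?_) (by simp)
    (fun a b ha hb => by simp only [map_add, ha, hb])
    (fun c a ha => by simp only [map_smul, ha])
  rw [prodA_basis, Nat.cast_inj.1 hr, Nat.cast_inj.1 hs]

/-- The product of the deformation. -/
def starMap : (k[X] ⊗[k] A) →ₗ[k[X]] (k[X] ⊗[k] A) →ₗ[k[X]] (k[X] ⊗[k] A) :=
  LinearMap.liftBaseChange k[X]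
    (((LinearMap.liftBaseChangeEquiv k[X]).restrictScalars k).toLinearMap ∘ₗ F.prodA)

@[simp]
theorem starMap_tmul (p q : k[X]) (a b : A) :
    F.starMap (p ⊗ₜ a) (q ⊗ₜ b) = p • q • F.prodA a b := by
  simp [starMap]

/-- Homogenization turns the filtered product into the product of the Rees algebra: on basis
elements the missing power of t is restored by `homogenize_add`. Associativity rests on this and its
mirror image. -/
theorem starMap_homogenize_left {N r : ℕ} {z c : A} (hz : z ∈ below F.e F.deg (N + 1))
    (hc : c ∈ gr r) : F.starMap (homogenize F.e F.deg N z) (1 ⊗ₜ c) =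
      homogenize F.e F.deg (N + r) (F.mul z c) := by
  rw [below] at hz
  induction hz using Submodule.span_induction with
  | zero => simp
  | add a b _ _ ha hb => simp only [map_add, LinearMap.add_apply, ha, hb]
  | smul c a _ ha =>
    rw [map_smul, LinearMap.map_smul_of_tower, LinearMap.smul_apply, ha, map_smul,
      LinearMap.smul_apply, map_smul]
  | mem a ha =>
    obtain ⟨q, hq, rfl⟩ := ha
    rw [homogenize_basis]
    refine F.gr_induction (P := fun c =>
        F.starMap (((Polynomial.X : k[X]) ^ (N - F.deg q)) ⊗ₜ F.e q) (1 ⊗ₜ c) =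
          homogenize F.e F.deg (N + r) (F.mul (F.e q) c)) hc (fun s hs => ?_) (by simp)
      (fun a b ha hb => by simp only [map_add, TensorProduct.tmul_add, ha, hb])
      (fun c a ha => by
        rw [TensorProduct.tmul_smul, LinearMap.map_smul_of_tower, ha, map_smul, map_smul])
    rw [starMap_tmul, one_smul, prodA_basis, ← homogenize_add _ _ _ (F.mul_basis_mem_below q s)]
    have e : F.deg q + F.deg s + (N - F.deg q) = N + r := by omega
    rw [e]

theorem starMap_homogenize_right {N r : ℕ} {z c : A} (hz : z ∈ below F.e F.deg (N + 1))
    (hc : c ∈ gr r) : F.starMap (1 ⊗ₜ c) (homogenize F.e F.deg N z) =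
      homogenize F.e F.deg (r + N) (F.mul c z) := by
  rw [below] at hz
  induction hz using Submodule.span_induction with
  | zero => simp
  | add a b _ _ ha hb => simp only [map_add, ha, hb]
  | smul c a _ ha =>
    rw [map_smul, LinearMap.map_smul_of_tower, ha, map_smul, map_smul]
  | mem a ha =>
    obtain ⟨q, hq, rfl⟩ := ha
    rw [homogenize_basis]
    refine F.gr_induction (P := fun c =>
        F.starMap (1 ⊗ₜ c) (((Polynomial.X : k[X]) ^ (N - F.deg q)) ⊗ₜ F.e q) =
          homogenize F.e F.deg (r + N) (F.mul c (F.e q))) hc (fun s hs => ?_) (by simp)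
      (fun a b ha hb => by simp only [map_add, LinearMap.add_apply, TensorProduct.tmul_add, ha, hb])
      (fun c a ha => by
        rw [TensorProduct.tmul_smul, LinearMap.map_smul_of_tower, LinearMap.smul_apply, ha,
          map_smul, LinearMap.smul_apply, map_smul])
    rw [starMap_tmul, one_smul, prodA_basis, ← homogenize_add _ _ _ (F.mul_basis_mem_below s q)]
    have e : F.deg s + F.deg q + (N - F.deg q) = r + N := by omega
    rw [e]

theorem basis_induction {P : A → Prop} (a : A) (basis : ∀ q, P (F.e q)) (zero : P 0)
    (add : ∀ a b, P a → P b → P (a + b)) (smul : ∀ (c : k) a, P a → P (c • a)) : P a := by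
  have ha := F.e.mem_span a
  induction ha using Submodule.span_induction with
  | zero => exact zero
  | add a b _ _ ha hb => exact add a b ha hb
  | smul c a _ ha => exact smul c a ha
  | mem a ha => obtain ⟨q, rfl⟩ := ha; exact basis q

/-- On basis elements of degrees p, q, r both sides are the homogenization of degree p + q + r of a
triple product in H. -/
theorem starMap_assoc (y z w : k[X] ⊗[k] A) :
    F.starMap (F.starMap y z) w = F.starMap y (F.starMap z w) := by
  induction y using polyTensor_induction with
  | add y y' h h' => simp only [map_add, LinearMap.add_apply, h, h']
  | smul p y h => simp only [map_smul, LinearMap.smul_apply, h]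
  | one a =>
  induction z using polyTensor_induction with
  | add y y' h h' => simp only [map_add, LinearMap.add_apply, h, h']
  | smul p y h => simp only [map_smul, LinearMap.smul_apply, h]
  | one b =>
  induction w using polyTensor_induction with
  | add y y' h h' => simp only [map_add, h, h']
  | smul p y h => simp only [map_smul, h]
  | one c =>
  induction a using F.basis_induction with
  | zero => simp
  | add y y' h h' => simp only [map_add, LinearMap.add_apply, TensorProduct.tmul_add, h, h']
  | smul p y h =>
    simp only [TensorProduct.tmul_smul, LinearMap.map_smul_of_tower, LinearMap.smul_apply, h]
  | basis q =>
  induction b using F.basis_induction with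
  | zero => simp
  | add y y' h h' => simp only [map_add, LinearMap.add_apply, TensorProduct.tmul_add, h, h']
  | smul p y h =>
    simp only [TensorProduct.tmul_smul, LinearMap.map_smul_of_tower, LinearMap.smul_apply, h]
  | basis r =>
  induction c using F.basis_induction with
  | zero => simp
  | add y y' h h' => simp only [map_add, TensorProduct.tmul_add, h, h']
  | smul p y h => simp only [TensorProduct.tmul_smul, LinearMap.map_smul_of_tower, h]
  | basis s =>
  rw [starMap_tmul, starMap_tmul, one_smul, one_smul, one_smul, one_smul, prodA_basis, prodA_basis,
    F.starMap_homogenize_left (F.mul_basis_mem_below q r) (F.e_mem s),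
    F.starMap_homogenize_right (F.mul_basis_mem_below r s) (F.e_mem q), mul_assoc', add_assoc]

theorem prodA_one_left (a : A) : F.prodA 1 a = 1 ⊗ₜ a := by
  induction a using F.basis_induction with
  | zero => simp
  | add y y' h h' => simp only [map_add, TensorProduct.tmul_add, h, h']
  | smul p y h => simp only [TensorProduct.tmul_smul, map_smul, h]
  | basis s =>
    rw [F.prodA_of_mem (p := 0) (by exact_mod_cast F.one_mem) (F.e_mem s), one_mul',
      homogenize_basis]
    simp

theorem prodA_one_right (a : A) : F.prodA a 1 = 1 ⊗ₜ a := by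
  induction a using F.basis_induction with
  | zero => simp
  | add y y' h h' => simp only [map_add, LinearMap.add_apply, TensorProduct.tmul_add, h, h']
  | smul p y h => simp only [TensorProduct.tmul_smul, map_smul, LinearMap.smul_apply, h]
  | basis s =>
    rw [F.prodA_of_mem (q := 0) (F.e_mem s) (by exact_mod_cast F.one_mem), mul_one',
      homogenize_basis]
    simp

/-- Only the top degree survives at t = 0, and there the product of H is that of A. -/
theorem tcoeff_zero_prodA (a b : A) : tcoeff k A 0 (F.prodA a b) = a * b := by
  induction a using F.basis_induction with
  | zero => simp
  | add y y' h h' => simp only [map_add, LinearMap.add_apply, h, h', add_mul]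
  | smul p y h => simp only [map_smul, LinearMap.smul_apply, h, smul_mul_assoc]
  | basis q =>
  induction b using F.basis_induction with
  | zero => simp
  | add y y' h h' => simp only [map_add, h, h', mul_add]
  | smul p y h => simp only [map_smul, h, mul_smul_comm]
  | basis r =>
  have e : F.mul (F.e q) (F.e r) = (F.mul (F.e q) (F.e r) - F.e q * F.e r) + F.e q * F.e r := by abel
  have hm := F.mul_mem _ _ _ _ (F.e_mem q) (F.e_mem r)
  rw [← Nat.cast_add] at hm
  -- The subtracted 0 is the index of the coefficient, as in `tcoeff_homogenize_below`.
  have hl : F.mul (F.e q) (F.e r) - F.e q * F.e r ∈ below F.e F.deg (F.deg q + F.deg r - 0) :=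
    F.leading q r
  rw [prodA_basis, e, map_add, map_add, tcoeff_homogenize_below F.e F.deg hl,
    F.homogenize_of_mem_gr hm, tcoeff_tmul, Polynomial.coeff_X_pow, Nat.sub_self, if_pos rfl,
    one_smul, zero_add]

/-- A criterion for the first order term: the part of degree p + q - 1 carries one factor t, and
everything lower carries at least two. -/
theorem tcoeff_one_prodA {p q : ℕ} {a b y : A} (ha : a ∈ gr p) (hb : b ∈ gr q)
    (hy : y ∈ gr (p + q - 1)) (h : F.mul a b - a * b - y ∈ below F.e F.deg (p + q - 1)) :
    tcoeff k A 1 (F.prodA a b) = y := by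
  have e : F.mul a b = (F.mul a b - a * b - y) + y + a * b := by abel
  have hm := F.mul_mem _ _ _ _ ha hb
  rw [← Nat.cast_add] at hm hy
  rw [F.prodA_of_mem ha hb, e, map_add, map_add, map_add, map_add,
    tcoeff_homogenize_below F.e F.deg h, F.homogenize_of_mem_gr hm, tcoeff_tmul,
    Polynomial.coeff_X_pow, Nat.sub_self, if_neg one_ne_zero, zero_smul, add_zero, zero_add]
  -- For p + q = 0 the natural difference p + q - 1 is truncated; then y has degree -1 and is zero.
  rcases Nat.eq_zero_or_pos (p + q) with h0 | h0
  · have : y = 0 := by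
      have h := F.mem_below_of_mem_gr (m := 0) (by omega) hy
      simpa [below] using h
    simp [this]
  · have h1 : (((p + q : ℕ) : ℤ) - 1) = ((p + q - 1 : ℕ) : ℤ) := by omega
    rw [h1] at hy
    rw [F.homogenize_of_mem_gr hy, tcoeff_tmul, Polynomial.coeff_X_pow, if_pos (by omega), one_smul]

theorem tcoeff_prodA_mem {p q : ℤ} {a b : A} (ha : a ∈ gr p) (hb : b ∈ gr q) (j : ℕ) :
    tcoeff k A j (F.prodA a b) ∈ gr (p + q - j) := by
  refine F.gr_induction (P := fun a => tcoeff k A j (F.prodA a b) ∈ gr (p + q - j)) ha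
    (fun r hr => ?_) (by simp)
    (fun a b ha hb => by simp only [map_add, LinearMap.add_apply]; exact add_mem ha hb)
    (fun c a ha => by simp only [map_smul, LinearMap.smul_apply]; exact Submodule.smul_mem _ _ ha)
  refine F.gr_induction (P := fun b => tcoeff k A j (F.prodA (F.e r) b) ∈ gr (p + q - j)) hb
    (fun s hs => ?_) (by simp)
    (fun a b ha hb => by simp only [map_add]; exact add_mem ha hb)
    (fun c a ha => by simp only [map_smul]; exact Submodule.smul_mem _ _ ha)
  rw [prodA_basis]
  have hz := F.mul_basis_mem_below r s
  generalize F.mul (F.e r) (F.e s) = z at hz ⊢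
  rw [below] at hz
  induction hz using Submodule.span_induction with
  | zero => simp
  | add a b _ _ ha hb => rw [map_add, map_add]; exact add_mem ha hb
  | smul c a _ ha => rw [map_smul, map_smul]; exact Submodule.smul_mem _ _ ha
  | mem a ha =>
    obtain ⟨i, hi, rfl⟩ := ha
    rw [homogenize_basis, tcoeff_tmul, Polynomial.coeff_X_pow]
    split_ifs with h
    · have : p + q - j = (F.deg i : ℤ) := by omega
      rw [one_smul, this]
      exact F.e_mem i
    · simp

/-- The graded deformation given by a filtered product. -/
def deformation : GradedDeformation k A gr where
  μ j := F.prodA.compr₂ (tcoeff k A j)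
  star := F.starMap
  μ_zero := F.tcoeff_zero_prodA
  finite a b := finite_tcoeff_ne_zero _
  star_tmul a b := by
    rw [starMap_tmul, one_smul, one_smul]
    exact eq_finsum_tcoeff _
  star_assoc := F.starMap_assoc
  one_star y := by
    induction y using polyTensor_induction with
    | add y y' h h' => simp only [map_add, h, h']
    | smul p y h => simp only [map_smul, h]
    | one a => rw [starMap_tmul, one_smul, one_smul, prodA_one_left]
  star_one y := by
    induction y using polyTensor_induction with
    | add y y' h h' => simp only [map_add, LinearMap.add_apply, h, h']
    | smul p y h => simp only [map_smul, LinearMap.smul_apply, h]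
    | one a => rw [starMap_tmul, one_smul, one_smul, prodA_one_right]
  graded j p q a ha b hb := F.tcoeff_prodA_mem ha hb j

theorem deformation_μ_apply (j : ℕ) (a b : A) :
    F.deformation.μ j a b = tcoeff k A j (F.prodA a b) := rfl

theorem teval_prodA (a b : A) : teval k A (F.prodA a b) = F.mul a b := by
  induction a using F.basis_induction with
  | zero => simp
  | add y y' h h' => simp only [map_add, LinearMap.add_apply, h, h']
  | smul p y h => simp only [map_smul, LinearMap.smul_apply, h]
  | basis q =>
    induction b using F.basis_induction with
    | zero => simp
    | add y y' h h' => simp only [map_add, h, h']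
    | smul p y h => simp only [map_smul, h]
    | basis r => rw [prodA_basis, teval_homogenize]

theorem teval_starMap (y z : k[X] ⊗[k] A) :
    teval k A (F.starMap y z) = F.mul (teval k A y) (teval k A z) := by
  induction y using polyTensor_induction with
  | add y y' h h' => simp only [map_add, LinearMap.add_apply, h, h']
  | smul p y h => simp only [map_smul, LinearMap.smul_apply, teval_smul, h]
  | one a =>
    induction z using polyTensor_induction with
    | add y y' h h' => simp only [map_add, h, h']
    | smul p y h => simp only [map_smul, teval_smul, h]
    | one b => simp [teval_prodA]

/-- The evaluation of the deformation at `t = 1`, with values in `H`. -/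
def evalOne : F.deformation.Total →ₐ[k] H :=
  AlgHom.ofLinearMap
    { toFun := fun y => F.Φ (teval k A y)
      map_add' := fun y z => by
        rw [← map_add]
        exact congrArg F.Φ (map_add (teval k A) y z)
      map_smul' := fun c y => (congrArg F.Φ (teval_C_smul c y)).trans (map_smul F.Φ c _) }
    (by
      change F.Φ (teval k A (1 ⊗ₜ 1)) = 1
      rw [teval_tmul, Polynomial.eval_one, one_smul, F.Φ_one])
    (fun y z => by
      refine (congrArg F.Φ (F.teval_starMap y z)).trans ?_
      rw [mul_apply, LinearEquiv.apply_symm_apply]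
      rfl)

/-- The map from the fiber at `t = 1` to `H`. -/
def fiberMap : F.deformation.FiberOne →ₐ[k] H :=
  RingQuot.liftAlgHom k ⟨F.evalOne, by
    rintro _ _ ⟨rfl, rfl⟩
    rw [map_one, Algebra.algebraMap_eq_smul_one]
    refine (congrArg F.Φ (teval_smul Polynomial.X ((1 : k[X]) ⊗ₜ[k] (1 : A)))).trans ?_
    rw [teval_tmul, Polynomial.eval_X, Polynomial.eval_one, one_smul, one_smul, F.Φ_one]⟩

/-- The projection onto the fiber at `t = 1`. -/
def toFiber : F.deformation.Total →ₐ[k] F.deformation.FiberOne := RingQuot.mkAlgHom k _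

theorem fiberMap_toFiber (y : F.deformation.Total) : F.fiberMap (F.toFiber y) = F.evalOne y :=
  RingQuot.liftAlgHom_mkAlgHom_apply k _ _ _

theorem toFiber_X_smul (y : F.deformation.Total) :
    F.toFiber ((Polynomial.X : k[X]) • y) = F.toFiber y := by
  rw [Algebra.smul_def, map_mul]
  have : F.toFiber (algebraMap k[X] F.deformation.Total Polynomial.X) = F.toFiber 1 :=
    RingQuot.mkAlgHom_rel k ⟨rfl, rfl⟩
  rw [this, map_one, one_mul]

theorem toFiber_smul (p : k[X]) (y : F.deformation.Total) :
    F.toFiber (p • y) = Polynomial.eval 1 p • F.toFiber y := by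
  induction p using Polynomial.induction_on' with
  | add p q hp hq => rw [add_smul, map_add, hp, hq, Polynomial.eval_add, add_smul]
  | monomial i c =>
    rw [← Polynomial.C_mul_X_pow_eq_monomial, mul_smul]
    have h : F.toFiber ((Polynomial.X : k[X]) ^ i • y) = F.toFiber y := by
      induction i with
      | zero => rw [pow_zero, one_smul]
      | succ i ih => rw [pow_succ', mul_smul, toFiber_X_smul, ih]
    have h' : ∀ y : F.deformation.Total, (Polynomial.C c : k[X]) • y = c • y := fun y => rfl
    rw [h', map_smul, h]
    simp

/-- Since t acts as 1 on the fiber, each class is represented by the constant obtained by setting t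
= 1. -/
theorem toFiber_eq (y : k[X] ⊗[k] A) :
    F.toFiber (y : F.deformation.Total) = F.toFiber ((1 : k[X]) ⊗ₜ[k] teval k A y :) := by
  induction y using polyTensor_induction with
  | add y z hy hz =>
    rw [map_add, TensorProduct.tmul_add]
    exact (map_add F.toFiber _ _).trans ((congrArg₂ (· + ·) hy hz).trans
      (map_add F.toFiber _ _).symm)
  | smul p y hy =>
    refine (F.toFiber_smul p _).trans ?_
    have h : ∀ (c : k) (a : A), (1 : k[X]) ⊗ₜ[k] (c • a) = Polynomial.C c • (1 : k[X]) ⊗ₜ[k] a :=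
      fun c a => by
        rw [TensorProduct.smul_tmul', TensorProduct.tmul_smul, TensorProduct.smul_tmul',
          Polynomial.smul_eq_C_mul, smul_eq_mul]
    rw [hy, teval_smul, h]
    refine Eq.trans ?_ (F.toFiber_smul (Polynomial.C _) _).symm
    rw [Polynomial.eval_C]
  | one a => rw [teval_tmul, Polynomial.eval_one, one_smul]

/-- By `toFiber_eq` an element which vanishes at t = 1 has zero class; surjectivity is already
visible on constants. -/
theorem fiberMap_bijective : Function.Bijective F.fiberMap := by
  constructor
  · rw [injective_iff_map_eq_zero]
    intro z hz
    obtain ⟨y, rfl⟩ := RingQuot.mkAlgHom_surjective k _ z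
    have h : F.evalOne y = 0 := (F.fiberMap_toFiber y).symm.trans hz
    have h' : teval k A y = 0 := (LinearEquiv.map_eq_zero_iff _).1 h
    refine (F.toFiber_eq y).trans ?_
    rw [h', TensorProduct.tmul_zero]
    exact map_zero F.toFiber
  · intro h
    refine ⟨F.toFiber ((1 : k[X]) ⊗ₜ[k] F.Φ.symm h :), ?_⟩
    refine (F.fiberMap_toFiber _).trans ((congrArg F.Φ (teval_tmul _ _)).trans ?_)
    simp

/-- The fiber of the deformation at `t = 1` is `H`. -/
def fiberEquiv : H ≃ₐ[k] F.deformation.FiberOne :=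
  (AlgEquiv.ofBijective F.fiberMap F.fiberMap_bijective).symm

/-! ### First order terms -/

/-- At t = 1 the product is the sum of all μ_j(a,b). The terms with j at least 2 have degree at most
p + q - 2, hence less than m. -/
theorem mul_sub_mem_below {p q : ℤ} {m : ℕ} (hm : p + q ≤ m + 1) {a b : A} (ha : a ∈ gr p)
    (hb : b ∈ gr q) : F.mul a b - a * b - F.deformation.μ 1 a b ∈ below F.e F.deg m := by
  obtain ⟨N, -, hN⟩ := exists_eq_sum_tcoeff (F.prodA a b)
  -- The cutoff N + 2 leaves room to split off the terms with j = 0 and j = 1.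
  have h := congrArg (teval k A) (hN (N + 2) (by omega))
  rw [teval_prodA, map_sum, Finset.sum_range_succ', Finset.sum_range_succ'] at h
  simp only [teval_tmul, Polynomial.eval_pow, Polynomial.eval_X, one_pow, one_smul,
    tcoeff_zero_prodA, zero_add] at h
  rw [h, add_sub_cancel_right, deformation_μ_apply, add_sub_cancel_right]
  exact sum_mem fun j _ => F.mem_below_of_mem_gr (by push_cast; omega)
    (F.tcoeff_prodA_mem ha hb (j + 1 + 1))

theorem mul_sub_mul_mem_below {p q : ℤ} {m : ℕ} (hm : p + q ≤ m) {a b : A} (ha : a ∈ gr p)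
    (hb : b ∈ gr q) : F.mul a b - a * b ∈ below F.e F.deg m := by
  have h := add_mem (F.mul_sub_mem_below (m := m) (by omega) ha hb)
    (F.mem_below_of_mem_gr (m := m) (by push_cast; omega) (F.deformation.graded 1 p q a ha b hb))
  rwa [sub_add_cancel] at h

theorem μ_one_eq {p q : ℕ} {a b y : A} (ha : a ∈ gr p) (hb : b ∈ gr q)
    (hy : y ∈ gr (p + q - 1)) (h : F.mul a b - a * b - y ∈ below F.e F.deg (p + q - 1)) :
    F.deformation.μ 1 a b = y := F.tcoeff_one_prodA ha hb hy h

theorem tcoeff_one_smul (p : k[X]) (y : k[X] ⊗[k] A) :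
    tcoeff k A 1 (p • y) = p.coeff 0 • tcoeff k A 1 y + p.coeff 1 • tcoeff k A 0 y := by
  induction y using TensorProduct.induction_on with
  | zero => simp
  | add y z hy hz => simp only [smul_add, map_add, hy, hz]; abel
  | tmul q a =>
    rw [TensorProduct.smul_tmul', tcoeff_tmul, tcoeff_tmul, tcoeff_tmul, smul_eq_mul,
      Polynomial.mul_coeff_one, add_smul, mul_smul, mul_smul]

theorem tcoeff_one_starMap_left (y : k[X] ⊗[k] A) (c : A) :
    tcoeff k A 1 (F.starMap y (1 ⊗ₜ c)) =
      tcoeff k A 1 (F.prodA (tcoeff k A 0 y) c) + tcoeff k A 1 y * c := by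
  induction y using TensorProduct.induction_on with
  | zero => simp
  | add y z hy hz => simp only [map_add, LinearMap.add_apply, hy, hz, add_mul]; abel
  | tmul p a =>
    rw [starMap_tmul, one_smul, tcoeff_one_smul, tcoeff_tmul, tcoeff_tmul, tcoeff_zero_prodA,
      map_smul, LinearMap.smul_apply, map_smul, smul_mul_assoc]

theorem tcoeff_one_starMap_right (y : k[X] ⊗[k] A) (c : A) :
    tcoeff k A 1 (F.starMap (1 ⊗ₜ c) y) =
      tcoeff k A 1 (F.prodA c (tcoeff k A 0 y)) + c * tcoeff k A 1 y := by
  induction y using TensorProduct.induction_on with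
  | zero => simp
  | add y z hy hz => simp only [map_add, hy, hz, mul_add]; abel
  | tmul p a =>
    rw [starMap_tmul, one_smul, tcoeff_one_smul, tcoeff_tmul, tcoeff_tmul, tcoeff_zero_prodA,
      map_smul, map_smul, mul_smul_comm]

/-- This is the coefficient of t in the associativity of the deformed product. -/
theorem μ_one_cocycle (a b c : A) :
    a * F.deformation.μ 1 b c - F.deformation.μ 1 (a * b) c + F.deformation.μ 1 a (b * c)
      - F.deformation.μ 1 a b * c = 0 := by
  have h := congrArg (tcoeff k A 1) (F.starMap_assoc (1 ⊗ₜ a) (1 ⊗ₜ b) (1 ⊗ₜ c))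
  rw [F.starMap_tmul 1 1 a b, F.starMap_tmul 1 1 b c, one_smul, one_smul, one_smul, one_smul,
    tcoeff_one_starMap_left, tcoeff_one_starMap_right, tcoeff_zero_prodA, tcoeff_zero_prodA] at h
  simp only [deformation_μ_apply]
  linear_combination (norm := abel) -h

theorem μ_one_one_left (a : A) : F.deformation.μ 1 1 a = 0 := by
  rw [deformation_μ_apply, prodA_one_left, tcoeff_tmul, Polynomial.coeff_one, if_neg one_ne_zero,
    zero_smul]

theorem μ_one_one_right (a : A) : F.deformation.μ 1 a 1 = 0 := by
  rw [deformation_μ_apply, prodA_one_right, tcoeff_tmul, Polynomial.coeff_one, if_neg one_ne_zero,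
    zero_smul]

/-! ### Changing the isomorphism -/

section Twist

variable (β : A →ₗ[k] A) (hβ : ∀ p a, a ∈ gr p → β a ∈ gr (p - 1)) (hβ1 : β 1 = 0)

theorem mem_below_of_lowering {F : FilteredIso k A J H gr} {β : A →ₗ[k] A}
    (hβ : ∀ p a, a ∈ gr p → β a ∈ gr (p - 1)) {m : ℕ} {a : A}
    (ha : a ∈ below F.e F.deg (m + 1)) : β a ∈ below F.e F.deg m := by
  have : below F.e F.deg (m + 1) ≤ (below F.e F.deg m).comap β := by
    rw [below, Submodule.span_le]
    rintro _ ⟨q, hq, rfl⟩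
    exact F.mem_below_of_mem_gr (by omega) (hβ _ _ (F.e_mem q))
  exact this ha

theorem below_zero : below F.e F.deg 0 = ⊥ := by simp [below]

theorem exists_mem_below (a : A) : ∃ m, a ∈ below F.e F.deg m := by
  induction a using F.basis_induction with
  | basis q => exact ⟨_, basis_mem_below _ _ (Nat.lt_succ_self _)⟩
  | zero => exact ⟨0, zero_mem _⟩
  | add a b ha hb =>
    obtain ⟨m, hm⟩ := ha
    obtain ⟨m', hm'⟩ := hb
    exact ⟨max m m', add_mem (below_mono _ _ (le_max_left _ _) hm)
      (below_mono _ _ (le_max_right _ _) hm')⟩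
  | smul c a ha => obtain ⟨m, hm⟩ := ha; exact ⟨m, Submodule.smul_mem _ _ hm⟩

/-- On elements of bounded degree β is nilpotent, so 1 + β can be inverted by induction on the
bound. -/
theorem exists_add_lowering_eq {F : FilteredIso k A J H gr} {β : A →ₗ[k] A}
    (hβ : ∀ p a, a ∈ gr p → β a ∈ gr (p - 1)) (m : ℕ) :
    ∀ a ∈ below F.e F.deg m, ∃ b ∈ below F.e F.deg m, b + β b = a := by
  induction m with
  | zero =>
    intro a ha
    rw [below_zero, Submodule.mem_bot] at ha
    exact ⟨0, zero_mem _, by rw [ha, map_zero, add_zero]⟩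
  | succ m ih =>
    intro a ha
    -- If b is the preimage of β(a), which has smaller degree, then a - b is the preimage of a.
    obtain ⟨b, hb, h⟩ := ih _ (mem_below_of_lowering hβ ha)
    refine ⟨a - b, sub_mem ha (below_mono _ _ (Nat.le_succ m) hb), ?_⟩
    rw [map_sub, ← h]
    abel

theorem eq_zero_of_add_lowering {F : FilteredIso k A J H gr} {β : A →ₗ[k] A}
    (hβ : ∀ p a, a ∈ gr p → β a ∈ gr (p - 1)) (m : ℕ) :
    ∀ a ∈ below F.e F.deg m, a + β a = 0 → a = 0 := by
  induction m with
  | zero =>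
    intro a ha _
    rwa [below_zero, Submodule.mem_bot] at ha
  | succ m ih =>
    intro a ha h
    refine ih a ?_ h
    rw [eq_neg_of_add_eq_zero_left h]
    exact neg_mem (mem_below_of_lowering hβ ha)

theorem one_add_lowering_bijective (F : FilteredIso k A J H gr) (β : A →ₗ[k] A)
    (hβ : ∀ p a, a ∈ gr p → β a ∈ gr (p - 1)) :
    Function.Bijective (LinearMap.id + β : A →ₗ[k] A) := by
  constructor
  · rw [injective_iff_map_eq_zero]
    intro a ha
    obtain ⟨m, hm⟩ := F.exists_mem_below a
    exact eq_zero_of_add_lowering hβ m a hm ha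
  · intro a
    obtain ⟨m, hm⟩ := F.exists_mem_below a
    obtain ⟨b, -, hb⟩ := exists_add_lowering_eq hβ m a hm
    exact ⟨b, hb⟩

/-- The linear automorphism `1 + β` of `A`. -/
def lowering : A ≃ₗ[k] A := LinearEquiv.ofBijective _ (F.one_add_lowering_bijective β hβ)

theorem lowering_apply (a : A) : F.lowering β hβ a = a + β a := rfl

theorem lowering_symm_mem {m : ℕ} {a : A} (ha : a ∈ below F.e F.deg m) :
    (F.lowering β hβ).symm a ∈ below F.e F.deg m := by
  obtain ⟨b, hb, rfl⟩ := exists_add_lowering_eq hβ m a ha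
  rwa [← lowering_apply F β hβ, LinearEquiv.symm_apply_apply]

include hβ in
theorem coboundary_mem {p q : ℤ} {a b : A} (ha : a ∈ gr p) (hb : b ∈ gr q) :
    F.deformation.μ 1 a b - (β (a * b) - a * β b - β a * b) ∈ gr (p + q - 1) := by
  have t₁ := hβ _ _ (F.mul_mem _ _ _ _ ha hb)
  have t₂ := F.mul_mem _ _ _ _ ha (hβ _ _ hb)
  have t₃ := F.mul_mem _ _ _ _ (hβ _ _ ha) hb
  rw [← add_sub_assoc] at t₂
  rw [sub_add_eq_add_sub] at t₃
  exact sub_mem (F.deformation.graded 1 _ _ a ha b hb) (sub_mem (sub_mem t₁ t₂) t₃)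

/-- In the product of a + β(a) and b + β(b), the terms of degree p + q - 1 beyond μ₁(a,b) are aβ(b)
and β(a)b; the inverse of 1 + β contributes -β(ab). All else is lower. -/
theorem lowering_leading {p q : ℕ} {a b : A} (ha : a ∈ gr p) (hb : b ∈ gr q) :
    (F.lowering β hβ).symm (F.mul (F.lowering β hβ a) (F.lowering β hβ b)) - a * b
      - (F.deformation.μ 1 a b - (β (a * b) - a * β b - β a * b)) ∈
      below F.e F.deg (p + q - 1) := by
  set y := F.deformation.μ 1 a b - (β (a * b) - a * β b - β a * b) with hy
  set m := p + q - 1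
  have e : (F.lowering β hβ).symm (F.mul (F.lowering β hβ a) (F.lowering β hβ b)) - a * b - y =
      (F.lowering β hβ).symm (F.mul (F.lowering β hβ a) (F.lowering β hβ b)
        - F.lowering β hβ (a * b + y)) := by
    rw [map_sub, LinearEquiv.symm_apply_apply]
    abel
  rw [e]
  apply F.lowering_symm_mem β hβ
  have h₁ := F.mul_sub_mem_below (m := m) (by omega) ha hb
  have h₂ := F.mul_sub_mul_mem_below (m := m) (by omega) (hβ _ _ ha) hb
  have h₃ := F.mul_sub_mul_mem_below (m := m) (by omega) ha (hβ _ _ hb)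
  have h₄ : F.mul (β a) (β b) ∈ below F.e F.deg m := by
    have h := add_mem (F.mul_sub_mul_mem_below (m := m) (by omega) (hβ _ _ ha) (hβ _ _ hb))
      (F.mem_below_of_mem_gr (m := m) (by omega) (F.mul_mem _ _ _ _ (hβ _ _ ha) (hβ _ _ hb)))
    rwa [sub_add_cancel] at h
  have h₅ : β y ∈ below F.e F.deg m := by
    have hy' := F.coboundary_mem β hβ ha hb
    rw [← hy] at hy'
    exact F.mem_below_of_mem_gr (by omega) (hβ _ _ hy')
  have h := sub_mem (add_mem (add_mem (add_mem h₁ h₂) h₃) h₄) h₅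
  have e' : F.mul (F.lowering β hβ a) (F.lowering β hβ b) - F.lowering β hβ (a * b + y) =
      F.mul a b - a * b - F.deformation.μ 1 a b + (F.mul (β a) b - β a * b)
        + (F.mul a (β b) - a * β b) + F.mul (β a) (β b) - β y := by
    simp only [lowering_apply, map_add, LinearMap.add_apply]
    nth_rewrite 1 [hy]
    abel
  rwa [e']

/-- The isomorphism `Φ ∘ (1 + β)`. -/
def twist : FilteredIso k A J H gr where
  e := F.e
  deg := F.deg
  gr_eq := F.gr_eq
  one_mem := F.one_mem
  mul_mem := F.mul_mem
  Φ := (F.lowering β hβ).trans F.Φ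
  Φ_one := by rw [LinearEquiv.trans_apply, lowering_apply, hβ1, add_zero, F.Φ_one]
  leading q r := by
    have h := add_mem (below_mono _ _ (Nat.sub_le _ 1)
      (F.lowering_leading β hβ (F.e_mem q) (F.e_mem r)))
      (F.mem_below_of_mem_gr (by push_cast; omega) (F.coboundary_mem β hβ (F.e_mem q) (F.e_mem r)))
    rwa [sub_add_cancel] at h

theorem twist_μ_one (a b : A) : (F.twist β hβ hβ1).deformation.μ 1 a b =
    F.deformation.μ 1 a b - (β (a * b) - a * β b - β a * b) := by
  induction a using F.basis_induction with
  | zero => simp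
  | add y y' h h' =>
    simp only [map_add, LinearMap.add_apply, add_mul, h, h']
    abel
  | smul p y h => simp only [map_smul, LinearMap.smul_apply, h, smul_mul_assoc, smul_sub]
  | basis q =>
  induction b using F.basis_induction with
  | zero => simp
  | add y y' h h' =>
    simp only [map_add, mul_add, h, h']
    abel
  | smul p y h => simp only [map_smul, h, mul_smul_comm, smul_sub]
  | basis r =>
  exact (F.twist β hβ hβ1).μ_one_eq (F.e_mem q) (F.e_mem r)
    (F.coboundary_mem β hβ (F.e_mem q) (F.e_mem r))
    (F.lowering_leading β hβ (F.e_mem q) (F.e_mem r))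

end Twist

end FilteredIso

end FilteredProduct

/-! ### Components of A in degrees 0 and 1 -/

section Projections

variable {k V G : Type*} [Field k] [AddCommGroup V] [Module k V] [Group G]
  [DistribMulAction G V] [SMulCommClass G k V]

theorem mono_induction {P : Skew k V G → Prop} (a : Skew k V G)
    (mono : ∀ g s, P (mono k V G g s)) (add : ∀ a b, P a → P b → P (a + b)) : P a := by
  obtain ⟨f, rfl⟩ := (skewCoeff k V G).symm.surjective a
  induction f using Finsupp.induction_linear with
  | zero =>
    have := mono 1 0
    rwa [map_zero] at this ⊢
  | add f f' hf hf' => rw [map_add]; exact add _ _ hf hf'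
  | single g s => exact mono g s

theorem algebraMapInv_smul (g : G) (s : SymmetricAlgebra k V) :
    SymmetricAlgebra.algebraMapInv (g • s) = SymmetricAlgebra.algebraMapInv s := by
  have : (SymmetricAlgebra.algebraMapInv (R := k) (M := V)).comp (symAct k V G g) =
      SymmetricAlgebra.algebraMapInv := by
    apply SymmetricAlgebra.algHom_ext
    ext v
    simp [symAct, SymmetricAlgebra.algebraMapInv]
  exact DFunLike.congr_fun this s

theorem projkG_mul (a b : Skew k V G) :
    projkG k V G (a * b) = projkG k V G a * projkG k V G b := by
  induction a using mono_induction with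
  | add a b h h' => rw [add_mul, map_add, map_add, h, h', add_mul]
  | mono g s =>
    induction b using mono_induction with
    | add a b h h' => rw [mul_add, map_add, map_add, h, h', mul_add]
    | mono h t =>
      rw [mono_mul_mono, projkG_mono, projkG_mono, projkG_mono, map_mul, algebraMapInv_smul,
        MonoidAlgebra.single_mul_single]

theorem projkG_vA (v : V) : projkG k V G (vA k V G v) = 0 := by
  change projkG k V G (mono k V G 1 (SymmetricAlgebra.ι k V v)) = 0
  rw [projkG_mono, SymmetricAlgebra.algebraMapInv_ι, MonoidAlgebra.single_zero]

theorem projkG_of_mem {d : ℤ} (hd : d ≠ 0) {a : Skew k V G} (ha : a ∈ aGr k V G d) :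
    projkG k V G a = 0 := by
  rw [aGr] at ha
  induction ha using Submodule.span_induction with
  | zero => simp
  | add u v _ _ hu hv => rw [map_add, hu, hv, add_zero]
  | smul a v _ hv => rw [map_smul, hv, smul_zero]
  | mem a ha =>
    obtain ⟨m, g, s, hm, hs, rfl⟩ := ha
    obtain ⟨m, rfl⟩ : ∃ m', m = m' + 1 := ⟨m - 1, by omega⟩
    rw [projkG_mono]
    suffices h : SymmetricAlgebra.algebraMapInv s = 0 by rw [h, MonoidAlgebra.single_zero]
    rw [pow_succ'] at hs
    induction hs using Submodule.mul_induction_on' with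
    | mem_mul_mem u hu t ht =>
      obtain ⟨v, rfl⟩ := hu
      rw [map_mul, SymmetricAlgebra.algebraMapInv_ι, zero_mul]
    | add u _ t _ hu ht => rw [map_add, hu, ht, add_zero]

/-- The inclusion of V extends to an algebra map from S(V) to the square zero extension k ⊕ V, where
products of two vectors vanish; its second component is the linear part. -/
theorem exists_symLin : ∃ f : SymmetricAlgebra k V →ₗ[k] V,
    ∀ v s, f (SymmetricAlgebra.ι k V v * s) = SymmetricAlgebra.algebraMapInv s • v := by
  -- The algebra structure on `TrivSqZeroExt` asks for a right action as well; it is taken equal to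
  -- the left one.
  let _ : Module kᵐᵒᵖ V := Module.compHom V ((RingHom.id k).fromOpposite fun _ _ => mul_comm _ _)
  have : IsCentralScalar k V := ⟨fun _ _ => rfl⟩
  let F : SymmetricAlgebra k V →ₐ[k] TrivSqZeroExt k V :=
    SymmetricAlgebra.lift (TrivSqZeroExt.inrHom k V)
  have hF (v : V) : F (SymmetricAlgebra.ι k V v) = TrivSqZeroExt.inr v :=
    SymmetricAlgebra.lift_ι_apply ..
  have hfst (s) : (F s).fst = SymmetricAlgebra.algebraMapInv s := by
    have : (TrivSqZeroExt.fstHom k k V).comp F = SymmetricAlgebra.algebraMapInv := by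
      apply SymmetricAlgebra.algHom_ext
      ext v
      simp [hF, SymmetricAlgebra.algebraMapInv]
    exact DFunLike.congr_fun this s
  refine ⟨TrivSqZeroExt.sndHom k V ∘ₗ F.toLinearMap, fun v s => ?_⟩
  simp [hF, hfst]

/-- The degree one component of an element of `S(V)`. -/
def symLin : SymmetricAlgebra k V →ₗ[k] V := exists_symLin.choose

theorem symLin_ι_mul (v : V) (s : SymmetricAlgebra k V) :
    symLin (SymmetricAlgebra.ι k V v * s) = SymmetricAlgebra.algebraMapInv s • v :=
  exists_symLin.choose_spec v s

/-- The projection of `A` onto its degree one component, which is identified with `V ⊗ kG`. -/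
def projV : Skew k V G →ₗ[k] V ⊗[k] MonoidAlgebra k G :=
  Finsupp.lsum k (fun g => (TensorProduct.mk k V (MonoidAlgebra k G)).flip
    (MonoidAlgebra.single g 1) ∘ₗ symLin) ∘ₗ (skewCoeff k V G).toLinearMap

theorem projV_mono (g : G) (s : SymmetricAlgebra k V) :
    projV (mono k V G g s) = symLin s ⊗ₜ MonoidAlgebra.single g 1 := by
  simp [projV, skewCoeff_mono]

theorem projV_vA_mul (u : V) (a : Skew k V G) :
    projV (vA k V G u * a) = u ⊗ₜ projkG k V G a := by
  induction a using mono_induction with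
  | add a b h h' => rw [mul_add, map_add, h, h', map_add, TensorProduct.tmul_add]
  | mono g s =>
    rw [vA_mul_mono, projV_mono, symLin_ι_mul, projkG_mono, TensorProduct.smul_tmul,
      MonoidAlgebra.smul_single, smul_eq_mul, mul_one]

/-- Only the degree 0 part of a contributes to degree 1, and there gu = (gu)g, which is `twist`. -/
theorem projV_mul_vA (u : V) (a : Skew k V G) :
    projV (a * vA k V G u) = twist k V G (projkG k V G a) u := by
  induction a using mono_induction with
  | add a b h h' => rw [add_mul, map_add, h, h', map_add, map_add, LinearMap.add_apply]
  | mono g s =>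
    change projV (mono k V G g s * mono k V G 1 (SymmetricAlgebra.ι k V u)) = _
    rw [mono_mul_mono, smul_ι, mul_comm, mul_one, projV_mono, symLin_ι_mul, projkG_mono]
    have : MonoidAlgebra.single g (SymmetricAlgebra.algebraMapInv s) =
        SymmetricAlgebra.algebraMapInv s • MonoidAlgebra.single g (1 : k) := by
      rw [MonoidAlgebra.smul_single, smul_eq_mul, mul_one]
    rw [this, map_smul, LinearMap.smul_apply, twist_single, TensorProduct.smul_tmul']

end Projections

/-! ### Values of φ₃ and d₃ on generators of X_{1,2} and X_{0,3} -/

section Evaluation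

variable {k V G : Type*} [Field k] [AddCommGroup V] [Module k V] [Group G]
  [DistribMulAction G V] [SMulCommClass G k V]

theorem tri_eq_smul {W : Type*} [AddCommGroup W] [Module k W] (a b : Skew k V G) (w : W) :
    tri k V G a b w = env k V G a b • tri k V G 1 1 w := by
  rw [env_smul_tri, mul_one, one_mul]

theorem bimodLift_tri_one {W N : Type*} [AddCommGroup W] [Module k W] [AddCommGroup N] [Module k N]
    [Module (Env k V G) N] [IsScalarTower k (Env k V G) N] (f : W →ₗ[k] N) (w : W) :
    bimodLift k V G f (tri k V G 1 1 w) = f w := by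
  rw [bimodLift_tri, env_one_one, one_smul]

variable (k) in
/-- The element `1 ⊗ g ⊗ v ∧ w ⊗ 1` of `X_{1,2}`. -/
def e12 (g : G) (v w : V) : X k V G 1 2 :=
  tri k V G 1 1 (Finsupp.single ![g] (exteriorPower.ιMulti k 2 ![v, w]))

variable (k G) in
/-- The element `1 ⊗ u ∧ v ∧ w ⊗ 1` of `X_{0,3}`. -/
def e03 (u v w : V) : X k V G 0 3 :=
  tri k V G 1 1 (Finsupp.single (![] : Fin 0 → G) (exteriorPower.ιMulti k 3 ![u, v, w]))

theorem sum_perm_two {M : Type*} [AddCommMonoid M] (f : Equiv.Perm (Fin 2) → M) :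
    ∑ σ, f σ = f 1 + f (Equiv.swap 0 1) := by
  have : (Finset.univ : Finset (Equiv.Perm (Fin 2))) = {1, Equiv.swap 0 1} := by decide
  rw [this, Finset.sum_pair (by decide)]

theorem sum_perm_three {M : Type*} [AddCommMonoid M] (f : Equiv.Perm (Fin 3) → M) :
    ∑ σ, f σ = f 1 + (f (finRotate 3) + (f (finRotate 3)⁻¹ + (f (Equiv.swap 0 1) +
      (f (Equiv.swap 1 2) + f (Equiv.swap 0 2))))) := by
  have : (Finset.univ : Finset (Equiv.Perm (Fin 3))) =
    {1, finRotate 3, (finRotate 3)⁻¹, Equiv.swap 0 1, Equiv.swap 1 2, Equiv.swap 0 2} := by decide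
  rw [this, Finset.sum_insert (by decide), Finset.sum_insert (by decide),
    Finset.sum_insert (by decide), Finset.sum_insert (by decide), Finset.sum_pair (by decide)]

theorem alternatization_two {N : Type*} [AddCommGroup N] [Module k N] (B : V →ₗ[k] V →ₗ[k] N)
    (v w : V) :
    MultilinearMap.alternatization (multi2 k V B) ![v, w] = B v w - B w v := by
  rw [MultilinearMap.alternatization_apply, sum_perm_two]
  simp [multi2, sub_eq_add_neg]

theorem φ12_e12 (g : G) (v w : V) :
    φ12 k V G (e12 k g v w) = tri k V G 1 1 (φ12Aux k V G g v w - φ12Aux k V G g w v) := by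
  rw [φ12, e12, bimodLift_tri_one, Finsupp.lsum_single, LinearMap.comp_apply,
    exteriorPower.alternatingMapLinearEquiv_apply_ιMulti, alternatization_two]
  rfl

theorem φ03_e03 (u v w : V) :
    φ03 k V G (e03 k G u v w) = tri k V G 1 1
      (tmul3 k V G (vA k V G u) (vA k V G v) (vA k V G w) +
      (tmul3 k V G (vA k V G v) (vA k V G w) (vA k V G u) +
      (tmul3 k V G (vA k V G w) (vA k V G u) (vA k V G v) -
      (tmul3 k V G (vA k V G v) (vA k V G u) (vA k V G w) +
      (tmul3 k V G (vA k V G u) (vA k V G w) (vA k V G v) +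
      tmul3 k V G (vA k V G w) (vA k V G v) (vA k V G u)))))) := by
  rw [φ03, e03, bimodLift_tri_one, Finsupp.lsum_single, LinearMap.comp_apply,
    exteriorPower.alternatingMapLinearEquiv_apply_ιMulti]
  congr 1
  have key (σ : Equiv.Perm (Fin 3)) : MultilinearMap.domDomCongr σ
      ((multi3 k (Skew k V G) (tmul3 k V G)).compLinearMap fun _ => vA k V G) ![u, v, w] =
      tmul3 k V G (vA k V G (![u, v, w] (σ 0))) (vA k V G (![u, v, w] (σ 1)))
        (vA k V G (![u, v, w] (σ 2))) := rfl
  have h1 : Equiv.Perm.sign (finRotate 3) = 1 := by decide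
  have h2 : Equiv.Perm.sign (Equiv.swap (0 : Fin 3) 1) = -1 := by decide
  have h3 : Equiv.Perm.sign (Equiv.swap (1 : Fin 3) 2) = -1 := by decide
  have h4 : Equiv.Perm.sign (Equiv.swap (0 : Fin 3) 2) = -1 := by decide
  rw [MultilinearMap.alternatization_apply, sum_perm_three]
  simp only [key, Equiv.Perm.sign_one, Equiv.Perm.sign_inv, h1, h2, h3, h4, one_smul,
    Units.neg_smul]
  rw [← sub_eq_zero]
  simp only [show (finRotate 3) 0 = 1 from rfl, show (finRotate 3) 1 = 2 from rfl,
    show (finRotate 3) 2 = 0 from rfl, show (finRotate 3)⁻¹ 0 = 2 from rfl,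
    show (finRotate 3)⁻¹ 1 = 0 from rfl, show (finRotate 3)⁻¹ 2 = 1 from rfl,
    show (Equiv.swap (0 : Fin 3) 1) 2 = 2 from rfl, show (Equiv.swap (1 : Fin 3) 2) 0 = 0 from rfl,
    show (Equiv.swap (0 : Fin 3) 2) 1 = 1 from rfl, Equiv.Perm.coe_one, id, Equiv.swap_apply_left,
    Equiv.swap_apply_right, Matrix.cons_val]
  abel

theorem φ₃_e12 (g : G) (v w : V) : φ₃ k V G (0, 0, e12 k g v w, 0) = φ12 k V G (e12 k g v w) := by
  simp [φ₃]

theorem φ₃_e03 (u v w : V) : φ₃ k V G (0, 0, 0, e03 k G u v w) = φ03 k V G (e03 k G u v w) := by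
  simp [φ₃]

theorem dh_e12 (g : G) (v w : V) : dh k V G 0 2 (e12 k g v w) =
    env k V G (gA k V g) 1 • e02 k G v w - env k V G 1 (gA k V g) • e02 k G (g • v) (g • w) := by
  have h0 : Fin.tail ![g] = (![] : Fin 0 → G) := Subsingleton.elim _ _
  have h1 : Fin.init ![g] = (![] : Fin 0 → G) := Subsingleton.elim _ _
  have h2 : (DistribSMul.toLinearMap k V g) ∘ ![v, w] = ![g • v, g • w] := by
    funext i; fin_cases i <;> rfl
  rw [dh, e12, bimodLift_tri_one, Finsupp.lsum_single, e02, e02, ← tri_eq_smul, ← tri_eq_smul]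
  simp only [Finset.univ_eq_empty, Finset.sum_empty, add_zero, LinearMap.add_apply,
    LinearMap.comp_apply, Finsupp.lsingle_apply, h0, h1, zero_add, pow_one, neg_smul, one_smul,
    sub_eq_add_neg, LinearMap.neg_apply]
  have h3 : (![g] : Fin 1 → G) (Fin.last 0) = g := rfl
  rw [h3, exteriorPower.map_apply_ιMulti, h2]
  rfl

theorem dv_e12 (g : G) (v w : V) : dv k V G 1 1 (e12 k g v w) =
    -((env k V G (vA k V G (g • v)) 1 - env k V G 1 (vA k V G v)) • e11 k g w
      - (env k V G (vA k V G (g • w)) 1 - env k V G 1 (vA k V G w)) • e11 k g v) := by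
  rw [dv, e12, bimodLift_tri_one, Finsupp.lsum_single, LinearMap.smul_apply,
    exteriorPower.alternatingMapLinearEquiv_apply_ιMulti,
    AlternatingMap.alternatizeUncurryFin_apply, Fin.sum_univ_two, sub_smul, sub_smul, e11, e11]
  simp only [← tri_eq_smul]
  have h1 : Fin.removeNth (0 : Fin 2) ![v, w] = ![w] := by funext i; fin_cases i; rfl
  have h2 : Fin.removeNth (1 : Fin 2) ![v, w] = ![v] := by funext i; fin_cases i; rfl
  simp [dvAux, h1, h2, sub_eq_add_neg]
  abel

theorem dv_e03 (u v w : V) : dv k V G 0 2 (e03 k G u v w) =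
    (env k V G (vA k V G u) 1 - env k V G 1 (vA k V G u)) • e02 k G v w
      - (env k V G (vA k V G v) 1 - env k V G 1 (vA k V G v)) • e02 k G u w
      + (env k V G (vA k V G w) 1 - env k V G 1 (vA k V G w)) • e02 k G u v := by
  rw [dv, e03, bimodLift_tri_one, Finsupp.lsum_single, LinearMap.smul_apply,
    exteriorPower.alternatingMapLinearEquiv_apply_ιMulti,
    AlternatingMap.alternatizeUncurryFin_apply, Fin.sum_univ_three, sub_smul, sub_smul, sub_smul,
    e02, e02, e02]
  simp only [← tri_eq_smul]
  have h1 : Fin.removeNth (0 : Fin 3) ![u, v, w] = ![v, w] := by funext i; fin_cases i <;> rfl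
  have h2 : Fin.removeNth (1 : Fin 3) ![u, v, w] = ![u, w] := by funext i; fin_cases i <;> rfl
  have h3 : Fin.removeNth (2 : Fin 3) ![u, v, w] = ![u, v] := by funext i; fin_cases i <;> rfl
  simp [dvAux, h1, h2, h3, sub_eq_add_neg]
  abel

end Evaluation

/-! ### Cochain equations and the PBW conditions -/

section Cochains

variable {k V G : Type*} [Field k] [AddCommGroup V] [Module k V] [Group G]
  [DistribMulAction G V] [SMulCommClass G k V] (Ψ : BarToX k V G)

/-- The bilinear map on `A` which corresponds to the Hochschild 2-cochain `ψ^*(f)`. -/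
def pullBil (f : Cochain2 k V G) : Skew k V G →ₗ[k] Skew k V G →ₗ[k] Skew k V G :=
  (TensorProduct.mk k _ _).compr₂ (pullψ Ψ f)

theorem pullBil_apply (f : Cochain2 k V G) (a b : Skew k V G) :
    pullBil Ψ f a b = f (Ψ.ψ₂ (tri k V G 1 1 (a ⊗ₜ b))) := rfl

theorem pullBil_vA_vA (f : Cochain2 k V G) (v w : V) :
    pullBil Ψ f (vA k V G v) (vA k V G w) - pullBil Ψ f (vA k V G w) (vA k V G v) =
      f (0, 0, e02 k G v w) := by
  rw [← Ψ.ψ₂_vw, map_sub, map_sub, map_sub]; rfl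

theorem pullBil_gA_vA_sub (f : Cochain2 k V G) (g : G) (v : V) :
    pullBil Ψ f (gA k V g) (vA k V G v) - pullBil Ψ f (vA k V G (g • v)) (gA k V g) =
      f (0, e11 k g v, 0) := by
  rw [← Ψ.ψ₂_gv, map_sub, map_sub, map_sub]; rfl

theorem halfSquare_apply (f : Cochain2 k V G) (y : X3 k V G)
    (w : Skew k V G ⊗[k] (Skew k V G ⊗[k] Skew k V G)) (h : φ₃ k V G y = tri k V G 1 1 w) :
    halfSquare Ψ f y = circ (pullψ Ψ f) (pullψ Ψ f) w := by
  rw [halfSquare, pullφ, LinearMap.comp_apply, h, bimodLift_tri_one]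

theorem bracket_apply (f f' : Cochain2 k V G) (y : X3 k V G)
    (w : Skew k V G ⊗[k] (Skew k V G ⊗[k] Skew k V G)) (h : φ₃ k V G y = tri k V G 1 1 w) :
    bracket Ψ f f' y = gerstenhaber (pullψ Ψ f) (pullψ Ψ f') w := by
  rw [bracket, pullφ, LinearMap.comp_apply, h, bimodLift_tri_one]

theorem circ_tmul3 (f f' : Cochain2 k V G) (a b c : Skew k V G) :
    circ (pullψ Ψ f) (pullψ Ψ f') (tmul3 k V G a b c) =
      pullBil Ψ f (pullBil Ψ f' a b) c - pullBil Ψ f a (pullBil Ψ f' b c) := by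
  simp [circ, tmul3, pullBil]

theorem dStar_e12 (f : Cochain2 k V G) (g : G) (v w : V) :
    dStar k f (0, 0, e12 k g v w, 0) =
      gA k V g * f (0, 0, e02 k G v w) - f (0, 0, e02 k G (g • v) (g • w)) * gA k V g
      - (vA k V G (g • v) * f (0, e11 k g w, 0) - f (0, e11 k g w, 0) * vA k V G v
        - (vA k V G (g • w) * f (0, e11 k g v, 0) - f (0, e11 k g v, 0) * vA k V G w)) := by
  have h : d₃ k V G (0, 0, e12 k g v w, 0) =
      env k V G (gA k V g) 1 • (0, 0, e02 k G v w)
        - env k V G 1 (gA k V g) • (0, 0, e02 k G (g • v) (g • w))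
      - ((env k V G (vA k V G (g • v)) 1 - env k V G 1 (vA k V G v)) • (0, e11 k g w, 0)
        - (env k V G (vA k V G (g • w)) 1 - env k V G 1 (vA k V G w)) • (0, e11 k g v, 0)) := by
    simp [d₃, dh_e12, dv_e12]
  rw [dStar, LinearMap.comp_apply, h]
  simp only [map_sub, map_smul, sub_smul, env_smul, one_mul, mul_one]

theorem dStar_e03 (f : Cochain2 k V G) (u v w : V) :
    dStar k f (0, 0, 0, e03 k G u v w) =
      (vA k V G u * f (0, 0, e02 k G v w) - f (0, 0, e02 k G v w) * vA k V G u)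
      - (vA k V G v * f (0, 0, e02 k G u w) - f (0, 0, e02 k G u w) * vA k V G v)
      + (vA k V G w * f (0, 0, e02 k G u v) - f (0, 0, e02 k G u v) * vA k V G w) := by
  have h : d₃ k V G (0, 0, 0, e03 k G u v w) =
      (env k V G (vA k V G u) 1 - env k V G 1 (vA k V G u)) • (0, 0, e02 k G v w)
      - (env k V G (vA k V G v) 1 - env k V G 1 (vA k V G v)) • (0, 0, e02 k G u w)
      + (env k V G (vA k V G w) 1 - env k V G 1 (vA k V G w)) • (0, 0, e02 k G u v) := by
    simp [d₃, dv_e03]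
  rw [dStar, LinearMap.comp_apply, h]
  simp only [map_sub, map_add, map_smul, sub_smul, env_smul, one_mul, mul_one]

section Cocycle

variable {lam : Cochain2 k V G} {Ψ}

theorem pullBil_mem (hdeg : HasDegree (x2Gr k V G) (aGr k V G) lam (-1)) {p q : ℤ}
    {a b : Skew k V G} (ha : a ∈ aGr k V G p) (hb : b ∈ aGr k V G q) :
    pullBil Ψ lam a b ∈ aGr k V G (p + q - 1) := by
  have h := Ψ.deg₂ (p + q) (tri k V G 1 1 (a ⊗ₜ b)) (Submodule.subset_span
    ⟨0, 0, p + q, 1, 1, a ⊗ₜ b, by ring, one_mem_aGr, one_mem_aGr,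
      Submodule.subset_span ⟨p, q, a, b, rfl, ha, hb, rfl⟩, rfl⟩)
  rw [add_zero] at h
  exact hdeg _ _ h

/-- Pulling back along a chain map preserves cocycles; the identity is `comm₃` evaluated at 1 ⊗ a ⊗
b ⊗ c ⊗ 1. -/
theorem pullBil_cocycle (hc : dStar k lam = 0) (a b c : Skew k V G) :
    a * pullBil Ψ lam b c - pullBil Ψ lam (a * b) c + pullBil Ψ lam a (b * c)
      - pullBil Ψ lam a b * c = 0 := by
  have h := LinearMap.congr_fun hc (Ψ.ψ₃ (tri k V G 1 1 (a ⊗ₜ (b ⊗ₜ c))))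
  rw [dStar, LinearMap.comp_apply, Ψ.comm₃, δ₃_apply, tri_eq_smul a, tri_eq_smul 1 c] at h
  simp only [map_sub, map_add, map_smul, env_smul, one_mul, mul_one] at h
  exact h

theorem pullBil_aGr_zero (hdeg : HasDegree (x2Gr k V G) (aGr k V G) lam (-1))
    {a b : Skew k V G} (ha : a ∈ aGr k V G 0) (hb : b ∈ aGr k V G 0) :
    pullBil Ψ lam a b = 0 := by
  have h := pullBil_mem (Ψ := Ψ) hdeg ha hb
  rwa [aGr_of_neg (by norm_num), Submodule.mem_bot] at h

/-- The cocycle identity at (1,1,a) reduces the value to that at (1,1) times a, and the latter has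
degree -1. Hence ψ^*λ is normalized although ψ is not assumed to be. -/
theorem pullBil_one_left (hc : dStar k lam = 0)
    (hdeg : HasDegree (x2Gr k V G) (aGr k V G) lam (-1)) (a : Skew k V G) :
    pullBil Ψ lam 1 a = 0 := by
  have h := pullBil_cocycle (Ψ := Ψ) hc 1 1 a
  rw [pullBil_aGr_zero hdeg one_mem_aGr one_mem_aGr] at h
  simpa using h

theorem pullBil_one_right (hc : dStar k lam = 0)
    (hdeg : HasDegree (x2Gr k V G) (aGr k V G) lam (-1)) (a : Skew k V G) :
    pullBil Ψ lam a 1 = 0 := by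
  have h := pullBil_cocycle (Ψ := Ψ) hc a 1 1
  rw [pullBil_aGr_zero hdeg one_mem_aGr one_mem_aGr] at h
  simpa using h

/-- The value of ψ₂ is prescribed for g ≠ 1 only; normalization covers g = 1. -/
theorem pullBil_vA_gA (hc : dStar k lam = 0)
    (hdeg : HasDegree (x2Gr k V G) (aGr k V G) lam (-1)) (v : V) (g : G) :
    pullBil Ψ lam (vA k V G v) (gA k V g) = 0 := by
  by_cases hg : g = 1
  · subst hg
    exact pullBil_one_right hc hdeg _
  · rw [pullBil_apply, Ψ.ψ₂_vg v g hg, map_zero]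

theorem pullBil_vA_aGr_zero (hc : dStar k lam = 0)
    (hdeg : HasDegree (x2Gr k V G) (aGr k V G) lam (-1)) (v : V) {a : Skew k V G}
    (ha : a ∈ aGr k V G 0) : pullBil Ψ lam (vA k V G v) a = 0 := by
  have h : pullBil Ψ lam (vA k V G v) ∘ₗ kgA k V G = 0 :=
    kg_hom_ext fun g => by simp [pullBil_vA_gA hc hdeg]
  rw [← kgA_projkG ha]
  exact LinearMap.congr_fun h _

theorem pullBil_gA_vA (hc : dStar k lam = 0)
    (hdeg : HasDegree (x2Gr k V G) (aGr k V G) lam (-1)) (g : G) (v : V) :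
    pullBil Ψ lam (gA k V g) (vA k V G v) = lam (0, e11 k g v, 0) := by
  rw [← pullBil_gA_vA_sub Ψ, pullBil_vA_gA hc hdeg, sub_zero]

theorem pullBil_gA_vA_mem (hdeg : HasDegree (x2Gr k V G) (aGr k V G) lam (-1)) (g : G) (v : V) :
    pullBil Ψ lam (gA k V g) (vA k V G v) ∈ aGr k V G 0 := by
  simpa using pullBil_mem (Ψ := Ψ) hdeg (gA_mem_aGr g) (vA_mem_aGr v)

theorem pullBil_vA_swap (hv : ∀ x : X k V G 0 2, lam (0, 0, x) = 0) (v w : V) :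
    pullBil Ψ lam (vA k V G v) (vA k V G w) = pullBil Ψ lam (vA k V G w) (vA k V G v) := by
  rw [← sub_eq_zero, pullBil_vA_vA, hv]

theorem pullBil_gA_mul (hc : dStar k lam = 0)
    (hdeg : HasDegree (x2Gr k V G) (aGr k V G) lam (-1)) (g h : G) (v : V) :
    pullBil Ψ lam (gA k V (g * h)) (vA k V G v) =
      pullBil Ψ lam (gA k V g) (vA k V G (h • v)) * gA k V h
        + gA k V g * pullBil Ψ lam (gA k V h) (vA k V G v) := by
  have h1 := pullBil_cocycle (Ψ := Ψ) hc (gA k V g) (gA k V h) (vA k V G v)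
  have h2 := pullBil_cocycle (Ψ := Ψ) hc (gA k V g) (vA k V G (h • v)) (gA k V h)
  have h3 := pullBil_cocycle (Ψ := Ψ) hc (vA k V G (g • h • v)) (gA k V g) (gA k V h)
  rw [pullBil_aGr_zero hdeg (gA_mem_aGr g) (gA_mem_aGr h), gA_mul_gA, gA_mul_vA] at h1
  rw [pullBil_vA_gA hc hdeg, gA_mul_vA] at h2
  rw [pullBil_aGr_zero hdeg (gA_mem_aGr g) (gA_mem_aGr h), gA_mul_gA, pullBil_vA_gA hc hdeg,
    pullBil_vA_gA hc hdeg] at h3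
  simp only [mul_zero, zero_mul, zero_sub, sub_zero, add_zero, neg_eq_zero] at h1 h2 h3
  rw [h3, neg_zero, zero_add, sub_eq_zero] at h2
  rw [h2, sub_add_eq_add_sub, sub_eq_zero] at h1
  rw [← h1, add_comm]

theorem vA_mul_vA_comm (v w : V) : vA k V G v * vA k V G w = vA k V G w * vA k V G v := by
  change mono k V G 1 _ * mono k V G 1 _ = mono k V G 1 _ * mono k V G 1 _
  rw [mono_mul_mono, mono_mul_mono, one_smul, one_smul, mul_comm]

/-- The cocycle identity is combined over the three triples that make up B(v,w) in φ₃. What remains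
is symmetric in v and w. -/
theorem pullBil_gA_swap (hc : dStar k lam = 0)
    (hdeg : HasDegree (x2Gr k V G) (aGr k V G) lam (-1))
    (hv : ∀ x : X k V G 0 2, lam (0, 0, x) = 0) (g : G) (v w : V) :
    vA k V G (g • v) * pullBil Ψ lam (gA k V g) (vA k V G w)
        + pullBil Ψ lam (gA k V g) (vA k V G v) * vA k V G w =
      vA k V G (g • w) * pullBil Ψ lam (gA k V g) (vA k V G v)
        + pullBil Ψ lam (gA k V g) (vA k V G w) * vA k V G v := by
  have key (v w : V) : vA k V G (g • v) * pullBil Ψ lam (gA k V g) (vA k V G w)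
        + pullBil Ψ lam (gA k V g) (vA k V G v) * vA k V G w =
      gA k V g * pullBil Ψ lam (vA k V G v) (vA k V G w)
        + pullBil Ψ lam (gA k V g) (vA k V G v * vA k V G w)
        - pullBil Ψ lam (vA k V G (g • v) * vA k V G (g • w)) (gA k V g)
        - pullBil Ψ lam (vA k V G (g • v)) (vA k V G (g • w)) * gA k V g := by
    have h1 := pullBil_cocycle (Ψ := Ψ) hc (gA k V g) (vA k V G v) (vA k V G w)
    have h2 := pullBil_cocycle (Ψ := Ψ) hc (vA k V G (g • v)) (gA k V g) (vA k V G w)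
    have h3 := pullBil_cocycle (Ψ := Ψ) hc (vA k V G (g • v)) (vA k V G (g • w)) (gA k V g)
    rw [pullBil_vA_gA hc hdeg, gA_mul_vA, zero_mul, sub_zero] at h2
    rw [pullBil_vA_gA hc hdeg, mul_zero, zero_sub] at h3
    rw [gA_mul_vA] at h1
    linear_combination (norm := abel) h2 - h1 - h3
  rw [key v w, key w v, pullBil_vA_swap hv v w, pullBil_vA_swap hv (g • v), vA_mul_vA_comm v w,
    vA_mul_vA_comm (g • v)]

end Cocycle

/-- Linear maps on `A` agree if they do so on `G` and on the components of nonzero degree. -/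
theorem skew_hom_ext [FiniteDimensional k V] {N : Type*} [AddCommGroup N] [Module k N]
    {f f' : Skew k V G →ₗ[k] N} (h₀ : ∀ g, f (gA k V g) = f' (gA k V g))
    (h : ∀ d : ℕ, d ≠ 0 → ∀ a ∈ aGr k V G d, f a = f' a) : f = f' := by
  let x := Module.finBasis k V
  apply (skewBasis G x).ext
  rintro ⟨m, g⟩
  by_cases hm : m = 0
  · rw [hm, skewBasis_zero, h₀]
  · apply h m.card (by simpa using hm)
    rw [aGr_eq_span x]
    exact Submodule.subset_span ⟨(m, g), rfl, rfl⟩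

section Datum

variable {lam kap : Cochain2 k V G} {Ψ}

variable (Ψ lam) in
/-- The parameter `λ` of a cochain, extended linearly to `kG`. -/
def linLam : MonoidAlgebra k G →ₗ[k] V →ₗ[k] MonoidAlgebra k G :=
  ((pullBil Ψ lam).compl₁₂ (kgA k V G) (vA k V G)).compr₂ (projkG k V G)

variable (Ψ kap) in
/-- The parameter `κ` of a cochain, as a bilinear map. -/
def linKap : V →ₗ[k] V →ₗ[k] MonoidAlgebra k G :=
  ((pullBil Ψ kap - (pullBil Ψ kap).flip).compl₁₂ (vA k V G) (vA k V G)).compr₂ (projkG k V G)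

theorem linLam_single (g : G) (v : V) : linLam Ψ lam (MonoidAlgebra.single g 1) v =
    projkG k V G (pullBil Ψ lam (gA k V g) (vA k V G v)) := by
  simp [linLam]

theorem linKap_apply (v w : V) : linKap Ψ kap v w = projkG k V G (kap (0, 0, e02 k G v w)) := by
  rw [← pullBil_vA_vA Ψ]; rfl

theorem linKap_apply' (v w : V) : linKap Ψ kap v w =
    projkG k V G (pullBil Ψ kap (vA k V G v) (vA k V G w))
      - projkG k V G (pullBil Ψ kap (vA k V G w) (vA k V G v)) := by
  rw [linKap_apply, ← pullBil_vA_vA Ψ, map_sub]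

/-- Pairing with w by a cochain of degree -1 keeps the degree of a, so only the degree 0 part of a
matters. Hence κ may be inhomogeneous. -/
theorem projkG_pullBil_vA [FiniteDimensional k V]
    (hdeg : HasDegree (x2Gr k V G) (aGr k V G) lam (-1)) (a : Skew k V G) (w : V) :
    projkG k V G (pullBil Ψ lam a (vA k V G w)) = linLam Ψ lam (projkG k V G a) w := by
  have h : projkG k V G ∘ₗ (pullBil Ψ lam).flip (vA k V G w) =
      (linLam Ψ lam).flip w ∘ₗ projkG k V G := by
    refine skew_hom_ext (fun g => ?_) fun d hd a ha => ?_
    · simp [projkG_gA, linLam_single]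
    · have h1 := pullBil_mem (Ψ := Ψ) hdeg ha (vA_mem_aGr w)
      rw [add_sub_cancel_right] at h1
      have hd' : (d : ℤ) ≠ 0 := by exact_mod_cast hd
      simp [projkG_of_mem hd' ha, projkG_of_mem hd' h1]
  exact LinearMap.congr_fun h a

theorem projkG_pullBil_vA_left [FiniteDimensional k V] (hc : dStar k lam = 0)
    (hdeg : HasDegree (x2Gr k V G) (aGr k V G) lam (-1)) (a : Skew k V G) (u : V) :
    projkG k V G (pullBil Ψ lam (vA k V G u) a) = 0 := by
  have h : projkG k V G ∘ₗ pullBil Ψ lam (vA k V G u) = 0 := by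
    refine skew_hom_ext (fun g => ?_) fun d hd a ha => ?_
    · simp [pullBil_vA_gA hc hdeg]
    · have h1 := pullBil_mem (Ψ := Ψ) hdeg (vA_mem_aGr u) ha
      rw [add_sub_cancel_left] at h1
      exact projkG_of_mem (by exact_mod_cast hd) h1
  exact LinearMap.congr_fun h a

theorem linLam_swap (hc : dStar k lam = 0)
    (hdeg : HasDegree (x2Gr k V G) (aGr k V G) lam (-1))
    (hv : ∀ x : X k V G 0 2, lam (0, 0, x) = 0) (g : G) (u v : V) :
    twist k V G (linLam Ψ lam (MonoidAlgebra.single g 1) v) u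
        - (g • u) ⊗ₜ linLam Ψ lam (MonoidAlgebra.single g 1) v =
      twist k V G (linLam Ψ lam (MonoidAlgebra.single g 1) u) v
        - (g • v) ⊗ₜ linLam Ψ lam (MonoidAlgebra.single g 1) u := by
  have h := congrArg projV (pullBil_gA_swap (Ψ := Ψ) hc hdeg hv g u v)
  simp only [map_add, projV_vA_mul, projV_mul_vA, ← linLam_single] at h
  rw [sub_eq_sub_iff_add_eq_add, add_comm, add_comm (twist k V G _ v)]
  linear_combination (norm := abel) -h

/-- The degree 0 part of ½[λ,λ] = d^*κ on X_{1,2}. The values of κ on X_{1,1} enter only multiplied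
by vectors and disappear. -/
theorem linKap_smul [FiniteDimensional k V] (hc : dStar k lam = 0)
    (hdeg : HasDegree (x2Gr k V G) (aGr k V G) lam (-1))
    (hv : ∀ x : X k V G 0 2, lam (0, 0, x) = 0)
    (hs : halfSquare Ψ lam = dStar k kap) (g : G) (u v : V) :
    linKap Ψ kap (g • u) (g • v) * MonoidAlgebra.single g 1
      - MonoidAlgebra.single g 1 * linKap Ψ kap u v =
    linLam Ψ lam (linLam Ψ lam (MonoidAlgebra.single g 1) v) u
      - linLam Ψ lam (linLam Ψ lam (MonoidAlgebra.single g 1) u) v := by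
  have h := LinearMap.congr_fun hs (0, 0, e12 k g u v, 0)
  rw [dStar_e12, halfSquare_apply _ _ _ _ ((φ₃_e12 g u v).trans (φ12_e12 g u v))] at h
  have h' := congrArg (projkG k V G) h
  simp only [φ12Aux, LinearMap.mk₂_apply, map_sub, map_add, circ_tmul3, projkG_mul, projkG_gA,
    projkG_vA, zero_mul, mul_zero, sub_zero, ← linKap_apply (Ψ := Ψ), projkG_pullBil_vA hdeg,
    pullBil_vA_gA hc hdeg, pullBil_vA_swap hv v u, map_zero,
    pullBil_vA_swap hv (g • v) (g • u), LinearMap.zero_apply,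
    pullBil_vA_aGr_zero hc hdeg _ (pullBil_gA_vA_mem hdeg g _)] at h'
  simp only [linLam_single] at h' ⊢
  linear_combination (norm := abel) h'

/-- The degree 1 part of ½[λ,λ] = d^*κ on X_{0,3}, where the left side vanishes by the symmetry of
ψ^*λ on V. -/
theorem linKap_cyclic [FiniteDimensional k V]
    (hv : ∀ x : X k V G 0 2, lam (0, 0, x) = 0)
    (hs : halfSquare Ψ lam = dStar k kap) (u v w : V) :
    (twist k V G (linKap Ψ kap u v) w - w ⊗ₜ linKap Ψ kap u v)
      + (twist k V G (linKap Ψ kap v w) u - u ⊗ₜ linKap Ψ kap v w)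
      + (twist k V G (linKap Ψ kap w u) v - v ⊗ₜ linKap Ψ kap w u) = 0 := by
  have h := LinearMap.congr_fun hs (0, 0, 0, e03 k G u v w)
  have hk : linKap Ψ kap w u = - linKap Ψ kap u w := by
    rw [linKap_apply', linKap_apply', neg_sub]
  rw [dStar_e03, halfSquare_apply _ _ _ _ ((φ₃_e03 u v w).trans (φ03_e03 u v w))] at h
  have h' := congrArg projV h
  simp only [map_sub, map_add, circ_tmul3, pullBil_vA_swap hv v u, pullBil_vA_swap hv w u,
    pullBil_vA_swap hv w v, projV_vA_mul, projV_mul_vA, ← linKap_apply (Ψ := Ψ)] at h'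
  rw [hk, map_neg, LinearMap.neg_apply, TensorProduct.tmul_neg]
  linear_combination (norm := abel) h'

/-- The degree 0 part of [λ,κ] = 0 on X_{0,3}. In λ ∘ κ the terms with a vector in the first slot of
λ have no degree 0 part; those of κ ∘ λ cancel by symmetry. -/
theorem linLam_cyclic [FiniteDimensional k V] (hc : dStar k lam = 0)
    (hdeg : HasDegree (x2Gr k V G) (aGr k V G) lam (-1))
    (hv : ∀ x : X k V G 0 2, lam (0, 0, x) = 0)
    (hb : bracket Ψ lam kap = 0) (u v w : V) :
    linLam Ψ lam (linKap Ψ kap u v) w + linLam Ψ lam (linKap Ψ kap v w) u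
      + linLam Ψ lam (linKap Ψ kap w u) v = 0 := by
  have h := LinearMap.congr_fun hb (0, 0, 0, e03 k G u v w)
  rw [bracket_apply _ _ _ _ _ ((φ₃_e03 u v w).trans (φ03_e03 u v w))] at h
  have h' := congrArg (projkG k V G) h
  simp only [gerstenhaber, LinearMap.add_apply, map_sub, map_add, circ_tmul3,
    pullBil_vA_swap hv v u, pullBil_vA_swap hv w u, pullBil_vA_swap hv w v,
    projkG_pullBil_vA hdeg, projkG_pullBil_vA_left hc hdeg, LinearMap.zero_apply, map_zero] at h'
  simp only [linKap_apply', map_sub, LinearMap.sub_apply]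
  linear_combination (norm := abel) h'

end Datum

end Cochains

/-! ### Hochschild cocycles which vanish on generators -/

section Presentation

variable (k V G : Type*) [Field k] [AddCommGroup V] [Module k V] [Group G]
  [DistribMulAction G V] [SMulCommClass G k V]

/-- The inclusion of `kG` in `A`, as an algebra homomorphism. -/
def kgAlgHom : MonoidAlgebra k G →ₐ[k] Skew k V G :=
  MonoidAlgebra.lift k _ G
    { toFun := fun g => gA k V g
      map_one' := gA_one
      map_mul' := fun g h => (gA_mul_gA g h).symm }

theorem kgAlgHom_single (g : G) : kgAlgHom k V G (MonoidAlgebra.single g 1) = gA k V g := by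
  simp [kgAlgHom]

/-- The projection of `H_{0,0}` onto `A`. -/
def zeroAlgHom : (PBWDatum.zero k V G).Alg →ₐ[k] Skew k V G :=
  (PBWDatum.zero k V G).algLift (vA k V G) (kgAlgHom k V G)
    (fun v w => by rw [vA_mul_vA_comm, sub_self]; simp [PBWDatum.zero])
    (fun g v => by rw [kgAlgHom_single, gA_mul_vA, sub_self]; simp [PBWDatum.zero])

variable {k V G} {n : ℕ} (x : Module.Basis (Fin n) k V)

theorem prod_vA_mul_gA (w : List (Fin n)) (g : G) :
    (w.map fun i => vA k V G (x i)).prod * gA k V g = skewBasis G x (↑w, g) := by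
  induction w with
  | nil => simp [skewBasis_zero]
  | cons i w ih =>
    rw [List.map_cons, List.prod_cons, mul_assoc, ih, vA_mul_skewBasis, Multiset.cons_coe]

theorem zeroAlgHom_pbw (a : Skew k V G) :
    zeroAlgHom k V G ((PBWDatum.zero k V G).pbw x a) = a := by
  have : (zeroAlgHom k V G).toLinearMap ∘ₗ ((PBWDatum.zero k V G).pbw x).toLinearMap =
      LinearMap.id := (skewBasis G x).ext fun ⟨m, g⟩ => by
    have h : skewBasis G x (m, g) =
        (PBWDatum.zero k V G).proj x (PBWDatum.word k (m.sort (· ≤ ·)) g) := by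
      rw [← PBWDatum.sec_skewBasis x m g, PBWDatum.proj_sec]
    change zeroAlgHom k V G ((PBWDatum.zero k V G).pbw x (skewBasis G x (m, g))) = _
    rw [h, PBWDatum.pbw_proj, PBWDatum.wordAlg_word, map_mul, map_list_prod, List.map_map, ← h]
    have hV : (zeroAlgHom k V G) ∘ (fun i => (PBWDatum.zero k V G).hV (x i)) =
        fun i => vA k V G (x i) := funext fun i => PBWDatum.algLift_hV _ _ _ _ _ _
    rw [hV, zeroAlgHom, PBWDatum.algLift_hG, kgAlgHom_single, prod_vA_mul_gA, Multiset.sort_eq]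
    rfl
  exact LinearMap.congr_fun this a

theorem pbw_zeroAlgHom (h : (PBWDatum.zero k V G).Alg) :
    (PBWDatum.zero k V G).pbw x (zeroAlgHom k V G h) = h := by
  obtain ⟨a, rfl⟩ := ((PBWDatum.zero k V G).pbw x).surjective h
  rw [zeroAlgHom_pbw]

/-- For zero parameters `pbw` is inverse to an algebra homomorphism, hence multiplicative. So A is
presented by V and G with the relations of `H_{0,0}`. -/
theorem pbw_zero_mul (a b : Skew k V G) : (PBWDatum.zero k V G).pbw x (a * b) =
    (PBWDatum.zero k V G).pbw x a * (PBWDatum.zero k V G).pbw x b := by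
  conv_lhs => rw [← zeroAlgHom_pbw x a, ← zeroAlgHom_pbw x b, ← map_mul, pbw_zeroAlgHom]

end Presentation

/-! ### The square zero extension of an algebra given by a 2-cocycle -/

section Coboundary

variable {k A : Type*} [Field k] [Ring A] [Algebra k A] (c : A →ₗ[k] A →ₗ[k] A)

/-- The left multiplication by `(a, a')` in the square zero extension of `A` given by a Hochschild
2-cocycle `c`, as an operator on `A × A`. -/
def extOp : A × A →ₗ[k] Module.End k (A × A) :=
  LinearMap.mk₂ k (fun a b => (a.1 * b.1, a.1 * b.2 + a.2 * b.1 + c a.1 b.1))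
    (fun a a' b => by
      ext <;> simp only [Prod.fst_add, Prod.snd_add, add_mul, map_add, LinearMap.add_apply]; abel)
    (fun s a b => by ext <;> simp)
    (fun a b b' => by
      ext <;> simp only [Prod.fst_add, Prod.snd_add, mul_add, map_add]; abel)
    (fun s a b => by ext <;> simp)

theorem extOp_apply (a b : A × A) :
    extOp c a b = (a.1 * b.1, a.1 * b.2 + a.2 * b.1 + c a.1 b.1) := rfl

variable {c}

/-- The cocycle identity is associativity of the extension. Working with left multiplications as
operators avoids a ring structure on `A × A`. -/
theorem extOp_mul (hc : ∀ a b d, a * c b d - c (a * b) d + c a (b * d) - c a b * d = 0)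
    (a b : A × A) : extOp c a * extOp c b = extOp c (extOp c a b) := by
  refine LinearMap.ext fun d => ?_
  rw [Module.End.mul_apply]
  simp only [extOp_apply]
  ext
  · simp only [mul_assoc]
  · simp only [mul_add, add_mul, mul_assoc]
    linear_combination (norm := abel) hc a.1 b.1 d.1

theorem extOp_one (h : ∀ a, c 1 a = 0) : extOp c (1, 0) = 1 := by
  refine LinearMap.ext fun d => ?_
  simp [extOp_apply, h]

theorem extOp_apply_one (h : ∀ a, c a 1 = 0) (a : A × A) : extOp c a (1, 0) = a := by
  simp [extOp_apply, h]

end Coboundary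

/-! ### Splitting the extension over the generators of A -/

section SkewCoboundary

variable {k V G : Type*} [Field k] [AddCommGroup V] [Module k V] [FiniteDimensional k V] [Group G]
  [DistribMulAction G V] [SMulCommClass G k V]

/-- A Hochschild 2-cocycle of `A` of degree `-1` which satisfies the same relations as a coboundary
on the generators is the coboundary of a cochain of degree `-1`. -/
theorem exists_coboundary {c : Skew k V G →ₗ[k] Skew k V G →ₗ[k] Skew k V G}
    (hc : ∀ a b d, a * c b d - c (a * b) d + c a (b * d) - c a b * d = 0)
    (h1 : ∀ a, c 1 a = 0) (h1' : ∀ a, c a 1 = 0)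
    (hgg : ∀ g h, c (gA k V g) (gA k V h) = 0)
    (hgv : ∀ g v, c (gA k V g) (vA k V G v) = c (vA k V G (g • v)) (gA k V g))
    (hvw : ∀ v w, c (vA k V G v) (vA k V G w) = c (vA k V G w) (vA k V G v))
    (hdeg : ∀ p q a b, a ∈ aGr k V G p → b ∈ aGr k V G q → c a b ∈ aGr k V G (p + q - 1)) :
    ∃ β : Skew k V G →ₗ[k] Skew k V G, (∀ p a, a ∈ aGr k V G p → β a ∈ aGr k V G (p - 1)) ∧
      β 1 = 0 ∧ ∀ a b, β (a * b) - a * β b - β a * b = c a b := by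
  let x := Module.finBasis k V
  let Z := PBWDatum.zero k V G
  let fG : MonoidAlgebra k G →ₐ[k] Module.End k (Skew k V G × Skew k V G) :=
    MonoidAlgebra.lift k _ G
      { toFun := fun g => extOp c (gA k V g, 0)
        map_one' := extOp_one h1
        map_mul' := fun g h => by
          rw [extOp_mul hc, extOp_apply]
          simp [hgg, gA_mul_gA] }
  have fG_single (g : G) : fG (MonoidAlgebra.single g 1) = extOp c (gA k V g, 0) := by
    simp only [fG, MonoidAlgebra.lift_single, one_smul]
    rfl
  let fV : V →ₗ[k] Module.End k (Skew k V G × Skew k V G) :=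
    extOp c ∘ₗ LinearMap.inl k _ _ ∘ₗ vA k V G
  have fV_apply (v : V) : fV v = extOp c (vA k V G v, 0) := rfl
  -- The lifts (v,0) and (g,0) satisfy the defining relations of A because c vanishes on G, is
  -- symmetric on V and agrees on (g,v) and (gv,g).
  let θ : Z.Alg →ₐ[k] Module.End k (Skew k V G × Skew k V G) := Z.algLift fV fG
    (fun v w => by
      rw [fV_apply, fV_apply, extOp_mul hc, extOp_mul hc, ← map_sub, extOp_apply, extOp_apply]
      simp [vA_mul_vA_comm v w, hvw v w, Z, PBWDatum.zero])
    (fun g v => by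
      rw [fV_apply, fV_apply, fG_single, extOp_mul hc, extOp_mul hc, ← map_sub, extOp_apply,
        extOp_apply]
      simp [gA_mul_vA, hgv, Z, PBWDatum.zero])
  -- Every operator in the image is a left multiplication by its value at the unit, so θ is a
  -- homomorphism into the extension itself.
  have hθ (h : Z.Alg) : θ h = extOp c (θ h (1, 0)) := by
    induction h using Z.alg_induction with
    | V v => rw [PBWDatum.algLift_hV, fV_apply, extOp_apply_one h1']
    | G g => rw [PBWDatum.algLift_hG, fG_single, extOp_apply_one h1']
    | scalar s =>
      rw [AlgHom.commutes, Algebra.algebraMap_eq_smul_one, LinearMap.smul_apply, map_smul,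
        Module.End.one_apply, extOp_one h1]
    | add a b ha hb => rw [map_add, LinearMap.add_apply, map_add, ← ha, ← hb]
    | mul a b ha hb =>
      rw [map_mul, Module.End.mul_apply]
      conv_lhs => rw [ha, hb, extOp_mul hc, ← ha]
  let s : Skew k V G →ₗ[k] Skew k V G × Skew k V G :=
    (LinearMap.applyₗ (1, 0) ∘ₗ θ.toLinearMap) ∘ₗ (Z.pbw x).toLinearMap
  have s_apply (a : Skew k V G) : s a = θ (Z.pbw x a) (1, 0) := rfl
  have s_mul (a b : Skew k V G) : s (a * b) = extOp c (s a) (s b) := by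
    rw [s_apply, pbw_zero_mul, map_mul, Module.End.mul_apply, hθ (Z.pbw x a)]
    rfl
  have s_vA (v : V) : s (vA k V G v) = (vA k V G v, 0) := by
    rw [s_apply, PBWDatum.pbw_vA, PBWDatum.algLift_hV, fV_apply, extOp_apply_one h1']
  have s_gA (g : G) : s (gA k V g) = (gA k V g, 0) := by
    rw [s_apply, PBWDatum.pbw_gA, PBWDatum.algLift_hG, fG_single, extOp_apply_one h1']
  -- Prefixing x_i to a monomial y changes the second component β(y) to x_i β(y) + c(x_i,y), which
  -- shows inductively that β has degree -1.
  have s_basis (m : Multiset (Fin _)) (g : G) : (s (skewBasis G x (m, g))).1 = skewBasis G x (m, g)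
      ∧ (s (skewBasis G x (m, g))).2 ∈ aGr k V G (m.card - 1) := by
    induction m using Multiset.induction with
    | empty =>
      rw [skewBasis_zero, s_gA]
      exact ⟨rfl, zero_mem _⟩
    | cons i m ih =>
      have hm : skewBasis G x (m, g) ∈ aGr k V G m.card := by
        rw [aGr_eq_span x]
        exact Submodule.subset_span ⟨(m, g), rfl, rfl⟩
      rw [← vA_mul_skewBasis, s_mul, s_vA, extOp_apply]
      refine ⟨by rw [ih.1], ?_⟩
      have t₁ := aGr_mul_mem (vA_mem_aGr (k := k) (G := G) (x i)) ih.2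
      have t₂ := hdeg _ _ _ _ (vA_mem_aGr (k := k) (G := G) (x i)) hm
      have e₁ : (1 : ℤ) + (m.card - 1) = ((i ::ₘ m).card : ℤ) - 1 := by
        rw [Multiset.card_cons]; push_cast; ring
      have e₂ : (1 : ℤ) + m.card - 1 = ((i ::ₘ m).card : ℤ) - 1 := by
        rw [Multiset.card_cons]; push_cast; ring
      rw [e₁] at t₁
      rw [e₂] at t₂
      simpa only [zero_mul, add_zero, ih.1] using add_mem t₁ t₂
  have s_fst (a : Skew k V G) : (s a).1 = a := by
    have : LinearMap.fst k _ _ ∘ₗ s = LinearMap.id :=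
      (skewBasis G x).ext fun ⟨m, g⟩ => (s_basis m g).1
    exact LinearMap.congr_fun this a
  refine ⟨LinearMap.snd k _ _ ∘ₗ s, fun p a ha => ?_, ?_, fun a b => ?_⟩
  · rw [aGr_eq_span x] at ha
    have : Submodule.span k {y | ∃ q : Multiset (Fin _) × G, (q.1.card : ℤ) = p ∧
        y = skewBasis G x q} ≤ (aGr k V G (p - 1)).comap (LinearMap.snd k _ _ ∘ₗ s) := by
      rw [Submodule.span_le]
      rintro _ ⟨⟨m, g⟩, rfl, rfl⟩
      exact (s_basis m g).2
    exact this ha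
  · rw [← gA_one, LinearMap.comp_apply, s_gA]
    rfl
  · simp only [LinearMap.comp_apply, LinearMap.snd_apply, s_mul, extOp_apply, s_fst]
    abel

end SkewCoboundary

/-! ### The PBW deformation and its first order term -/

section Main

variable {k V G : Type*} [Field k] [AddCommGroup V] [Module k V] [Group G]
  [DistribMulAction G V] [SMulCommClass G k V]

namespace PBWDatum

variable {n : ℕ} (D : PBWDatum k V G) (x : Module.Basis (Fin n) k V)

/-- The PBW isomorphism, as a filtered isomorphism. -/
def filteredIso : FilteredIso k (Skew k V G) (Multiset (Fin n) × G) D.Alg (aGr k V G) where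
  e := skewBasis G x
  deg := degBasis
  gr_eq := aGr_eq_span x
  one_mem := one_mem_aGr
  mul_mem _ _ _ _ := aGr_mul_mem
  Φ := D.pbw x
  Φ_one := D.pbw_one x
  leading := D.pbw_leading_term x

theorem mul_apply (a b : Skew k V G) : (D.filteredIso x).mul a b =
    (D.pbw x).symm (D.pbw x a * D.pbw x b) := rfl

theorem mul_gA_gA (g h : G) : (D.filteredIso x).mul (gA k V g) (gA k V h) =
    gA k V g * gA k V h := by
  rw [mul_apply, LinearEquiv.symm_apply_eq, gA_mul_gA, pbw_gA, pbw_gA, pbw_gA, ← map_mul,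
    MonoidAlgebra.single_mul_single, one_mul]

theorem mul_vA_gA (v : V) (g : G) : (D.filteredIso x).mul (vA k V G v) (gA k V g) =
    vA k V G v * gA k V g := by
  rw [mul_apply, LinearEquiv.symm_apply_eq, pbw_vA_mul_gA, pbw_gA, pbw_vA]

theorem mul_gA_vA (g : G) (v : V) : (D.filteredIso x).mul (gA k V g) (vA k V G v) =
    gA k V g * vA k V G v + kgA k V G (D.lam (MonoidAlgebra.single g 1) v) := by
  rw [mul_apply, LinearEquiv.symm_apply_eq, gA_mul_vA, map_add, pbw_vA_mul_gA, pbw_gA, pbw_vA,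
    pbw_kgA, ← hG_mul_hV]
  abel

theorem mul_vA_vA (v w : V) : (D.filteredIso x).mul (vA k V G v) (vA k V G w) =
    (D.filteredIso x).mul (vA k V G w) (vA k V G v) + kgA k V G (D.kap v w) := by
  rw [mul_apply, mul_apply, LinearEquiv.symm_apply_eq, map_add, LinearEquiv.apply_symm_apply,
    pbw_vA, pbw_vA, pbw_kgA, ← hV_mul_hV]
  abel

theorem μ_one_gA_gA (g h : G) :
    (D.filteredIso x).deformation.μ 1 (gA k V g) (gA k V h) = 0 :=
  (D.filteredIso x).μ_one_eq (p := 0) (q := 0) (gA_mem_aGr g) (gA_mem_aGr h) (zero_mem _)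
    (by rw [mul_gA_gA, sub_self, sub_zero]; exact zero_mem _)

theorem μ_one_vA_gA (v : V) (g : G) :
    (D.filteredIso x).deformation.μ 1 (vA k V G v) (gA k V g) = 0 :=
  (D.filteredIso x).μ_one_eq (p := 1) (q := 0) (vA_mem_aGr v) (gA_mem_aGr g) (zero_mem _)
    (by rw [mul_vA_gA, sub_self, sub_zero]; exact zero_mem _)

theorem μ_one_gA_vA (g : G) (v : V) : (D.filteredIso x).deformation.μ 1 (gA k V g) (vA k V G v) =
    kgA k V G (D.lam (MonoidAlgebra.single g 1) v) :=
  (D.filteredIso x).μ_one_eq (p := 0) (q := 1) (gA_mem_aGr g) (vA_mem_aGr v)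
    (by simpa using kgA_mem_aGr _)
    (by rw [mul_gA_vA, add_sub_cancel_left, sub_self]; exact zero_mem _)

/-- The commutator κ(v,w) lies in degree 0, two below vw, so it is invisible to first order. -/
theorem μ_one_vA_vA (v w : V) : (D.filteredIso x).deformation.μ 1 (vA k V G v) (vA k V G w) =
    (D.filteredIso x).deformation.μ 1 (vA k V G w) (vA k V G v) := by
  set F := D.filteredIso x with hF
  refine F.μ_one_eq (p := 1) (q := 1) (vA_mem_aGr v) (vA_mem_aGr w)
    (F.deformation.graded 1 1 1 _ (vA_mem_aGr w) _ (vA_mem_aGr v)) ?_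
  have h := add_mem (F.mul_sub_mem_below (m := 1) (p := 1) (q := 1) (by norm_num)
    (vA_mem_aGr w) (vA_mem_aGr v))
    (F.mem_below_of_mem_gr (m := 1) (by norm_num) (kgA_mem_aGr (D.kap v w)))
  rw [hF, mul_vA_vA, vA_mul_vA_comm v w, ← hF]
  convert h using 1
  abel

/-- The PBW isomorphism can be changed such that the first order term of the product is a given
cocycle with the same values on generators. -/
theorem exists_filteredIso [FiniteDimensional k V]
    {μ : Skew k V G →ₗ[k] Skew k V G →ₗ[k] Skew k V G}
    (hc : ∀ a b d, a * μ b d - μ (a * b) d + μ a (b * d) - μ a b * d = 0)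
    (h1 : ∀ a, μ 1 a = 0) (h1' : ∀ a, μ a 1 = 0)
    (hgg : ∀ g h, μ (gA k V g) (gA k V h) = 0)
    (hvg : ∀ v g, μ (vA k V G v) (gA k V g) = 0)
    (hgv : ∀ g v, μ (gA k V g) (vA k V G v) = kgA k V G (D.lam (MonoidAlgebra.single g 1) v))
    (hvw : ∀ v w, μ (vA k V G v) (vA k V G w) = μ (vA k V G w) (vA k V G v))
    (hdeg : ∀ p q a b, a ∈ aGr k V G p → b ∈ aGr k V G q → μ a b ∈ aGr k V G (p + q - 1)) :
    ∃ F : FilteredIso k (Skew k V G) (Multiset (Fin (Module.finrank k V)) × G) D.Alg (aGr k V G),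
      ∀ a b, F.deformation.μ 1 a b = μ a b := by
  set F := D.filteredIso (Module.finBasis k V) with hF
  -- Twisting by β subtracts its coboundary from μ₁, so β is chosen for the difference of μ₁ and the
  -- desired cocycle.
  obtain ⟨β, hβ, hβ1, h⟩ := exists_coboundary (c := F.deformation.μ 1 - μ)
    (fun a b d => by
      simp only [LinearMap.sub_apply, mul_sub, sub_mul]
      linear_combination (norm := abel) F.μ_one_cocycle a b d - hc a b d)
    (fun a => by simp [F.μ_one_one_left, h1])
    (fun a => by simp [F.μ_one_one_right, h1'])
    (fun g h => by simp [hF, μ_one_gA_gA, hgg])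
    (fun g v => by simp [hF, μ_one_gA_vA, μ_one_vA_gA, hgv, hvg])
    (fun v w => by simp only [LinearMap.sub_apply, hF, μ_one_vA_vA D _ v w, hvw v w])
    (fun p q a b ha hb => sub_mem (F.deformation.graded 1 p q a ha b hb) (hdeg p q a b ha hb))
  refine ⟨F.twist β hβ hβ1, fun a b => ?_⟩
  rw [F.twist_μ_one, h]
  simp

/-- The datum given by a Poisson structure `λ` and a cochain `κ` which satisfy the conditions
`[λ, λ] = 2 d^* κ` and `[λ, κ] = 0`. -/
def ofCochains [FiniteDimensional k V] (Ψ : BarToX k V G) (lam kap : Cochain2 k V G)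
    (hc : dStar k lam = 0)
    (hdeg : HasDegree (x2Gr k V G) (aGr k V G) lam (-1))
    (hvanish : ∀ x : X k V G 0 2, lam (0, 0, x) = 0)
    (hsquare : halfSquare Ψ lam = dStar k kap)
    (hbracket : bracket Ψ lam kap = 0) : PBWDatum k V G where
  lam := linLam Ψ lam
  kap := linKap Ψ kap
  kap_self v := by rw [linKap_apply', sub_self]
  lam_mul g h v := by
    rw [linLam_single, linLam_single, linLam_single, pullBil_gA_mul hc hdeg, map_add, projkG_mul,
      projkG_mul, projkG_gA, projkG_gA]
  kap_smul := linKap_smul hc hdeg hvanish hsquare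
  lam_swap := linLam_swap hc hdeg hvanish
  kap_cyclic := linKap_cyclic hvanish hsquare
  lam_cyclic := linLam_cyclic hc hdeg hvanish hbracket

end PBWDatum

end Main

end SkewDeformation

end

open SkewDeformation in
theorem mainTheorem7 {k V G : Type*} [Field k] [AddCommGroup V] [Module k V]
    [FiniteDimensional k V] [Group G] [Finite G] [DistribMulAction G V] [SMulCommClass G k V]
    (Ψ : BarToX k V G) (lam kap : Cochain2 k V G)
    (hPoisson : IsNCPoisson Ψ lam)
    (hdeg : HasDegree (x2Gr k V G) (aGr k V G) lam (-1))
    (hvanish : ∀ x : X k V G 0 2, lam (0, 0, x) = 0)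
    (hsquare : halfSquare Ψ lam = dStar k kap)
    (hbracket : bracket Ψ lam kap = 0) :
    ∃ D : GradedDeformation k (Skew k V G) (aGr k V G),
      (∀ a b, D.μ 1 a b = pullψ Ψ lam (a ⊗ₜ[k] b)) ∧
      Nonempty (HAlg (paramLam lam) (paramKap kap) ≃ₐ[k] D.FiberOne) := by
  have hc := hPoisson.cocycle
  let D := PBWDatum.ofCochains Ψ lam kap hc hdeg hvanish hsquare hbracket
  obtain ⟨F, hF⟩ := D.exists_filteredIso (μ := pullBil Ψ lam) (pullBil_cocycle hc)
    (pullBil_one_left hc hdeg) (pullBil_one_right hc hdeg)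
    (fun g h => pullBil_aGr_zero hdeg (gA_mem_aGr g) (gA_mem_aGr h)) (pullBil_vA_gA hc hdeg)
    (fun g v => ((congrArg _ (linLam_single g v)).trans
      (kgA_projkG (pullBil_gA_vA_mem hdeg g v))).symm)
    (pullBil_vA_swap hvanish) (fun _ _ _ _ => pullBil_mem hdeg)
  -- The datum was built from ψ^*λ(g,v), which equals λ(1 ⊗ g ⊗ v ⊗ 1) because ψ^*λ vanishes on the
  -- pairs (v,g).
  have hlam : (fun g v => D.lam (MonoidAlgebra.single g 1) v) = paramLam lam :=
    funext fun g => funext fun v => by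
      rw [paramLam, ← pullBil_gA_vA (Ψ := Ψ) hc hdeg]
      exact linLam_single g v
  have hkap : (fun v w => D.kap v w) = paramKap kap :=
    funext fun v => funext fun w => linKap_apply v w
  refine ⟨F.deformation, hF, ?_⟩
  rw [← hlam, ← hkap]
  exact ⟨F.fiberEquiv⟩
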